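/- Let $(\Omega,\mathcal F,P)$ be a probability space and $X=\{X_t\}_{t\ge 0}$ a (time-inhomogeneous) Markov chain with right-continuous paths with left limits (RCLL), whose state space is the set of unit vectors $\{e_1,\dots,e_N\}\subset\mathbb R^N$, with bounded measurable rate matrices $A_t$ (where $(A_t)_{ji}$, $j\ne i$, is the rate of the jump $e_i\to e_j$ and the columns of $A_t$ sum to $0$). Let $\{\mathcal F_t\}$ be its completed natural filtration and $M_t=X_t-X_0-\int_0^tA_sX_s\,ds$ the associated martingale. Put $$\Psi_t=\operatorname{diag}(A_tX_{t-})-\operatorname{diag}(X_{t-})A_t'-A_t\operatorname{diag}(X_{t-}),\qquad \|z\|_{X_t}^2=z'\Psi_tz\quad(z\in\mathbb R^N).$$ Let $T\geq 0$, $c',c''\ge 0$. Then there is a constant $C>0$ depending only on $c',c'',T$ such that the following holds for every such chain. Let * $\xi\in L^2(\mathcal F_T)$; * $f:\Omega\times[0,T]\times\mathbb R\times\mathbb R^N\to\mathbb R$ be measurable with respect to the product of the predictable $\sigma$-field and the Borel $\sigma$-field, with $E\int_0^T|f(t,0,0)|^2dt<\infty$ and, almost surely, for all $0<t\le T$, $$|f(t,v_1,z_1)-f(t,v_2,z_2)|\le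 c'|v_1-v_2|+c''\|z_1-z_2\|_{X_t}\quad (v_i\in\mathbb R,\ z_i\in\mathbb R^N),$$ where $c''\,\|\Psi_t^{\dagger}\|\sqrt{6m}<1$ almost surely for all $0<t\le T$; here $\Psi_t^\dagger$ is the Moore–Penrose pseudoinverse, $\|\cdot\|$ the operator norm on Euclidean $\mathbb R^N$, and $m>0$ a bound of $\|A_t\|$ on $[0,T]$; * $G$ be a real measurable process with $E[\sup_{0\le t\le T}(G_t^+)^2]<\infty$. Let $(V,Z,K)$ be a solution of the reflected BSDE, i.e. $V$ is adapted and RCLL with $E\int_0^T|V_t|^2dt<\infty$, $Z$ is an $\mathbb R^N$-valued predictable process with $E\int_0^T\|Z_t\|_{X_t}^2dt<\infty$, $K_T\in L^2(\mathcal F_T)$, and almost surely $$V_t=\xi+\int_t^Tf(s,V_s,Z_s)\,ds+K_T-K_t-\int_t^TZ_s'\,dM_s,\qquad V_t\ge G_t,\qquad 0\le t\le T,$$ $K$ is continuous and increasing on $[0,T]$, $K_0=0$ and $\int_0^T(V_s-G_s)\,dK_s=0$. Then $$E\Big[\sup_{0\le t\le T}|V_t|^2\Big]+E\Big[\int_0^T\|Z_t\|^2_{X_t}dt\Big]+E\big[|K_T|^2\big]\le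 C\,E\Big[|\xi|^2+\sup_{0\le t\le T}(G_t^+)^2+\Big(\int_0^T|f(s,0,0)|\,ds\Big)^2\Big].$$ -/

import Mathlib

open MeasureTheory Filter Topology Matrix
open scoped NNReal ENNReal

noncomputable section

namespace MarkovRBSDE

/-- Lebesgue measure on the time axis `[0, ∞)`. -/
def leb : Measure ℝ≥0 := Measure.comap ((↑) : ℝ≥0 → ℝ) volume

/-- The rate matrices of a finite-state chain, in the convention `dX = A X dt + dM`: the entry
`A t j i` is the rate of the jump `i → j`, so columns sum to zero. The entries are bounded. -/
structure IsRateMatrix {N : ℕ} (A : ℝ≥0 → Matrix (Fin N) (Fin N) ℝ) : Prop where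
  measurable : ∀ i j, Measurable fun t => A t i j
  bounded : ∃ b : ℝ, ∀ t i j, |A t i j| ≤ b
  offDiag_nonneg : ∀ t i j, i ≠ j → 0 ≤ A t i j
  colSum_zero : ∀ t j, ∑ i, A t i j = 0

/-- `Φ s t` (for `s ≤ t`) are the transition matrices generated by `A`: the continuous solution of
the Kolmogorov forward equation `Φ(s,t) = I + ∫ₛᵗ A(u) Φ(s,u) du`. -/
structure IsTransitionFamily {N : ℕ} (A : ℝ≥0 → Matrix (Fin N) (Fin N) ℝ)
    (Φ : ℝ≥0 → ℝ≥0 → Matrix (Fin N) (Fin N) ℝ) : Prop where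
  continuousOn : ∀ s, ContinuousOn (Φ s) (Set.Ici s)
  forward : ∀ s t, s ≤ t → ∀ i j,
    Φ s t i j = (1 : Matrix (Fin N) (Fin N) ℝ) i j + ∫ u in Set.Ioc s t, (A u * Φ s u) i j ∂leb

/-- The completed natural filtration of a process: `σ(X_s, s ≤ t)` augmented by the null events. -/
def completedFiltration {Ω : Type*} [mΩ : MeasurableSpace Ω] {N : ℕ} (μ : Measure Ω)
    (X : ℝ≥0 → Ω → (Fin N → ℝ)) (hX : ∀ t, Measurable (X t)) : Filtration ℝ≥0 mΩ where
  seq t := (⨆ s ≤ t, MeasurableSpace.comap (X s) inferInstance) ⊔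
    MeasurableSpace.generateFrom {B | MeasurableSet B ∧ μ B = 0}
  mono' := fun _ _ hst =>
    sup_le_sup_right (biSup_mono fun _ hr => le_trans hr hst) _
  le' := fun _ =>
    sup_le (iSup₂_le fun r _ => (hX r).comap_le)
      (MeasurableSpace.generateFrom_le fun _ hB => hB.1)

/-- Right continuity with left limits on `[0, T]`. -/
def IsRCLLOn (T : ℝ≥0) {E : Type*} [TopologicalSpace E] (x : ℝ≥0 → E) : Prop :=
  (∀ t < T, ContinuousWithinAt x (Set.Ici t) t) ∧ ∀ t ≤ T, ∃ l, Tendsto x (𝓝[<] t) (𝓝 l)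

/-- A (time-inhomogeneous) Markov chain on the unit vectors `e_1, …, e_N` of `ℝ^N`, with RCLL paths
and rate matrices `A`. Since `X_t` is a unit vector, the coordinate `X_t j` is the indicator of
`X_t = e_j`, so `markov` says that the conditional probability of `X_t = e_j` given the past up to
time `s` is `(Φ(s,t) X_s)_j`. -/
structure MarkovChain {Ω : Type*} [MeasurableSpace Ω] (N : ℕ) (μ : Measure Ω) where
  X : ℝ≥0 → Ω → (Fin N → ℝ)
  A : ℝ≥0 → Matrix (Fin N) (Fin N) ℝ
  isRateMatrix : IsRateMatrix A
  measurable_X : ∀ t, Measurable (X t)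
  unitVector : ∀ t ω, ∃ i, X t ω = Pi.single i 1
  rcll : ∀ ω T, IsRCLLOn T fun t => X t ω
  markov : ∃ Φ, IsTransitionFamily A Φ ∧ ∀ s t, s ≤ t → ∀ j,
    μ[fun ω => X t ω j | completedFiltration μ X measurable_X s]
      =ᵐ[μ] fun ω => (Φ s t *ᵥ X s ω) j

namespace MarkovChain

variable {Ω : Type*} [mΩ : MeasurableSpace Ω] {N : ℕ} {μ : Measure Ω} (𝒳 : MarkovChain N μ)

/-- The completed filtration generated by the chain. -/
def filtration : Filtration ℝ≥0 mΩ := completedFiltration μ 𝒳.X 𝒳.measurable_X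

/-- The left limit `X_{t-}` (with `X_{0-} = X_0`). -/
def Xleft (t : ℝ≥0) (ω : Ω) : Fin N → ℝ := Function.leftLim (fun s => 𝒳.X s ω) t

/-- `Ψ_t = diag(A_t X_{t-}) - diag(X_{t-}) A_t' - A_t diag(X_{t-})`. -/
def Psi (t : ℝ≥0) (ω : Ω) : Matrix (Fin N) (Fin N) ℝ :=
  diagonal (𝒳.A t *ᵥ 𝒳.Xleft t ω) - diagonal (𝒳.Xleft t ω) * (𝒳.A t)ᵀ
    - 𝒳.A t * diagonal (𝒳.Xleft t ω)

/-- The squared semi-norm `‖z‖²_{X_t} = z' Ψ_t z`. -/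
def normSq (t : ℝ≥0) (ω : Ω) (z : Fin N → ℝ) : ℝ := z ⬝ᵥ (𝒳.Psi t ω *ᵥ z)

/-- The semi-norm `‖z‖_{X_t}`. -/
def seminorm (t : ℝ≥0) (ω : Ω) (z : Fin N → ℝ) : ℝ := √(𝒳.normSq t ω z)

/-- The stochastic integral `∫_{(s,t]} Z_u' dM_u` against `M_t = X_t - X_0 - ∫₀ᵗ A_u X_u du`. The
martingale `M` has paths of finite variation, with `dM_u = ΔX_u - A_u X_u du` and finitely many
jumps of `X` on bounded intervals, so the integral is the pathwise Lebesgue–Stieltjes integral. -/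
def integral (Z : ℝ≥0 → Ω → (Fin N → ℝ)) (s t : ℝ≥0) (ω : Ω) : ℝ :=
  (∑ᶠ u ∈ Set.Ioc s t, Z u ω ⬝ᵥ (𝒳.X u ω - 𝒳.Xleft u ω))
    - ∫ u in Set.Ioc s t, Z u ω ⬝ᵥ (𝒳.A u *ᵥ 𝒳.X u ω) ∂leb

/-- The space `L²(F_t)`. -/
def MemL2 (t : ℝ≥0) (ξ : Ω → ℝ) : Prop :=
  Measurable[𝒳.filtration t] ξ ∧ MemLp ξ 2 μ

end MarkovChain

/-- `P` is the Moore–Penrose pseudoinverse of `Q`. -/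
structure IsMoorePenrose {N : ℕ} (Q P : Matrix (Fin N) (Fin N) ℝ) : Prop where
  qpq : Q * P * Q = Q
  pqp : P * Q * P = P
  symm_qp : (Q * P)ᵀ = Q * P
  symm_pq : (P * Q)ᵀ = P * Q

/-- The norm of a matrix as an operator on Euclidean `ℝ^N`. -/
def matrixNorm {N : ℕ} (B : Matrix (Fin N) (Fin N) ℝ) : ℝ :=
  ‖Matrix.toEuclideanCLM (𝕜 := ℝ) (n := Fin N) B‖

/-- The conditions on the driver `f` on `[0, T]`: measurability with respect to the product of the
predictable and the Borel σ-algebra, the Lipschitz condition with constants `c'`, `c''`, the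
smallness of `c''`, and square integrability of `f(·,0,0)`. The semi-norm at time `t` is used for
`t > 0` only. -/
structure IsDriver {Ω : Type*} [MeasurableSpace Ω] {N : ℕ} {μ : Measure Ω} (𝒳 : MarkovChain N μ)
    (T : ℝ≥0) (c' c'' : ℝ) (f : ℝ≥0 → Ω → ℝ → (Fin N → ℝ) → ℝ) : Prop where
  measurable : Measurable[(𝒳.filtration.predictable).prod inferInstance]
    fun p : (ℝ≥0 × Ω) × (ℝ × (Fin N → ℝ)) => f p.1.1 p.1.2 p.2.1 p.2.2
  lipschitz : ∀ᵐ ω ∂μ, ∀ t, 0 < t → t ≤ T → ∀ v₁ v₂ z₁ z₂,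
    |f t ω v₁ z₁ - f t ω v₂ z₂| ≤ c' * |v₁ - v₂| + c'' * 𝒳.seminorm t ω (z₁ - z₂)
  small : ∃ m : ℝ, 0 < m ∧ (∀ t ≤ T, matrixNorm (𝒳.A t) ≤ m) ∧
    ∀ᵐ ω ∂μ, ∀ t, 0 < t → t ≤ T → ∀ P, IsMoorePenrose (𝒳.Psi t ω) P →
      c'' * matrixNorm P * √(6 * m) < 1
  sqIntegrable : ∫⁻ ω, ∫⁻ t in Set.Icc 0 T, ENNReal.ofReal (f t ω 0 0 ^ 2) ∂leb ∂μ < ∞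

/-- The conditions on the obstacle `G`: a measurable process with `E[sup_{t ≤ T} (G_t⁺)²] < ∞`. -/
structure IsObstacle {Ω : Type*} [MeasurableSpace Ω] (μ : Measure Ω) (T : ℝ≥0)
    (G : ℝ≥0 → Ω → ℝ) : Prop where
  measurable : Measurable (Function.uncurry G)
  sqIntegrable : ∫⁻ ω, ⨆ t ∈ Set.Icc 0 T, ENNReal.ofReal ((G t ω)⁺ ^ 2) ∂μ < ∞

/-- The Stieltjes function `t ↦ k (min t T)` of a path that is increasing and continuous on
`[0, T]`; its measure is `dk` on `[0, T]`. -/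
def pathStieltjes (T : ℝ≥0) (k : ℝ≥0 → ℝ) (hmono : MonotoneOn k (Set.Icc 0 T))
    (hcont : ContinuousOn k (Set.Icc 0 T)) : StieltjesFunction ℝ≥0 where
  toFun t := k (min t T)
  mono' := fun _ _ hst => hmono ⟨zero_le, min_le_right _ _⟩ ⟨zero_le, min_le_right _ _⟩
    (min_le_min_right T hst)
  right_continuous' := fun _ =>
    (hcont.comp_continuous (continuous_id.min continuous_const)
      fun _ => ⟨zero_le, min_le_right _ _⟩).continuousWithinAt

/-- `(V, Z, K)` solves the reflected BSDE driven by the chain, with terminal condition `ξ`, driver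
`f` and obstacle `G` on `[0, T]`. As `V ≥ G`, the integral `∫₀ᵀ (V_s - G_s) dK_s` is that of a
nonnegative function. -/
structure IsSolution {Ω : Type*} [MeasurableSpace Ω] {N : ℕ} {μ : Measure Ω} (𝒳 : MarkovChain N μ)
    (T : ℝ≥0) (ξ : Ω → ℝ) (f : ℝ≥0 → Ω → ℝ → (Fin N → ℝ) → ℝ) (G : ℝ≥0 → Ω → ℝ)
    (V : ℝ≥0 → Ω → ℝ) (Z : ℝ≥0 → Ω → (Fin N → ℝ)) (K : ℝ≥0 → Ω → ℝ) : Prop where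
  V_adapted : ∀ t ≤ T, Measurable[𝒳.filtration t] (V t)
  V_rcll : ∀ᵐ ω ∂μ, IsRCLLOn T fun t => V t ω
  V_sqIntegrable : ∫⁻ ω, ∫⁻ t in Set.Icc 0 T, ENNReal.ofReal (V t ω ^ 2) ∂leb ∂μ < ∞
  Z_predictable : IsStronglyPredictable 𝒳.filtration Z
  Z_sqIntegrable :
    ∫⁻ ω, ∫⁻ t in Set.Icc 0 T, ENNReal.ofReal (𝒳.normSq t ω (Z t ω)) ∂leb ∂μ < ∞
  K_memL2 : 𝒳.MemL2 T (K T)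
  equation : ∀ᵐ ω ∂μ, ∀ t ≤ T,
    V t ω = ξ ω + (∫ s in Set.Ioc t T, f s ω (V s ω) (Z s ω) ∂leb) + K T ω - K t ω
      - 𝒳.integral Z t T ω
  above : ∀ᵐ ω ∂μ, ∀ t ≤ T, G t ω ≤ V t ω
  K_zero : ∀ᵐ ω ∂μ, K 0 ω = 0
  reflection : ∀ᵐ ω ∂μ, ∃ (hmono : MonotoneOn (fun t => K t ω) (Set.Icc 0 T))
    (hcont : ContinuousOn (fun t => K t ω) (Set.Icc 0 T)),
    ∫⁻ s in Set.Icc 0 T, ENNReal.ofReal (V s ω - G s ω)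
      ∂(pathStieltjes T (fun t => K t ω) hmono hcont).measure = 0

end MarkovRBSDE

end

noncomputable section

namespace MarkovRBSDE

/-! ### Lebesgue measure on the half-line -/

/-! The proof treats `F_s = f(s, V_s, Z_s)` as a given process and studies the linear equation `dV =
-F dt - dK + Z' dM`. Three inequalities carry it, all obtained from telescoping sums along dyadic
partitions instead of an Itô formula.

Energy (`IsReflectedPath.energy_le`): telescoping `V²` over a partition of `[t, T]`, the cross terms
`V ∫ Z' dM` have mean zero, so the expected sum of squared increments of `V` is `E ξ² - E V_t²` plus
twice the expected Riemann sums of `∫ V F ds + ∫ V dK`. In the limit, Fatou bounds the squared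
increments from below by the squared jumps of `V`, whose expectation is `E ∫ ‖Z‖² ds`. An inequality
is enough.

Growth of `K` (`IsReflectedPath.integral_sq_K_le`): telescoping `(K_T - K_t)²` and solving the
equation for `K_T - K_t`, the stochastic integral after `t` is orthogonal to the increments of `K`
before `t`. This leaves `E K_T² ≤ 2 E ∫ V⁺ dK + 2 E [K_T (|ξ| + ∫ |F| ds)]`.

Supremum (`IsReflectedPath.exists_sup`): conditioning the equation on the past gives `|V_t| ≤ E[|ξ|
+ ∫ |F| ds + K_T | F_t]`, and Doob's inequality applies.

The reflection condition says that `dK` charges only times at which `V ≤ G`, so `∫ V⁺ dK` is at most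
`sup G⁺` times `K_T`. The Lipschitz condition bounds `|F|` by `|f(·,0,0)| + c'|V| + c''‖Z‖`. Young's
inequality leaves half of the energy on the left, and a backward Grönwall inequality bounds `E ∫ V²
ds` by a multiple of a number `a` containing `E ξ²` and two products of the unknowns `sup |V|`,
`K_T` with the data. Young's inequality with a small weight absorbs these products
(`exists_absorption_const`). The constants involve only `c'`, `c''` and `T`, never the rates or the
number of states.

What is needed about the chain is the compensation formula: for predictable `H`, the expected sum of
`H` over the jumps `i → j` is `E ∫ X^i A_{ji} H ds`. The Markov property and the forward equation
compensate the coordinates of `X`; counting transitions along dyadic partitions gives the formula on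
predictable rectangles, and a π-λ argument extends it (`MarkovChain.trim_jumpProd`). It yields both
the orthogonality of stochastic integrals to the past (`MarkovChain.integral_mul_integral_eq_zero`)
and the expected squared jumps (`MarkovChain.lintegral_sum_jumps_sq`). -/

theorem leb_apply (s : Set ℝ≥0) : leb s = volume (((↑) : ℝ≥0 → ℝ) '' s) :=
  (MeasurableEmbedding.subtype_coe measurableSet_Ici).comap_apply _ _

theorem leb_Ioc (a b : ℝ≥0) : leb (Set.Ioc a b) = ENNReal.ofReal (b - a) := by
  rw [leb_apply]
  have : ((↑) : ℝ≥0 → ℝ) '' Set.Ioc a b = Set.Ioc (a : ℝ) b := by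
    ext x
    constructor
    · rintro ⟨y, ⟨h1, h2⟩, rfl⟩
      exact ⟨by exact_mod_cast h1, by exact_mod_cast h2⟩
    · rintro ⟨h1, h2⟩
      exact ⟨⟨x, a.2.trans h1.le⟩, ⟨h1, h2⟩, rfl⟩
  rw [this, Real.volume_Ioc]

theorem leb_singleton (a : ℝ≥0) : leb {a} = 0 := by
  rw [leb_apply]; simp

instance : NullSingletonClass leb := ⟨leb_singleton⟩

instance : IsLocallyFiniteMeasure leb := by
  refine ⟨fun x => ⟨Set.Iio (x + 1), Iio_mem_nhds (by simp), ?_⟩⟩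
  have : Set.Iio (x + 1) ⊆ {0} ∪ Set.Ioc 0 (x + 1) := by
    intro y hy
    rcases eq_or_ne y 0 with h | h
    · simp [h]
    · exact Or.inr ⟨pos_iff_ne_zero.2 h, le_of_lt hy⟩
  refine (measure_mono this).trans_lt ((measure_union_le _ _).trans_lt ?_)
  rw [leb_singleton, leb_Ioc]
  simp

instance : SigmaFinite leb := inferInstance

theorem leb_real_Ioc {a b : ℝ≥0} (h : a ≤ b) : leb.real (Set.Ioc a b) = b - a := by
  rw [Measure.real, leb_Ioc, ENNReal.toReal_ofReal (sub_nonneg.2 (by exact_mod_cast h))]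

theorem leb_Icc_ae_eq (T : ℝ≥0) : Set.Icc 0 T =ᵐ[leb] Set.Ioc 0 T := Ioc_ae_eq_Icc.symm

/-! ### Dyadic partitions of an interval -/

/-- The `k`-th point of the partition of `[a, b]` into `2 ^ n` intervals of equal length. -/
def part (a b : ℝ≥0) (n k : ℕ) : ℝ≥0 := a + (b - a) * (k / 2 ^ n)

/-- The index of the partition interval containing `s`. -/
def idx (a b : ℝ≥0) (n : ℕ) (s : ℝ≥0) : ℕ := ⌈(s - a) / (b - a) * 2 ^ n⌉₊ - 1

variable {a b : ℝ≥0} {n k : ℕ} {s : ℝ≥0}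

@[simp] theorem part_zero : part a b n 0 = a := by simp [part]

theorem part_last (h : a ≤ b) : part a b n (2 ^ n) = b := by
  simp [part, add_tsub_cancel_of_le h]

theorem part_mono : Monotone (part a b n) := fun k l h => by
  unfold part; gcongr

theorem le_part : a ≤ part a b n k := by simp [part]

theorem part_le (h : a ≤ b) (hk : k ≤ 2 ^ n) : part a b n k ≤ b :=
  (part_mono hk).trans (part_last h).le

theorem part_le_succ : part a b n k ≤ part a b n (k + 1) := part_mono k.le_succ

/-- In the coordinate `x = (s - a) / (b - a)` both endpoint conditions compare an integer with `x *
2 ^ n`. Since `x > 0` the ceiling is positive, so the truncated subtraction in `idx` is exact and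
selects the cell open on the left and closed on the right. -/
theorem mem_Ioc_part_iff (hab : a < b) (hs : a < s) :
    s ∈ Set.Ioc (part a b n k) (part a b n (k + 1)) ↔ idx a b n s = k := by
  have hd : 0 < b - a := tsub_pos_of_lt hab
  obtain ⟨x, hx, rfl⟩ : ∃ x, 0 < x ∧ s = a + (b - a) * x := by
    refine ⟨(s - a) / (b - a), div_pos (tsub_pos_of_lt hs) hd, ?_⟩
    rw [mul_div_cancel₀ _ hd.ne', add_tsub_cancel_of_le hs.le]
  have hidx : idx a b n (a + (b - a) * x) = ⌈x * 2 ^ n⌉₊ - 1 := by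
    rw [idx, add_tsub_cancel_left, mul_div_cancel_left₀ _ hd.ne']
  have h2 : (0 : ℝ≥0) < 2 ^ n := by positivity
  have hpos : 0 < ⌈x * 2 ^ n⌉₊ := Nat.ceil_pos.2 (by positivity)
  have e1 : ∀ j : ℕ, part a b n j < a + (b - a) * x ↔ j < ⌈x * 2 ^ n⌉₊ := by
    intro j
    rw [part, add_lt_add_iff_left, mul_lt_mul_iff_right₀ hd, div_lt_iff₀ h2, Nat.lt_ceil]
  rw [hidx, Set.mem_Ioc, e1, ← not_lt, e1]
  omega

theorem idx_lt (hab : a < b) (hs : s ∈ Set.Ioc a b) : idx a b n s < 2 ^ n := by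
  by_contra! h
  have h1 := ((mem_Ioc_part_iff (n := n) hab hs.1).2 rfl).1
  have h2 : part a b n (2 ^ n) ≤ part a b n (idx a b n s) := part_mono h
  rw [part_last hab.le] at h2
  exact absurd hs.2 (not_le.2 (h2.trans_lt h1))

theorem part_idx_lt (hs : s ∈ Set.Ioc a b) : part a b n (idx a b n s) < s :=
  ((mem_Ioc_part_iff (hs.1.trans_le hs.2) hs.1).2 rfl).1

theorem le_part_idx_succ (hs : s ∈ Set.Ioc a b) : s ≤ part a b n (idx a b n s + 1) :=
  ((mem_Ioc_part_iff (hs.1.trans_le hs.2) hs.1).2 rfl).2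

theorem part_idx_succ_le (hs : s ∈ Set.Ioc a b) : part a b n (idx a b n s + 1) ≤ b :=
  part_le (hs.1.trans_le hs.2).le (idx_lt (hs.1.trans_le hs.2) hs)

theorem part_succ_eq : part a b n (k + 1) = part a b n k + (b - a) / 2 ^ n := by
  simp only [part, Nat.cast_add, Nat.cast_one, add_div, mul_add, add_assoc]
  simp [div_eq_mul_inv]

theorem tendsto_mesh : Tendsto (fun n : ℕ => (b - a) / 2 ^ n) atTop (𝓝 0) := by
  have h := (tendsto_pow_atTop_nhds_zero_of_lt_one (r := (1/2 : ℝ≥0)) (by simp)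
    (by rw [div_lt_one] <;> norm_num)).const_mul (b - a)
  simpa [div_eq_mul_inv] using h

theorem tendsto_part_idx_succ (hs : s ∈ Set.Ioc a b) :
    Tendsto (fun n => part a b n (idx a b n s + 1)) atTop (𝓝[≥] s) := by
  refine tendsto_nhdsWithin_iff.2 ⟨?_, Eventually.of_forall fun n => le_part_idx_succ hs⟩
  refine tendsto_of_tendsto_of_tendsto_of_le_of_le tendsto_const_nhds (?_ : Tendsto
    (fun n : ℕ => s + (b - a) / 2 ^ n) atTop (𝓝 s)) (fun n => le_part_idx_succ hs) fun n => ?_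
  · simpa using tendsto_mesh.const_add s
  · simp only [part_succ_eq]
    gcongr
    exact (part_idx_lt hs).le

theorem tendsto_part_idx (hs : s ∈ Set.Ioc a b) :
    Tendsto (fun n => part a b n (idx a b n s)) atTop (𝓝[<] s) := by
  refine tendsto_nhdsWithin_iff.2 ⟨?_, Eventually.of_forall fun n => part_idx_lt hs⟩
  refine tendsto_of_tendsto_of_tendsto_of_le_of_le (?_ : Tendsto
    (fun n : ℕ => s - (b - a) / 2 ^ n) atTop (𝓝 s)) tendsto_const_nhds (fun n => ?_)
    fun n => (part_idx_lt hs).le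
  · simpa using (tendsto_const_nhds (x := s)).sub (tendsto_mesh (a := a) (b := b))
  · refine tsub_le_iff_right.2 ?_
    rw [← part_succ_eq]
    exact le_part_idx_succ hs

theorem measurable_idx : Measurable (idx a b n) := by
  unfold idx
  have h1 : Measurable fun s : ℝ≥0 => ⌈(s - a) / (b - a) * 2 ^ n⌉₊ :=
    Nat.measurable_ceil.comp (by fun_prop)
  exact (measurable_from_nat (f := fun m => m - 1)).comp h1

/-- For `s < t` the left endpoint of the cell of `t` tends to `t`, so it eventually exceeds `s` and
separates the two points. Finiteness of `S` gives one threshold for all pairs. -/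
theorem eventually_injOn_idx {S : Set ℝ≥0} (hS : S.Finite) (hsub : S ⊆ Set.Ioc a b) :
    ∀ᶠ n in atTop, Set.InjOn (idx a b n) S := by
  have key : ∀ s ∈ S, ∀ t ∈ S, ∀ᶠ n in atTop, idx a b n s = idx a b n t → s = t := by
    have aux : ∀ s ∈ S, ∀ t ∈ S, s < t → ∀ᶠ n in atTop, idx a b n s ≠ idx a b n t := by
      intro s hs t ht hst
      have h := (tendsto_part_idx (hsub ht)).mono_right nhdsWithin_le_nhds
      filter_upwards [h.eventually (lt_mem_nhds hst)] with n hn he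
      rw [← he] at hn
      exact absurd (part_idx_lt (n := n) (hsub hs)) (not_lt.2 hn.le)
    intro s hs t ht
    rcases lt_trichotomy s t with h | h | h
    · filter_upwards [aux s hs t ht h] with n hn he using absurd he hn
    · exact Eventually.of_forall fun _ _ => h
    · filter_upwards [aux t ht s hs h] with n hn he using absurd he.symm hn
  have h2 : ∀ᶠ n in atTop, ∀ s ∈ S, ∀ t ∈ S, idx a b n s = idx a b n t → s = t :=
    (eventually_all_finite hS).2 fun s hs => (eventually_all_finite hS).2 fun t ht => key s hs t ht
  filter_upwards [h2] with n hn s hs t ht using hn s hs t ht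

theorem sum_indicator_part (hab : a < b) (hs : s ∈ Set.Ioc a b) (c : ℕ → ℝ) :
    ∑ k ∈ Finset.range (2 ^ n),
      (Set.Ioc (part a b n k) (part a b n (k + 1))).indicator (fun _ => c k) s
      = c (idx a b n s) := by
  rw [Finset.sum_eq_single (idx a b n s)]
  · rw [Set.indicator_of_mem]
    exact (mem_Ioc_part_iff hab hs.1).2 rfl
  · intro k _ hk
    rw [Set.indicator_of_notMem]
    intro h
    exact hk ((mem_Ioc_part_iff hab hs.1).1 h).symm
  · intro h
    exact absurd (Finset.mem_range.2 (idx_lt hab hs)) h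

theorem Ioc_part_subset (hab : a ≤ b) (hk : k < 2 ^ n) :
    Set.Ioc (part a b n k) (part a b n (k + 1)) ⊆ Set.Ioc a b :=
  Set.Ioc_subset_Ioc le_part (part_le hab hk)

/-- A Riemann sum is the integral of `f` against a step function, which makes its limit a question
of dominated convergence. The measure is arbitrary so that `ds` and `dK` are treated together. -/
theorem sum_mul_setIntegral_part (hab : a ≤ b) (ρ : Measure ℝ≥0) {f : ℝ≥0 → ℝ}
    (hf : IntegrableOn f (Set.Ioc a b) ρ) (c : ℕ → ℝ) :
    ∑ k ∈ Finset.range (2 ^ n), c k * ∫ s in Set.Ioc (part a b n k) (part a b n (k + 1)), f s ∂ρ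
      = ∫ s in Set.Ioc a b, c (idx a b n s) * f s ∂ρ := by
  rcases hab.eq_or_lt with rfl | hab'
  · simp [part]
  have h1 : ∀ k ∈ Finset.range (2 ^ n),
      c k * ∫ s in Set.Ioc (part a b n k) (part a b n (k + 1)), f s ∂ρ
      = ∫ s in Set.Ioc a b, (Set.Ioc (part a b n k) (part a b n (k + 1))).indicator
          (fun s => c k * f s) s ∂ρ := by
    intro k hk
    rw [setIntegral_indicator measurableSet_Ioc, Set.inter_eq_self_of_subset_right
      (Ioc_part_subset hab (Finset.mem_range.1 hk)), integral_const_mul]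
  rw [Finset.sum_congr rfl h1, ← integral_finsetSum]
  · refine setIntegral_congr_fun measurableSet_Ioc fun s hs => ?_
    have := sum_indicator_part (n := n) hab' hs c
    simp only [← this, Finset.sum_mul]
    refine Finset.sum_congr rfl fun k _ => ?_
    by_cases h : s ∈ Set.Ioc (part a b n k) (part a b n (k + 1)) <;> simp [h]
  · intro k _
    exact (hf.const_mul (c k)).indicator measurableSet_Ioc

/-- Riemann–Stieltjes sums along dyadic partitions converge by dominated convergence. -/
theorem tendsto_sum_mul_setIntegral_part (hab : a ≤ b) (ρ : Measure ℝ≥0) {f : ℝ≥0 → ℝ}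
    (hf : IntegrableOn f (Set.Ioc a b) ρ) {c : ℕ → ℕ → ℝ} {C : ℝ}
    (hC : ∀ n, ∀ k < 2 ^ n, |c n k| ≤ C) {h : ℝ≥0 → ℝ}
    (hlim : ∀ᵐ s ∂ρ.restrict (Set.Ioc a b), Tendsto (fun n => c n (idx a b n s)) atTop (𝓝 (h s))) :
    Tendsto (fun n => ∑ k ∈ Finset.range (2 ^ n),
      c n k * ∫ s in Set.Ioc (part a b n k) (part a b n (k + 1)), f s ∂ρ) atTop
      (𝓝 (∫ s in Set.Ioc a b, h s * f s ∂ρ)) := by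
  rcases hab.eq_or_lt with rfl | hab'
  · simp [part]
  simp_rw [sum_mul_setIntegral_part hab ρ hf]
  refine tendsto_integral_of_dominated_convergence (fun s => C * |f s|) ?_ ?_ ?_ ?_
  · intro n
    refine AEStronglyMeasurable.mul ?_ hf.aestronglyMeasurable
    exact ((measurable_from_nat (f := c n)).comp measurable_idx).aestronglyMeasurable
  · exact hf.abs.const_mul C
  · intro n
    filter_upwards [ae_restrict_mem measurableSet_Ioc] with s hs
    rw [norm_mul, Real.norm_eq_abs, Real.norm_eq_abs]
    gcongr
    exact hC n _ (idx_lt hab' hs)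
  · filter_upwards [hlim] with s hs using hs.mul_const _

end MarkovRBSDE
end

/-! ### Paths of the chain: left limits, jump times, observed transitions -/

noncomputable section

namespace MarkovRBSDE

/-- Removing the finitely many other values leaves a neighbourhood of `x`. This turns limits along
paths of the chain into eventual equalities. -/
theorem eventually_eq_of_tendsto_of_finite {α E : Type*} [TopologicalSpace E] [T1Space E]
    {l : Filter α} {u : α → E} {x : E} {F : Set E} (hF : F.Finite) (hu : ∀ a, u a ∈ F)
    (h : Tendsto u l (𝓝 x)) : ∀ᶠ a in l, u a = x := by
  have h1 : (F \ {x})ᶜ ∈ 𝓝 x := (hF.subset Set.sdiff_subset).isClosed.isOpen_compl.mem_nhds (by simp)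
  filter_upwards [h.eventually h1] with a ha
  by_contra hne
  exact ha ⟨hu a, hne⟩

theorem finite_inter_of_eventually_notMem {α : Type*} [TopologicalSpace α] {K S : Set α}
    (hK : IsCompact K) (h : ∀ x, ∀ᶠ y in 𝓝[≠] x, y ∉ S) : (K ∩ S).Finite := by
  refine hK.induction_on (p := fun s => (s ∩ S).Finite) (by simp) ?_ ?_ ?_
  · intro s t hst ht
    exact ht.subset (Set.inter_subset_inter_left _ hst)
  · intro s t hs ht
    rw [Set.union_inter_distrib_right]
    exact hs.union ht
  · intro x _
    refine ⟨{y | y ≠ x → y ∉ S}, nhdsWithin_le_nhds (eventually_nhdsWithin_iff.1 (h x)), ?_⟩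
    refine (Set.finite_singleton x).subset ?_
    rintro y ⟨hy, hyS⟩
    by_contra hne
    exact hy hne hyS

namespace MarkovChain

variable {Ω : Type*} [mΩ : MeasurableSpace Ω] {N : ℕ} {μ : Measure Ω} (𝒳 : MarkovChain N μ)

/-- The standard unit vectors of `ℝ^N`. -/
def states (N : ℕ) : Set (Fin N → ℝ) := Set.range fun i => Pi.single i (1 : ℝ)

theorem finite_states (N : ℕ) : (states N).Finite := Set.finite_range _

theorem X_mem_states (t : ℝ≥0) (ω : Ω) : 𝒳.X t ω ∈ states N := by
  obtain ⟨i, hi⟩ := 𝒳.unitVector t ω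
  exact ⟨i, hi.symm⟩

theorem tendsto_Xleft (t : ℝ≥0) (ω : Ω) :
    Tendsto (fun s => 𝒳.X s ω) (𝓝[<] t) (𝓝 (𝒳.Xleft t ω)) :=
  tendsto_leftLim_of_tendsto ((𝒳.rcll ω t).2 t le_rfl)

theorem eventually_eq_Xleft (t : ℝ≥0) (ω : Ω) :
    ∀ᶠ s in 𝓝[<] t, 𝒳.X s ω = 𝒳.Xleft t ω :=
  eventually_eq_of_tendsto_of_finite (finite_states N) (fun s => 𝒳.X_mem_states s ω)
    (𝒳.tendsto_Xleft t ω)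

theorem continuousWithinAt_X (t : ℝ≥0) (ω : Ω) :
    ContinuousWithinAt (fun s => 𝒳.X s ω) (Set.Ici t) t :=
  (𝒳.rcll ω (t + 1)).1 t (by simp)

theorem eventually_eq_X (t : ℝ≥0) (ω : Ω) : ∀ᶠ s in 𝓝[≥] t, 𝒳.X s ω = 𝒳.X t ω :=
  eventually_eq_of_tendsto_of_finite (finite_states N) (fun s => 𝒳.X_mem_states s ω)
    (𝒳.continuousWithinAt_X t ω)

/-- The hypothesis on the value at `t` serves the time `0`, where there is no left neighbourhood and
the left limit is the value itself. -/
theorem Xleft_eq_of_eventually {t : ℝ≥0} {ω : Ω} {x : Fin N → ℝ} (h : 𝒳.X t ω = x)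
    (h' : ∀ᶠ s in 𝓝[<] t, 𝒳.X s ω = x) : 𝒳.Xleft t ω = x := by
  rcases eq_or_neBot (𝓝[<] t) with hb | hb
  · rw [Xleft, leftLim_eq_of_eq_bot _ hb, h]
  · obtain ⟨s, hs, hs'⟩ := (h'.and (𝒳.eventually_eq_Xleft t ω)).exists
    rw [← hs', hs]

theorem Xleft_mem_states (t : ℝ≥0) (ω : Ω) : 𝒳.Xleft t ω ∈ states N := by
  rcases eq_or_neBot (𝓝[<] t) with hb | hb
  · rw [Xleft, leftLim_eq_of_eq_bot _ hb]
    exact 𝒳.X_mem_states t ω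
  · obtain ⟨s, hs⟩ := (𝒳.eventually_eq_Xleft t ω).exists
    rw [← hs]
    exact 𝒳.X_mem_states s ω

/-- The path is constant on a short interval to each side of `t`, so jump times do not accumulate at
`t`; on a compact interval they are therefore finite in number. -/
theorem eventually_Xleft_eq_X (t : ℝ≥0) (ω : Ω) : ∀ᶠ s in 𝓝[≠] t, 𝒳.Xleft s ω = 𝒳.X s ω := by
  rw [← Set.Iio_union_Ioi, nhdsWithin_union, eventually_sup]
  constructor
  · have h := 𝒳.eventually_eq_Xleft t ω
    filter_upwards [h, eventually_eventually_nhdsWithin.2 h, self_mem_nhdsWithin] with s h1 h2 h3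
    rw [h1]
    exact 𝒳.Xleft_eq_of_eventually h1 (nhdsWithin_mono _ (Set.Iio_subset_Iio (le_of_lt h3)) h2)
  · have h : ∀ᶠ s in 𝓝[>] t, 𝒳.X s ω = 𝒳.X t ω :=
      nhdsWithin_mono _ Set.Ioi_subset_Ici_self (𝒳.eventually_eq_X t ω)
    filter_upwards [h, eventually_eventually_nhdsWithin.2 h, self_mem_nhdsWithin] with s h1 h2 h3
    rw [h1]
    refine 𝒳.Xleft_eq_of_eventually h1 ?_
    rw [isOpen_Ioi.nhdsWithin_eq h3] at h2
    exact nhdsWithin_le_nhds h2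

/-- The jump times of the chain in `(a, b]`. -/
def jumpTimes (a b : ℝ≥0) (ω : Ω) : Set ℝ≥0 := {s ∈ Set.Ioc a b | 𝒳.X s ω ≠ 𝒳.Xleft s ω}

theorem finite_jumpTimes (a b : ℝ≥0) (ω : Ω) : (𝒳.jumpTimes a b ω).Finite := by
  refine (finite_inter_of_eventually_notMem (isCompact_Icc (a := a) (b := b))
    (S := {s | 𝒳.X s ω ≠ 𝒳.Xleft s ω}) fun t => ?_).subset ?_
  · filter_upwards [𝒳.eventually_Xleft_eq_X t ω] with s hs h
    exact h hs.symm
  · rintro s ⟨hs, hs'⟩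
    exact ⟨Set.Ioc_subset_Icc_self hs, hs'⟩

/-- The finite set of jump times of the chain in `(a, b]`. -/
def jumps (a b : ℝ≥0) (ω : Ω) : Finset ℝ≥0 := (𝒳.finite_jumpTimes a b ω).toFinset

theorem mem_jumps {a b s : ℝ≥0} {ω : Ω} :
    s ∈ 𝒳.jumps a b ω ↔ s ∈ Set.Ioc a b ∧ 𝒳.X s ω ≠ 𝒳.Xleft s ω := by
  simp [jumps, jumpTimes]

theorem jumps_subset (a b : ℝ≥0) (ω : Ω) : (𝒳.jumps a b ω : Set ℝ≥0) ⊆ Set.Ioc a b :=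
  fun _ hs => (𝒳.mem_jumps.1 hs).1

/-- Without jumps the path is continuous on an interval with values in a finite, hence discrete,
set. -/
theorem X_eq_of_no_jump {a b : ℝ≥0} (hab : a ≤ b) {ω : Ω}
    (h : ∀ s ∈ Set.Ioc a b, 𝒳.X s ω = 𝒳.Xleft s ω) : 𝒳.X a ω = 𝒳.X b ω := by
  refine isPreconnected_Icc.constant_of_mapsTo (S := Set.Icc a b) (T := states N)
    (f := fun s => 𝒳.X s ω) (finite_states N).isDiscrete ?_ (fun s _ => 𝒳.X_mem_states s ω)
    (Set.left_mem_Icc.2 hab) (Set.right_mem_Icc.2 hab)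
  intro s hs
  have h1 := 𝒳.continuousWithinAt_X s ω
  rcases hs.1.eq_or_lt with rfl | hlt
  · exact h1.mono fun x hx => hx.1
  · have h2 : ContinuousWithinAt (fun s => 𝒳.X s ω) (Set.Iio s) s := by
      have := 𝒳.tendsto_Xleft s ω
      rwa [← h s ⟨hlt, hs.2⟩] at this
    refine (h2.union h1).mono fun x _ => ?_
    simp

/-- Finitely many jump times are null for every measure without atoms. Both `ds` and `dK` are of
this kind. -/
theorem ae_Xleft_eq_X (ω : Ω) (ρ : Measure ℝ≥0) [NullSingletonClass ρ] (a b : ℝ≥0) :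
    ∀ᵐ s ∂ρ.restrict (Set.Ioc a b), 𝒳.Xleft s ω = 𝒳.X s ω := by
  have h : ∀ᵐ s ∂ρ, s ∉ 𝒳.jumpTimes a b ω :=
    measure_eq_zero_iff_ae_notMem.1 ((𝒳.finite_jumpTimes a b ω).measure_zero ρ)
  filter_upwards [ae_restrict_of_ae h, ae_restrict_mem measurableSet_Ioc] with s hs hs'
  by_contra hne
  exact hs ⟨hs', fun e => hne e.symm⟩

section coordinates

variable {x : Fin N → ℝ}

theorem states_nonneg (hx : x ∈ states N) (i : Fin N) : 0 ≤ x i := by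
  obtain ⟨j, rfl⟩ := hx
  by_cases h : i = j <;> simp [h]

theorem states_le_one (hx : x ∈ states N) (i : Fin N) : x i ≤ 1 := by
  obtain ⟨j, rfl⟩ := hx
  by_cases h : i = j <;> simp [h]

theorem states_mul (hx : x ∈ states N) (i j : Fin N) : x i * x j = if i = j then x i else 0 := by
  obtain ⟨l, rfl⟩ := hx
  simp only [Pi.single_apply]
  split_ifs <;> simp_all

theorem states_sum (hx : x ∈ states N) (g : Fin N → ℝ) :
    ∃ l, (∀ i, x i = if i = l then 1 else 0) ∧ ∑ i, x i * g i = g l := by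
  obtain ⟨l, rfl⟩ := hx
  exact ⟨l, fun i => by simp [Pi.single_apply], by simp [Pi.single_apply]⟩

end coordinates

theorem X_nonneg (t : ℝ≥0) (ω : Ω) (i : Fin N) : 0 ≤ 𝒳.X t ω i :=
  states_nonneg (𝒳.X_mem_states t ω) i

theorem X_le_one (t : ℝ≥0) (ω : Ω) (i : Fin N) : 𝒳.X t ω i ≤ 1 :=
  states_le_one (𝒳.X_mem_states t ω) i

theorem abs_X_le_one (t : ℝ≥0) (ω : Ω) (i : Fin N) : |𝒳.X t ω i| ≤ 1 := by
  rw [abs_of_nonneg (𝒳.X_nonneg t ω i)]; exact 𝒳.X_le_one t ω i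

/-- Along fine dyadic partitions, the observed transitions `i → j` are the jumps `i → j`. -/
theorem tendsto_sum_transitions {a b : ℝ≥0} (hab : a ≤ b) (ω : Ω) {i j : Fin N} (hij : i ≠ j) :
    Tendsto (fun n => ∑ k ∈ Finset.range (2 ^ n),
      𝒳.X (part a b n k) ω i * 𝒳.X (part a b n (k + 1)) ω j) atTop
      (𝓝 (∑ s ∈ 𝒳.jumps a b ω, 𝒳.Xleft s ω i * 𝒳.X s ω j)) := by
  refine Tendsto.congr' (f₁ := fun n => ∑ s ∈ 𝒳.jumps a b ω,
    𝒳.X (part a b n (idx a b n s)) ω i * 𝒳.X (part a b n (idx a b n s + 1)) ω j) ?_ ?_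
  -- Once distinct jumps lie in distinct cells, the sum reduces to the cells that contain a jump: in
  -- any other cell the two endpoint states coincide and the product of different coordinates
  -- vanishes.
  · filter_upwards [eventually_injOn_idx (𝒳.jumps a b ω).finite_toSet (𝒳.jumps_subset a b ω)]
      with n hn
    rcases hab.eq_or_lt with rfl | hab'
    · have : 𝒳.jumps a a ω = ∅ := by
        ext s; simp [mem_jumps]
      have hz := states_mul (𝒳.X_mem_states a ω) i j
      rw [if_neg hij] at hz
      simp [this, part, hz]
    rw [← Finset.sum_image (f := fun k => 𝒳.X (part a b n k) ω i * 𝒳.X (part a b n (k + 1)) ω j) hn]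
    refine Finset.sum_subset ?_ ?_
    · intro k hk
      obtain ⟨s, hs, rfl⟩ := Finset.mem_image.1 hk
      exact Finset.mem_range.2 (idx_lt hab' (𝒳.jumps_subset a b ω hs))
    · intro k hk hk'
      have : 𝒳.X (part a b n k) ω = 𝒳.X (part a b n (k + 1)) ω := by
        refine 𝒳.X_eq_of_no_jump part_le_succ fun s hs => ?_
        by_contra hne
        have hs' := Ioc_part_subset hab (Finset.mem_range.1 hk) hs
        refine hk' (Finset.mem_image.2 ⟨s, 𝒳.mem_jumps.2 ⟨hs', hne⟩, ?_⟩)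
        exact (mem_Ioc_part_iff hab' hs'.1).1 hs
      rw [this, states_mul (𝒳.X_mem_states _ ω), if_neg hij]
  · refine tendsto_finsetSum _ fun s hs => ?_
    have hs' := 𝒳.jumps_subset a b ω hs
    refine Tendsto.mul ?_ ?_
    · exact ((continuous_apply i).tendsto _).comp
        ((𝒳.tendsto_Xleft s ω).comp (tendsto_part_idx hs'))
    · exact ((continuous_apply j).tendsto _).comp
        ((𝒳.continuousWithinAt_X s ω).tendsto.comp (tendsto_part_idx_succ hs'))

/-- A cell with an observed transition contains at least one jump. The bound does not depend on `n`
and becomes the dominating function in `setIntegral_jumpCount`. -/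
theorem sum_transitions_le {a b : ℝ≥0} (hab : a ≤ b) (ω : Ω) {i j : Fin N} (hij : i ≠ j) (n : ℕ) :
    ∑ k ∈ Finset.range (2 ^ n), 𝒳.X (part a b n k) ω i * 𝒳.X (part a b n (k + 1)) ω j
      ≤ (𝒳.jumps a b ω).card := by
  rcases hab.eq_or_lt with rfl | hab'
  · have hz := states_mul (𝒳.X_mem_states a ω) i j
    rw [if_neg hij] at hz
    simp [part, hz]
  rw [Finset.card_eq_sum_card_fiberwise (f := idx a b n) (t := Finset.range (2 ^ n))
    fun s hs => Finset.mem_coe.2 (Finset.mem_range.2 (idx_lt hab' (𝒳.jumps_subset a b ω hs)))]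
  push_cast
  refine Finset.sum_le_sum fun k hk => ?_
  by_cases hX : 𝒳.X (part a b n k) ω = 𝒳.X (part a b n (k + 1)) ω
  · rw [hX, states_mul (𝒳.X_mem_states _ ω), if_neg hij]
    positivity
  · have hex : ∃ s ∈ Set.Ioc (part a b n k) (part a b n (k + 1)), 𝒳.X s ω ≠ 𝒳.Xleft s ω := by
      by_contra! h
      exact hX (𝒳.X_eq_of_no_jump part_le_succ h)
    obtain ⟨s, hs, hne⟩ := hex
    have hs' := Ioc_part_subset hab (Finset.mem_range.1 hk) hs
    have hmem : s ∈ {s ∈ 𝒳.jumps a b ω | idx a b n s = k} :=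
      Finset.mem_filter.2 ⟨𝒳.mem_jumps.2 ⟨hs', hne⟩, (mem_Ioc_part_iff hab' hs'.1).1 hs⟩
    have h1 : (1 : ℝ) ≤ ({s ∈ 𝒳.jumps a b ω | idx a b n s = k} : Finset ℝ≥0).card := by
      exact_mod_cast Finset.card_pos.2 ⟨s, hmem⟩
    refine le_trans ?_ h1
    exact mul_le_one₀ (𝒳.X_le_one _ _ _) (𝒳.X_nonneg _ _ _) (𝒳.X_le_one _ _ _)

end MarkovChain

end MarkovRBSDE
end

/-! ### Joint measurability and compensation of the coordinates by the drift -/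

noncomputable section

namespace MarkovRBSDE

/-- A right-continuous adapted process is jointly measurable up to a fixed time. -/
theorem measurable_stopped_of_rightContinuous {Ω : Type*} {m : MeasurableSpace Ω}
    {Y : ℝ≥0 → Ω → ℝ} {t : ℝ≥0} (hY : ∀ s ≤ t, Measurable (Y s))
    (hc : ∀ ω, ∀ s < t, ContinuousWithinAt (fun s => Y s ω) (Set.Ici s) s) :
    Measurable fun p : ℝ≥0 × Ω => Y (min p.1 t) p.2 := by
  -- Times are rounded up to the grid of mesh `2⁻ⁿ` and capped at `t`: rounding up matches right
  -- continuity, and the cap ensures that nothing after `t` is read.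
  let ρ : ℕ → ℝ≥0 → ℝ≥0 := fun n s => min (⌈s * 2 ^ n⌉₊ / 2 ^ n) t
  have hge : ∀ n s, s ≤ t → s ≤ ρ n s := fun n s hs =>
    le_min ((le_div_iff₀ (by positivity)).2 (Nat.le_ceil _)) hs
  have hle : ∀ n s, ρ n s ≤ s + 1 / 2 ^ n := fun n s => by
    refine (min_le_left _ _).trans ((div_le_iff₀ (by positivity)).2 ?_)
    have h2 : (2 : ℝ≥0) ^ n ≠ 0 := by positivity
    have := (Nat.ceil_lt_add_one (zero_le (a := s * 2 ^ n))).le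
    rwa [add_mul, one_div, inv_mul_cancel₀ h2]
  refine measurable_of_tendsto_metrizable (f := fun n (p : ℝ≥0 × Ω) => Y (ρ n p.1) p.2) ?_ ?_
  · intro n
    have h1 : Measurable fun q : ℕ × Ω => Y (min (q.1 / 2 ^ n) t) q.2 :=
      measurable_from_prod_countable_right fun k => hY (min (k / 2 ^ n) t) (min_le_right _ _)
    have h2 : Measurable fun p : ℝ≥0 × Ω => (⌈p.1 * 2 ^ n⌉₊, p.2) :=
      (Nat.measurable_ceil.comp (by fun_prop)).prodMk measurable_snd
    have h3 := h1.comp h2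
    simp only [Function.comp_def] at h3
    simpa only [ρ] using h3
  · rw [tendsto_pi_nhds]
    rintro ⟨s, ω⟩
    rcases lt_or_ge s t with hs | hs
    · simp only [min_eq_left hs.le]
      refine (hc ω s hs).tendsto.comp (tendsto_nhdsWithin_iff.2
        ⟨?_, Eventually.of_forall fun n => hge n s hs.le⟩)
      refine tendsto_of_tendsto_of_tendsto_of_le_of_le tendsto_const_nhds
        (?_ : Tendsto (fun n : ℕ => s + 1 / 2 ^ n) atTop (𝓝 s)) (fun n => hge n s hs.le)
        fun n => hle n s
      have := (tendsto_mesh (a := 0) (b := 1)).const_add s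
      simpa using this
    · have : ∀ n, ρ n s = t := fun n => min_eq_right
        (hs.trans ((le_div_iff₀ (by positivity)).2 (Nat.le_ceil _)))
      simp [this, min_eq_right hs]

namespace MarkovChain

variable {Ω : Type*} [mΩ : MeasurableSpace Ω] {N : ℕ} {μ : Measure Ω} (𝒳 : MarkovChain N μ)

theorem measurable_X_filtration {s t : ℝ≥0} (hst : s ≤ t) :
    Measurable[𝒳.filtration t] (𝒳.X s) := by
  rw [measurable_iff_comap_le]
  refine le_trans ?_ (le_sup_left (b := MeasurableSpace.generateFrom {B | MeasurableSet B ∧ μ B = 0}))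
  exact le_iSup₂ (f := fun s (_ : s ≤ t) => MeasurableSpace.comap (𝒳.X s) inferInstance) s hst

theorem measurable_X_apply_filtration {s t : ℝ≥0} (hst : s ≤ t) (i : Fin N) :
    Measurable[𝒳.filtration t] fun ω => 𝒳.X s ω i :=
  (measurable_pi_apply i).comp (𝒳.measurable_X_filtration hst)

theorem measurable_X_apply (s : ℝ≥0) (i : Fin N) : Measurable fun ω => 𝒳.X s ω i :=
  (measurable_pi_apply i).comp (𝒳.measurable_X s)

theorem measurable_stopped_X (t : ℝ≥0) (i : Fin N) :
    Measurable[Prod.instMeasurableSpace (m₂ := 𝒳.filtration t)]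
      fun p : ℝ≥0 × Ω => 𝒳.X (min p.1 t) p.2 i :=
  measurable_stopped_of_rightContinuous (m := 𝒳.filtration t)
    (Y := fun s ω => 𝒳.X s ω i) (fun _ hs => 𝒳.measurable_X_apply_filtration hs i)
    fun ω s _ => (continuous_apply i).continuousAt.comp_continuousWithinAt
      (𝒳.continuousWithinAt_X s ω)

theorem measurable_uncurry_X (i : Fin N) : Measurable fun p : ℝ≥0 × Ω => 𝒳.X p.1 p.2 i := by
  have h : ∀ n : ℕ, Measurable fun p : ℝ≥0 × Ω => 𝒳.X (min p.1 n) p.2 i := fun n =>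
    measurable_stopped_of_rightContinuous (Y := fun s ω => 𝒳.X s ω i)
      (fun s _ => 𝒳.measurable_X_apply s i)
      fun ω s _ => (continuous_apply i).continuousAt.comp_continuousWithinAt
        (𝒳.continuousWithinAt_X s ω)
  refine measurable_of_tendsto_metrizable h ?_
  rw [tendsto_pi_nhds]
  rintro ⟨s, ω⟩
  refine tendsto_const_nhds.congr' ?_
  obtain ⟨n, hn⟩ := exists_nat_ge s
  filter_upwards [eventually_ge_atTop n] with k hk
  have : s ≤ (k : ℝ≥0) := hn.trans (by exact_mod_cast hk)
  simp [min_eq_left this]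

/-- The drift `(A_t X_t)_j` of the `j`-th coordinate. -/
def drift (j : Fin N) (t : ℝ≥0) (ω : Ω) : ℝ := (𝒳.A t *ᵥ 𝒳.X t ω) j

theorem measurable_uncurry_drift (j : Fin N) :
    Measurable fun p : ℝ≥0 × Ω => 𝒳.drift j p.1 p.2 := by
  simp only [drift, mulVec, dotProduct]
  refine Finset.measurable_sum _ fun i _ => Measurable.mul ?_ (𝒳.measurable_uncurry_X i)
  exact (𝒳.isRateMatrix.measurable j i).comp measurable_fst

theorem measurable_drift_left (j : Fin N) (ω : Ω) : Measurable fun s => 𝒳.drift j s ω :=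
  (𝒳.measurable_uncurry_drift j).comp (measurable_id.prodMk measurable_const)

theorem exists_rate_bound : ∃ b : ℝ, 0 ≤ b ∧ ∀ t i j, |𝒳.A t i j| ≤ b := by
  obtain ⟨b, hb⟩ := 𝒳.isRateMatrix.bounded
  exact ⟨max b 0, le_max_right _ _, fun t i j => (hb t i j).trans (le_max_left _ _)⟩

theorem drift_eq (j : Fin N) (t : ℝ≥0) (ω : Ω) : ∃ l, 𝒳.drift j t ω = 𝒳.A t j l := by
  obtain ⟨l, -, hl⟩ := states_sum (𝒳.X_mem_states t ω) fun i => 𝒳.A t j i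
  exact ⟨l, by simp only [drift, mulVec, dotProduct, ← hl, mul_comm]⟩

theorem abs_drift_le {b : ℝ} (hb : ∀ t i j, |𝒳.A t i j| ≤ b) (j : Fin N) (t : ℝ≥0) (ω : Ω) :
    |𝒳.drift j t ω| ≤ b := by
  obtain ⟨l, hl⟩ := 𝒳.drift_eq j t ω
  rw [hl]; exact hb t j l

theorem integrableOn_drift (j : Fin N) (u v : ℝ≥0) (ω : Ω) :
    IntegrableOn (fun s => 𝒳.drift j s ω) (Set.Ioc u v) leb := by
  obtain ⟨b, -, hb⟩ := 𝒳.exists_rate_bound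
  refine Measure.integrableOn_of_bounded (M := b) (by rw [leb_Ioc]; simp)
    (𝒳.measurable_drift_left j ω).aestronglyMeasurable ?_
  exact Eventually.of_forall fun s => 𝒳.abs_drift_le hb j s ω

theorem measurable_integral_drift (j : Fin N) (u v : ℝ≥0) :
    Measurable fun ω => ∫ r in Set.Ioc u v, 𝒳.drift j r ω ∂leb :=
  ((𝒳.measurable_uncurry_drift j).stronglyMeasurable.integral_prod_left').measurable

theorem abs_integral_drift_le {b : ℝ} (hb : ∀ t i j, |𝒳.A t i j| ≤ b) (j : Fin N) {u v : ℝ≥0}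
    (huv : u ≤ v) (ω : Ω) : |∫ r in Set.Ioc u v, 𝒳.drift j r ω ∂leb| ≤ b * (v - u) := by
  have h := norm_setIntegral_le_of_norm_le_const (μ := leb) (s := Set.Ioc u v) (C := b)
    (f := fun r => 𝒳.drift j r ω) (by rw [leb_Ioc]; simp) (fun r _ => 𝒳.abs_drift_le hb j r ω)
  rwa [leb_real_Ioc huv, Real.norm_eq_abs] at h

section probability

variable [IsProbabilityMeasure μ]

theorem integrable_X (t : ℝ≥0) (i : Fin N) : Integrable (fun ω => 𝒳.X t ω i) μ :=
  Integrable.of_bound (𝒳.measurable_X_apply t i).aestronglyMeasurable 1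
    (Eventually.of_forall fun ω => 𝒳.abs_X_le_one t ω i)

/-- The increments of the coordinates are compensated by the drift. -/
theorem setIntegral_X {s t : ℝ≥0} (hst : s ≤ t) {B : Set Ω}
    (hB : MeasurableSet[𝒳.filtration s] B) (j : Fin N) :
    ∫ ω in B, 𝒳.X t ω j ∂μ = ∫ ω in B, 𝒳.X s ω j ∂μ
      + ∫ ω in B, ∫ r in Set.Ioc s t, 𝒳.drift j r ω ∂leb ∂μ := by
  obtain ⟨Φ, hΦ, hmk'⟩ := 𝒳.markov
  have hmk : ∀ s t, s ≤ t → ∀ j, μ[fun ω => 𝒳.X t ω j | 𝒳.filtration s]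
      =ᵐ[μ] fun ω => (Φ s t *ᵥ 𝒳.X s ω) j := hmk'
  obtain ⟨b, -, hb⟩ := 𝒳.exists_rate_bound
  have hB' : MeasurableSet B := 𝒳.filtration.le s B hB
  set β : Fin N → ℝ := fun l => ∫ ω in B, 𝒳.X s ω l ∂μ with hβ
  -- The Markov property tested on `B` says that the vector `E[1_B X_r]` is `Φ(s,r) β`; it therefore
  -- inherits the forward equation in `r`, and Fubini identifies the integral term with the expected
  -- drift.
  have key : ∀ r, s ≤ r → ∀ l, ∫ ω in B, 𝒳.X r ω l ∂μ = ∑ q, Φ s r l q * β q := by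
    intro r hr l
    rw [← setIntegral_condExp (𝒳.filtration.le s) (𝒳.integrable_X r l) hB,
      integral_congr_ae (ae_restrict_of_ae (hmk s r hr l))]
    simp only [mulVec, dotProduct]
    rw [integral_finsetSum _ fun q _ => ((𝒳.integrable_X s q).const_mul _).integrableOn]
    simp [integral_const_mul, hβ]
  have hintg : ∀ l q, IntegrableOn (fun u => (𝒳.A u * Φ s u) l q) (Set.Ioc s t) leb := by
    intro l q
    simp only [Matrix.mul_apply]
    refine integrable_finsetSum _ fun p _ => ?_
    have hcont : ContinuousOn (fun u => Φ s u p q) (Set.Icc s t) :=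
      ((continuous_apply_apply p q).comp_continuousOn (hΦ.continuousOn s)).mono fun u hu => hu.1
    have h1 : IntegrableOn (fun u => Φ s u p q) (Set.Ioc s t) leb :=
      (hcont.integrableOn_compact isCompact_Icc).mono_set Set.Ioc_subset_Icc_self
    exact h1.bdd_mul (c := b) (𝒳.isRateMatrix.measurable l p).aestronglyMeasurable
      (Eventually.of_forall fun u => hb u l p)
  have hfub : ∫ ω in B, ∫ r in Set.Ioc s t, 𝒳.drift j r ω ∂leb ∂μ
      = ∫ r in Set.Ioc s t, ∫ ω in B, 𝒳.drift j r ω ∂μ ∂leb := by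
    have hfin : IsFiniteMeasure (leb.restrict (Set.Ioc s t)) :=
      ⟨by rw [Measure.restrict_apply_univ, leb_Ioc]; simp⟩
    refine integral_integral_swap (f := fun ω r => 𝒳.drift j r ω) ?_
    refine Integrable.of_bound ?_ b (Eventually.of_forall fun p => 𝒳.abs_drift_le hb j p.2 p.1)
    exact ((𝒳.measurable_uncurry_drift j).comp measurable_swap).aestronglyMeasurable
  rw [hfub, key t hst j]
  have h2 : ∀ r ∈ Set.Ioc s t, ∫ ω in B, 𝒳.drift j r ω ∂μ
      = ∑ q, (𝒳.A r * Φ s r) j q * β q := by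
    intro r hr
    simp only [drift, mulVec, dotProduct]
    rw [integral_finsetSum _ fun q _ => ((𝒳.integrable_X r q).const_mul _).integrableOn]
    simp_rw [integral_const_mul, key r hr.1.le, Matrix.mul_apply, Finset.sum_mul, Finset.mul_sum]
    rw [Finset.sum_comm]
    simp only [mul_assoc]
  rw [setIntegral_congr_fun measurableSet_Ioc h2,
    integral_finsetSum _ fun q _ => (hintg j q).mul_const _]
  simp_rw [integral_mul_const, hΦ.forward s t hst, add_mul, Finset.sum_add_distrib]
  congr 1
  simp [Matrix.one_apply, hβ]

/-- For a cell starting at `p`, the event `B ∩ {X_p = e_i}` is known at time `p`, and on it the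
coordinate `j ≠ i` starts from zero. The expected transition is then the expected drift of that
coordinate over the cell. -/
theorem setIntegral_sum_transitions {u v : ℝ≥0} {B : Set Ω}
    (hB : MeasurableSet[𝒳.filtration u] B) {i j : Fin N} (hij : i ≠ j) (n : ℕ) :
    ∫ ω in B, ∑ k ∈ Finset.range (2 ^ n),
        𝒳.X (part u v n k) ω i * 𝒳.X (part u v n (k + 1)) ω j ∂μ
      = ∫ ω in B, ∑ k ∈ Finset.range (2 ^ n), 𝒳.X (part u v n k) ω i *
          ∫ r in Set.Ioc (part u v n k) (part u v n (k + 1)), 𝒳.drift j r ω ∂leb ∂μ := by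
  obtain ⟨b, hb0, hb⟩ := 𝒳.exists_rate_bound
  rw [integral_finsetSum, integral_finsetSum]
  · refine Finset.sum_congr rfl fun k _ => ?_
    set p := part u v n k
    set p' := part u v n (k + 1)
    have hC : MeasurableSet[𝒳.filtration p] (B ∩ {ω | 𝒳.X p ω i = 1}) :=
      MeasurableSet.inter (𝒳.filtration.mono le_part B hB)
        (𝒳.measurable_X_apply_filtration le_rfl i (measurableSet_singleton 1))
    have hB' : MeasurableSet B := 𝒳.filtration.le u B hB
    have hS : MeasurableSet {ω | 𝒳.X p ω i = 1} :=
      𝒳.measurable_X_apply p i (measurableSet_singleton 1)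
    have hind : ∀ g : Ω → ℝ, ∫ ω in B, 𝒳.X p ω i * g ω ∂μ
        = ∫ ω in B ∩ {ω | 𝒳.X p ω i = 1}, g ω ∂μ := by
      intro g
      rw [← setIntegral_indicator hS]
      congr 1
      ext ω
      obtain ⟨l, hl, -⟩ := states_sum (𝒳.X_mem_states p ω) fun _ => 0
      by_cases h : i = l <;> simp [Set.indicator, hl, h]
    rw [hind, hind, 𝒳.setIntegral_X part_le_succ hC j]
    have hz : ∫ ω in B ∩ {ω | 𝒳.X p ω i = 1}, 𝒳.X p ω j ∂μ = 0 := by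
      rw [← hind]
      simp [states_mul (𝒳.X_mem_states p _), hij]
    rw [hz, zero_add]
  · intro k _
    refine Integrable.of_bound ?_ (1 * (b * (part u v n (k + 1) - part u v n k)))
      (Eventually.of_forall fun ω => ?_)
    · exact ((𝒳.measurable_X_apply _ i).mul
        (𝒳.measurable_integral_drift j _ _)).aestronglyMeasurable
    · rw [norm_mul]
      exact mul_le_mul (𝒳.abs_X_le_one _ _ _) (𝒳.abs_integral_drift_le hb j part_le_succ ω)
        (norm_nonneg _) zero_le_one
  · intro k _
    refine Integrable.of_bound ?_ (1 * 1) (Eventually.of_forall fun ω => ?_)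
    · exact ((𝒳.measurable_X_apply _ i).mul (𝒳.measurable_X_apply _ j)).aestronglyMeasurable
    · rw [norm_mul]
      exact mul_le_mul (𝒳.abs_X_le_one _ _ _) (𝒳.abs_X_le_one _ _ _)
        (norm_nonneg _) zero_le_one

end probability

end MarkovChain

end MarkovRBSDE
end

/-! ### Jump counts and their compensators on rectangles -/

noncomputable section

namespace MarkovRBSDE

namespace MarkovChain

variable {Ω : Type*} [mΩ : MeasurableSpace Ω] {N : ℕ} {μ : Measure Ω} (𝒳 : MarkovChain N μ)

theorem Xleft_nonneg (t : ℝ≥0) (ω : Ω) (i : Fin N) : 0 ≤ 𝒳.Xleft t ω i :=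
  states_nonneg (𝒳.Xleft_mem_states t ω) i

/-- The number of jumps `i → j` in `(u, v]`. -/
def jumpCount (i j : Fin N) (u v : ℝ≥0) (ω : Ω) : ℝ :=
  ∑ s ∈ 𝒳.jumps u v ω, 𝒳.Xleft s ω i * 𝒳.X s ω j

theorem jumpCount_nonneg (i j : Fin N) (u v : ℝ≥0) (ω : Ω) : 0 ≤ 𝒳.jumpCount i j u v ω :=
  Finset.sum_nonneg fun s _ => mul_nonneg (𝒳.Xleft_nonneg s ω i) (𝒳.X_nonneg s ω j)

theorem measurable_jumpCount {u v : ℝ≥0} (huv : u ≤ v) {i j : Fin N} (hij : i ≠ j) :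
    Measurable[𝒳.filtration v] (𝒳.jumpCount i j u v) := by
  refine @measurable_of_tendsto_metrizable _ _ (𝒳.filtration v) _ _ _ _
    (fun n ω => ∑ k ∈ Finset.range (2 ^ n),
      𝒳.X (part u v n k) ω i * 𝒳.X (part u v n (k + 1)) ω j) _ (fun n => ?_) ?_
  · refine Finset.measurable_sum _ fun k hk => ?_
    have hk' := Finset.mem_range.1 hk
    exact (𝒳.measurable_X_apply_filtration (part_le huv hk'.le) i).mul
      (𝒳.measurable_X_apply_filtration (part_le huv hk') j)
  · rw [tendsto_pi_nhds]
    exact fun ω => 𝒳.tendsto_sum_transitions huv ω hij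

theorem jump_weights_sum {u v : ℝ≥0} {ω : Ω} {s : ℝ≥0} (hs : s ∈ 𝒳.jumps u v ω) :
    ∑ i, ∑ j ∈ Finset.univ.erase i, 𝒳.Xleft s ω i * 𝒳.X s ω j = 1 := by
  obtain ⟨l, hl, -⟩ := states_sum (𝒳.Xleft_mem_states s ω) fun _ => 0
  obtain ⟨l', hl', -⟩ := states_sum (𝒳.X_mem_states s ω) fun _ => 0
  have hne : l' ≠ l := by
    rintro rfl
    exact (𝒳.mem_jumps.1 hs).2 (funext fun i => by rw [hl, hl'])
  simp only [hl, hl', ← Finset.mul_sum]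
  rw [Finset.sum_eq_single l]
  · simp [Finset.sum_ite_eq', hne]
  · intro i _ hi
    simp [hi]
  · simp

theorem card_jumps_eq (u v : ℝ≥0) (ω : Ω) :
    ((𝒳.jumps u v ω).card : ℝ) = ∑ i, ∑ j ∈ Finset.univ.erase i, 𝒳.jumpCount i j u v ω := by
  simp only [jumpCount]
  simp_rw [Finset.sum_comm (t := 𝒳.jumps u v ω)]
  rw [Finset.sum_congr rfl fun s hs => 𝒳.jump_weights_sum hs]
  simp

/-- The sum is one integral of the drift with a weight of absolute value at most one, hence a bound
free of `n`. -/
theorem abs_sum_X_mul_integral_drift_le {b : ℝ} (hb : ∀ t i j, |𝒳.A t i j| ≤ b)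
    {u v : ℝ≥0} (huv : u ≤ v) (i j : Fin N) (n : ℕ) (ω : Ω) :
    |∑ k ∈ Finset.range (2 ^ n), 𝒳.X (part u v n k) ω i *
      ∫ r in Set.Ioc (part u v n k) (part u v n (k + 1)), 𝒳.drift j r ω ∂leb| ≤ b * (v - u) := by
  rw [sum_mul_setIntegral_part huv leb (𝒳.integrableOn_drift j u v ω)
    fun k => 𝒳.X (part u v n k) ω i]
  have h := norm_setIntegral_le_of_norm_le_const (μ := leb) (s := Set.Ioc u v) (C := b)
    (f := fun r => 𝒳.X (part u v n (idx u v n r)) ω i * 𝒳.drift j r ω) (by rw [leb_Ioc]; simp)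
    (fun r _ => by
      rw [norm_mul, Real.norm_eq_abs, Real.norm_eq_abs]
      exact (mul_le_mul (𝒳.abs_X_le_one _ _ _) (𝒳.abs_drift_le hb j r ω) (abs_nonneg _)
        zero_le_one).trans (one_mul b).le)
  rwa [leb_real_Ioc huv, Real.norm_eq_abs] at h

section probability

variable [IsProbabilityMeasure μ]

/-- Fatou along the dyadic counts, whose expectations equal those of the drift sums and are at most
`b * (v - u)`. Integrability has to come first, because the number of jumps is the dominating
function in the exact compensation formula. -/
theorem lintegral_jumpCount_lt_top {u v : ℝ≥0} (huv : u ≤ v) {i j : Fin N} (hij : i ≠ j) :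
    ∫⁻ ω, ENNReal.ofReal (𝒳.jumpCount i j u v ω) ∂μ < ∞ := by
  obtain ⟨b, hb0, hb⟩ := 𝒳.exists_rate_bound
  have hmeas : ∀ n, Measurable fun ω => ∑ k ∈ Finset.range (2 ^ n),
      𝒳.X (part u v n k) ω i * 𝒳.X (part u v n (k + 1)) ω j := fun n =>
    Finset.measurable_sum _ fun k _ => (𝒳.measurable_X_apply _ i).mul (𝒳.measurable_X_apply _ j)
  have hnn : ∀ n ω, 0 ≤ ∑ k ∈ Finset.range (2 ^ n),
      𝒳.X (part u v n k) ω i * 𝒳.X (part u v n (k + 1)) ω j := fun n ω =>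
    Finset.sum_nonneg fun k _ => mul_nonneg (𝒳.X_nonneg _ _ _) (𝒳.X_nonneg _ _ _)
  have h1 : ∀ n, ∫⁻ ω, ENNReal.ofReal (∑ k ∈ Finset.range (2 ^ n),
      𝒳.X (part u v n k) ω i * 𝒳.X (part u v n (k + 1)) ω j) ∂μ ≤ ENNReal.ofReal (b * (v - u)) := by
    intro n
    rw [← ofReal_integral_eq_lintegral_ofReal _ (Eventually.of_forall (hnn n))]
    · refine ENNReal.ofReal_le_ofReal ?_
      have h := 𝒳.setIntegral_sum_transitions (u := u) (v := v) MeasurableSet.univ hij n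
      rw [setIntegral_univ, setIntegral_univ] at h
      rw [h]
      refine (le_abs_self _).trans ?_
      rw [← Real.norm_eq_abs]
      refine (norm_integral_le_of_norm_le_const (C := b * (v - u)) (Eventually.of_forall
        fun ω => ?_)).trans (by simp)
      exact 𝒳.abs_sum_X_mul_integral_drift_le hb huv i j n ω
    · refine Integrable.of_bound (hmeas n).aestronglyMeasurable ((2 : ℝ) ^ n)
        (Eventually.of_forall fun ω => ?_)
      rw [Real.norm_of_nonneg (hnn n ω)]
      refine (Finset.sum_le_card_nsmul _ _ 1 fun k _ => ?_).trans (by simp)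
      exact mul_le_one₀ (𝒳.X_le_one _ _ _) (𝒳.X_nonneg _ _ _) (𝒳.X_le_one _ _ _)
  refine lt_of_le_of_lt ?_ (ENNReal.ofReal_lt_top (r := b * (v - u)))
  calc ∫⁻ ω, ENNReal.ofReal (𝒳.jumpCount i j u v ω) ∂μ
      = ∫⁻ ω, liminf (fun n => ENNReal.ofReal (∑ k ∈ Finset.range (2 ^ n),
        𝒳.X (part u v n k) ω i * 𝒳.X (part u v n (k + 1)) ω j)) atTop ∂μ := by
        refine lintegral_congr fun ω => ?_
        exact ((ENNReal.continuous_ofReal.tendsto _).comp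
          (𝒳.tendsto_sum_transitions huv ω hij)).liminf_eq.symm
    _ ≤ liminf (fun n => ∫⁻ ω, ENNReal.ofReal (∑ k ∈ Finset.range (2 ^ n),
        𝒳.X (part u v n k) ω i * 𝒳.X (part u v n (k + 1)) ω j) ∂μ) atTop :=
        lintegral_liminf_le fun n => (hmeas n).ennreal_ofReal
    _ ≤ ENNReal.ofReal (b * (v - u)) :=
        liminf_le_of_le (by isBoundedDefault) fun c hc => by
          obtain ⟨n, hn⟩ := hc.exists
          exact hn.trans (h1 n)

theorem integrable_jumpCount {u v : ℝ≥0} (huv : u ≤ v) {i j : Fin N} (hij : i ≠ j) :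
    Integrable (𝒳.jumpCount i j u v) μ := by
  refine ⟨((𝒳.measurable_jumpCount huv hij).mono (𝒳.filtration.le v) le_rfl).aestronglyMeasurable,
    ?_⟩
  rw [hasFiniteIntegral_iff_ofReal (Eventually.of_forall (𝒳.jumpCount_nonneg i j u v))]
  exact 𝒳.lintegral_jumpCount_lt_top huv hij

theorem integrable_card_jumps {u v : ℝ≥0} (huv : u ≤ v) :
    Integrable (fun ω => ((𝒳.jumps u v ω).card : ℝ)) μ := by
  simp_rw [card_jumps_eq]
  exact integrable_finsetSum _ fun i _ => integrable_finsetSum _ fun j hj =>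
    𝒳.integrable_jumpCount huv (Finset.ne_of_mem_erase hj).symm

/-- The compensation formula on the rectangles `(u, v] × B`. -/
theorem setIntegral_jumpCount {u v : ℝ≥0} (huv : u ≤ v) {B : Set Ω}
    (hB : MeasurableSet[𝒳.filtration u] B) {i j : Fin N} (hij : i ≠ j) :
    ∫ ω in B, 𝒳.jumpCount i j u v ω ∂μ
      = ∫ ω in B, ∫ r in Set.Ioc u v, 𝒳.X r ω i * 𝒳.A r j i ∂leb ∂μ := by
  obtain ⟨b, hb0, hb⟩ := 𝒳.exists_rate_bound
  have h1 : Tendsto (fun n => ∫ ω in B, ∑ k ∈ Finset.range (2 ^ n),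
      𝒳.X (part u v n k) ω i * 𝒳.X (part u v n (k + 1)) ω j ∂μ) atTop
      (𝓝 (∫ ω in B, 𝒳.jumpCount i j u v ω ∂μ)) := by
    refine tendsto_integral_of_dominated_convergence (fun ω => ((𝒳.jumps u v ω).card : ℝ))
      (fun n => ?_) (𝒳.integrable_card_jumps huv).integrableOn (fun n => ?_) ?_
    · exact (Finset.measurable_sum _ fun k _ => (𝒳.measurable_X_apply _ i).mul
        (𝒳.measurable_X_apply _ j)).aestronglyMeasurable
    · refine Eventually.of_forall fun ω => ?_
      rw [Real.norm_of_nonneg (Finset.sum_nonneg fun k _ =>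
        mul_nonneg (𝒳.X_nonneg _ _ _) (𝒳.X_nonneg _ _ _))]
      exact 𝒳.sum_transitions_le huv ω hij n
    · exact Eventually.of_forall fun ω => 𝒳.tendsto_sum_transitions huv ω hij
  -- The states at left endpoints converge to `X_{r-}`, which is `X_r` for almost every `r`; and
  -- `X^i (A X)_j = X^i A_{ji}` because `X` is a unit vector.
  have h2 : Tendsto (fun n => ∫ ω in B, ∑ k ∈ Finset.range (2 ^ n), 𝒳.X (part u v n k) ω i *
      ∫ r in Set.Ioc (part u v n k) (part u v n (k + 1)), 𝒳.drift j r ω ∂leb ∂μ) atTop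
      (𝓝 (∫ ω in B, ∫ r in Set.Ioc u v, 𝒳.X r ω i * 𝒳.A r j i ∂leb ∂μ)) := by
    refine tendsto_integral_of_dominated_convergence (fun _ => b * (v - u))
      (fun n => ?_) (integrable_const _) (fun n => ?_) ?_
    · exact (Finset.measurable_sum _ fun k _ => (𝒳.measurable_X_apply _ i).mul
        (𝒳.measurable_integral_drift j _ _)).aestronglyMeasurable
    · exact Eventually.of_forall fun ω =>
        𝒳.abs_sum_X_mul_integral_drift_le hb huv i j n ω
    · refine Eventually.of_forall fun ω => ?_
      have hlim := tendsto_sum_mul_setIntegral_part huv leb (𝒳.integrableOn_drift j u v ω)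
        (c := fun n k => 𝒳.X (part u v n k) ω i) (C := 1) (fun n k _ => 𝒳.abs_X_le_one _ _ _)
        (h := fun r => 𝒳.X r ω i) (by
          filter_upwards [𝒳.ae_Xleft_eq_X ω leb u v, ae_restrict_mem measurableSet_Ioc]
            with r hr hr'
          rw [← hr]
          exact ((continuous_apply i).tendsto _).comp
            ((𝒳.tendsto_Xleft r ω).comp (tendsto_part_idx hr')))
      convert hlim using 3
      ext r
      obtain ⟨l, hl, -⟩ := states_sum (𝒳.X_mem_states r ω) fun _ => 0
      simp only [drift, mulVec, dotProduct, hl]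
      by_cases h : i = l <;> simp [h]
  refine tendsto_nhds_unique h1 (h2.congr fun n => ?_)
  exact (𝒳.setIntegral_sum_transitions hB hij n).symm

end probability

end MarkovChain

end MarkovRBSDE
end

/-! ### The jump measure and the compensation formula for predictable integrands -/

noncomputable section

namespace MarkovRBSDE

open ProbabilityTheory in
-- Slicing the parameter space by the integer part of the total mass gives countably many uniformly
-- bounded kernels. This is needed because the number of jumps is finite for each scenario without
-- being bounded over all scenarios.
theorem isSFiniteKernel_of_isFiniteMeasure {α β : Type*} {mα : MeasurableSpace α}
    {mβ : MeasurableSpace β} (κ : Kernel α β) [∀ a, IsFiniteMeasure (κ a)] :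
    IsSFiniteKernel κ := by
  classical
  have hm : Measurable fun a => ⌊(κ a Set.univ).toReal⌋₊ :=
    Nat.measurable_floor.comp (κ.measurable_coe MeasurableSet.univ).ennreal_toReal
  have hS : ∀ n : ℕ, MeasurableSet {a | ⌊(κ a Set.univ).toReal⌋₊ = n} :=
    fun n => hm (measurableSet_singleton n)
  refine ⟨fun n => Kernel.piecewise (hS n) κ 0, fun n => ⟨n + 1, by simp, fun a => ?_⟩, ?_⟩
  · rw [Kernel.piecewise_apply]
    split_ifs with h
    · have h1 : (κ a Set.univ).toReal ≤ n + 1 := by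
        rw [← show ⌊(κ a Set.univ).toReal⌋₊ = n from h]
        exact (Nat.lt_floor_add_one _).le
      rw [← ENNReal.ofReal_toReal (measure_ne_top (κ a) Set.univ)]
      refine (ENNReal.ofReal_le_ofReal h1).trans ?_
      rw [ENNReal.ofReal_add (by positivity) zero_le_one]
      simp
    · simp
  · ext a s hs
    rw [Kernel.sum_apply' _ _ hs, tsum_eq_single ⌊(κ a Set.univ).toReal⌋₊]
    · simp [Kernel.piecewise_apply]
    · intro n hn
      simp [Kernel.piecewise_apply, hn.symm]

namespace MarkovChain

variable {Ω : Type*} [mΩ : MeasurableSpace Ω] {N : ℕ} {μ : Measure Ω} (𝒳 : MarkovChain N μ)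

theorem jumps_filter_le (a b v : ℝ≥0) (ω : Ω) :
    {s ∈ 𝒳.jumps a b ω | s ≤ v} = 𝒳.jumps a (min b v) ω := by
  ext s
  simp only [Finset.mem_filter, mem_jumps, Set.mem_Ioc, le_min_iff]
  tauto

theorem jumps_filter_lt {a u : ℝ≥0} (h : a ≤ u) (b : ℝ≥0) (ω : Ω) :
    {s ∈ 𝒳.jumps a b ω | u < s} = 𝒳.jumps u b ω := by
  ext s
  simp only [Finset.mem_filter, mem_jumps, Set.mem_Ioc]
  constructor
  · tauto
  · rintro ⟨⟨h1, h2⟩, h3⟩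
    exact ⟨⟨⟨h.trans_lt h1, h2⟩, h3⟩, h1⟩

/-- The measure counting the jumps `i → j` in `(0, T]`. -/
def jumpMeasure (i j : Fin N) (T : ℝ≥0) (ω : Ω) : Measure ℝ≥0 :=
  ∑ s ∈ 𝒳.jumps 0 T ω, ENNReal.ofReal (𝒳.Xleft s ω i * 𝒳.X s ω j) • Measure.dirac s

theorem lintegral_jumpMeasure (i j : Fin N) (T : ℝ≥0) (ω : Ω) (g : ℝ≥0 → ℝ≥0∞) :
    ∫⁻ s, g s ∂𝒳.jumpMeasure i j T ω
      = ∑ s ∈ 𝒳.jumps 0 T ω, ENNReal.ofReal (𝒳.Xleft s ω i * 𝒳.X s ω j) * g s := by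
  simp [jumpMeasure, lintegral_finsetSum_measure, lintegral_smul_measure, lintegral_dirac]

theorem integral_jumpMeasure (i j : Fin N) (T : ℝ≥0) (ω : Ω) (g : ℝ≥0 → ℝ) :
    ∫ s, g s ∂𝒳.jumpMeasure i j T ω
      = ∑ s ∈ 𝒳.jumps 0 T ω, 𝒳.Xleft s ω i * 𝒳.X s ω j * g s := by
  rw [jumpMeasure, integral_finsetSum_measure]
  · refine Finset.sum_congr rfl fun s _ => ?_
    rw [integral_smul_measure, integral_dirac, ENNReal.toReal_ofReal
      (mul_nonneg (𝒳.Xleft_nonneg s ω i) (𝒳.X_nonneg s ω j)), smul_eq_mul]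
  · intro s _
    exact (integrable_dirac (by simp)).smul_measure ENNReal.ofReal_ne_top

theorem jumpMeasure_apply (i j : Fin N) (T : ℝ≥0) (ω : Ω) {S : Set ℝ≥0} (hS : MeasurableSet S)
    [DecidablePred (· ∈ S)] :
    𝒳.jumpMeasure i j T ω S = ENNReal.ofReal
      (∑ s ∈ 𝒳.jumps 0 T ω with s ∈ S, 𝒳.Xleft s ω i * 𝒳.X s ω j) := by
  rw [← lintegral_indicator_one hS, lintegral_jumpMeasure, ENNReal.ofReal_sum_of_nonneg
    fun s _ => mul_nonneg (𝒳.Xleft_nonneg s ω i) (𝒳.X_nonneg s ω j), Finset.sum_filter]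
  refine Finset.sum_congr rfl fun s _ => ?_
  by_cases h : s ∈ S <;> simp [h]

theorem jumpMeasure_univ (i j : Fin N) (T : ℝ≥0) (ω : Ω) :
    𝒳.jumpMeasure i j T ω Set.univ = ENNReal.ofReal (𝒳.jumpCount i j 0 T ω) := by
  classical
  rw [jumpMeasure_apply _ _ _ _ _ MeasurableSet.univ]
  simp [jumpCount]

instance (i j : Fin N) (T : ℝ≥0) (ω : Ω) : IsFiniteMeasure (𝒳.jumpMeasure i j T ω) :=
  ⟨by rw [jumpMeasure_univ]; exact ENNReal.ofReal_lt_top⟩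

/-- Half-lines `(-∞, v]` form a generating π-system, and their mass is the jump count up to `min T
v`, already known to be measurable. -/
theorem measurable_jumpMeasure (T : ℝ≥0) {i j : Fin N} (hij : i ≠ j) :
    Measurable[𝒳.filtration T] (𝒳.jumpMeasure i j T) := by
  refine Measurable.measure_of_isPiSystem (mα := 𝒳.filtration T)
    (BorelSpace.measurable_eq.trans (borel_eq_generateFrom_Iic ℝ≥0)) isPiSystem_Iic ?_ ?_
  · rintro _ ⟨v, rfl⟩
    have h : ∀ ω, 𝒳.jumpMeasure i j T ω (Set.Iic v)
        = ENNReal.ofReal (𝒳.jumpCount i j 0 (min T v) ω) := by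
      intro ω
      rw [jumpMeasure_apply _ _ _ _ _ measurableSet_Iic, jumpCount, ← jumps_filter_le]
      rfl
    simp_rw [h]
    exact ((𝒳.measurable_jumpCount zero_le hij).mono
      (𝒳.filtration.mono (min_le_left T v)) le_rfl).ennreal_ofReal
  · simp_rw [jumpMeasure_univ]
    exact (𝒳.measurable_jumpCount zero_le hij).ennreal_ofReal

open ProbabilityTheory in
/-- Sums over the jumps `i → j` up to time `T` are measurable at time `T`. -/
theorem measurable_sum_jumps (T : ℝ≥0) {i j : Fin N} (hij : i ≠ j) {g : ℝ≥0 × Ω → ℝ}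
    (hg : Measurable[Prod.instMeasurableSpace (m₂ := 𝒳.filtration T)] g) :
    Measurable[𝒳.filtration T]
      fun ω => ∑ s ∈ 𝒳.jumps 0 T ω, 𝒳.Xleft s ω i * 𝒳.X s ω j * g (s, ω) := by
  simp_rw [← integral_jumpMeasure 𝒳 i j T _ fun s => g (s, _)]
  let κ : @Kernel Ω ℝ≥0 (𝒳.filtration T) _ :=
    @Kernel.mk _ _ (𝒳.filtration T) _ (𝒳.jumpMeasure i j T) (𝒳.measurable_jumpMeasure T hij)
  have hfin : ∀ ω, IsFiniteMeasure (κ ω) := fun ω => by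
    change IsFiniteMeasure (𝒳.jumpMeasure i j T ω)
    infer_instance
  have : IsSFiniteKernel κ := isSFiniteKernel_of_isFiniteMeasure κ
  have hg' : Measurable[Prod.instMeasurableSpace (m₁ := 𝒳.filtration T)]
      fun p : Ω × ℝ≥0 => g (p.2, p.1) :=
    hg.comp (@measurable_swap _ _ (𝒳.filtration T) _)
  exact (StronglyMeasurable.integral_kernel_prod_right' (κ := κ)
    hg'.stronglyMeasurable).measurable

open ProbabilityTheory in
/-- The jumps `i → j` as a kernel. -/
def jumpKernel (T : ℝ≥0) {i j : Fin N} (hij : i ≠ j) : Kernel Ω ℝ≥0 :=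
  ⟨𝒳.jumpMeasure i j T, (𝒳.measurable_jumpMeasure T hij).mono (𝒳.filtration.le T) le_rfl⟩

instance (T : ℝ≥0) {i j : Fin N} (hij : i ≠ j) :
    ProbabilityTheory.IsSFiniteKernel (𝒳.jumpKernel T hij) := by
  have : ∀ ω, IsFiniteMeasure (𝒳.jumpKernel T hij ω) := fun ω => by
    change IsFiniteMeasure (𝒳.jumpMeasure i j T ω)
    infer_instance
  exact isSFiniteKernel_of_isFiniteMeasure _

/-- The jump measure on the product of the time axis and the probability space. -/
def jumpProd (T : ℝ≥0) {i j : Fin N} (hij : i ≠ j) : Measure (ℝ≥0 × Ω) :=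
  (μ.compProd (𝒳.jumpKernel T hij)).map Prod.swap

/-- The density of the compensator of the jumps `i → j`. -/
def rate (i j : Fin N) (p : ℝ≥0 × Ω) : ℝ := 𝒳.X p.1 p.2 i * 𝒳.A p.1 j i

/-- The compensator of the jump measure. -/
def rateProd (T : ℝ≥0) (i j : Fin N) : Measure (ℝ≥0 × Ω) :=
  ((leb.restrict (Set.Ioc 0 T)).prod μ).withDensity fun p => ENNReal.ofReal (𝒳.rate i j p)

theorem measurable_rate (i j : Fin N) : Measurable (𝒳.rate i j) :=
  (𝒳.measurable_uncurry_X i).mul ((𝒳.isRateMatrix.measurable j i).comp measurable_fst)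

theorem rate_nonneg {i j : Fin N} (hij : i ≠ j) (p : ℝ≥0 × Ω) : 0 ≤ 𝒳.rate i j p :=
  mul_nonneg (𝒳.X_nonneg _ _ _) (𝒳.isRateMatrix.offDiag_nonneg _ _ _ hij.symm)

theorem integrableOn_rate (i j : Fin N) (u v : ℝ≥0) (ω : Ω) :
    IntegrableOn (fun s => 𝒳.rate i j (s, ω)) (Set.Ioc u v) leb := by
  obtain ⟨b, hb0, hb⟩ := 𝒳.exists_rate_bound
  refine Measure.integrableOn_of_bounded (M := 1 * b) (by rw [leb_Ioc]; simp)
    ((𝒳.measurable_rate i j).comp (measurable_id.prodMk measurable_const)).aestronglyMeasurable ?_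
  refine Eventually.of_forall fun s => ?_
  rw [rate, norm_mul]
  exact mul_le_mul (𝒳.abs_X_le_one _ _ _) (hb _ _ _) (norm_nonneg _) zero_le_one

theorem predictable_le : 𝒳.filtration.predictable ≤ (Prod.instMeasurableSpace : MeasurableSpace
    (ℝ≥0 × Ω)) :=
  measurableSpace_le_predictable_of_measurableSet
    (fun A hA => (measurableSet_singleton _).prod (𝒳.filtration.le _ A hA))
    (fun i A hA => measurableSet_Ioi.prod (𝒳.filtration.le i A hA))

theorem isPiSystem_predictable_rectangles (𝓕 : Filtration ℝ≥0 mΩ) : IsPiSystem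
    ({s | ∃ A, MeasurableSet[𝓕 ⊥] A ∧ s = {⊥} ×ˢ A} ∪
      {s | ∃ i A, MeasurableSet[𝓕 i] A ∧ s = Set.Ioi i ×ˢ A} : Set (Set (ℝ≥0 × Ω))) := by
  have hb : ∀ i : ℝ≥0, ({⊥} : Set ℝ≥0) ∩ Set.Ioi i = ∅ := fun i => by
    ext x; simp
  rintro _ (⟨A, hA, rfl⟩ | ⟨i, A, hA, rfl⟩) _ (⟨B, hB, rfl⟩ | ⟨j, B, hB, rfl⟩) -
  · exact Or.inl ⟨A ∩ B, hA.inter hB, by rw [Set.prod_inter_prod, Set.inter_self]⟩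
  · exact Or.inl ⟨∅, @MeasurableSet.empty _ (𝓕 ⊥), by rw [Set.prod_inter_prod, hb]; simp⟩
  · exact Or.inl ⟨∅, @MeasurableSet.empty _ (𝓕 ⊥), by
      rw [Set.prod_inter_prod, Set.inter_comm, hb]; simp⟩
  · refine Or.inr ⟨max i j, A ∩ B, ?_, by rw [Set.prod_inter_prod, Set.Ioi_inter_Ioi]⟩
    exact MeasurableSet.inter (𝓕.mono (le_max_left _ _) _ hA) (𝓕.mono (le_max_right _ _) _ hB)

section probability

variable [IsProbabilityMeasure μ]

theorem lintegral_jumpProd (T : ℝ≥0) {i j : Fin N} (hij : i ≠ j) {H : ℝ≥0 × Ω → ℝ≥0∞}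
    (hH : Measurable H) : ∫⁻ p, H p ∂𝒳.jumpProd T hij
      = ∫⁻ ω, ∑ s ∈ 𝒳.jumps 0 T ω, ENNReal.ofReal (𝒳.Xleft s ω i * 𝒳.X s ω j) * H (s, ω) ∂μ := by
  rw [jumpProd, lintegral_map hH measurable_swap,
    Measure.lintegral_compProd (f := fun p => H p.swap) (hH.comp measurable_swap)]
  exact lintegral_congr fun ω => 𝒳.lintegral_jumpMeasure i j T ω fun s => H (s, ω)

theorem lintegral_rateProd (T : ℝ≥0) (i j : Fin N) {H : ℝ≥0 × Ω → ℝ≥0∞}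
    (hH : Measurable H) : ∫⁻ p, H p ∂𝒳.rateProd T i j
      = ∫⁻ ω, ∫⁻ s in Set.Ioc 0 T, ENNReal.ofReal (𝒳.rate i j (s, ω)) * H (s, ω) ∂leb ∂μ := by
  have hm := (𝒳.measurable_rate i j).ennreal_ofReal
  rw [rateProd, lintegral_withDensity_eq_lintegral_mul _ hm hH,
    lintegral_prod_symm _ (hm.mul hH).aemeasurable]
  rfl

theorem setLIntegral_jumpCount {u v : ℝ≥0} (huv : u ≤ v) {B : Set Ω}
    (hB : MeasurableSet[𝒳.filtration u] B) {i j : Fin N} (hij : i ≠ j) :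
    ∫⁻ ω in B, ENNReal.ofReal (𝒳.jumpCount i j u v ω) ∂μ
      = ∫⁻ ω in B, ∫⁻ r in Set.Ioc u v, ENNReal.ofReal (𝒳.rate i j (r, ω)) ∂leb ∂μ := by
  have h1 : ∀ ω, ∫⁻ r in Set.Ioc u v, ENNReal.ofReal (𝒳.rate i j (r, ω)) ∂leb
      = ENNReal.ofReal (∫ r in Set.Ioc u v, 𝒳.rate i j (r, ω) ∂leb) := fun ω =>
    (ofReal_integral_eq_lintegral_ofReal (𝒳.integrableOn_rate i j u v ω)
      (Eventually.of_forall fun r => 𝒳.rate_nonneg hij _)).symm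
  have h0 : ∀ ω, 0 ≤ ∫ r in Set.Ioc u v, 𝒳.rate i j (r, ω) ∂leb := fun ω =>
    integral_nonneg fun r => 𝒳.rate_nonneg hij _
  simp_rw [h1]
  rw [← ofReal_integral_eq_lintegral_ofReal (𝒳.integrable_jumpCount huv hij).integrableOn
    (Eventually.of_forall (𝒳.jumpCount_nonneg i j u v)), 𝒳.setIntegral_jumpCount huv hB hij,
    ← ofReal_integral_eq_lintegral_ofReal _ (Eventually.of_forall h0)]
  · rfl
  · obtain ⟨b, hb0, hb⟩ := 𝒳.exists_rate_bound
    refine Integrable.of_bound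
      (((𝒳.measurable_rate i j).stronglyMeasurable.integral_prod_left').aestronglyMeasurable)
      (1 * b * (v - u)) (Eventually.of_forall fun ω => ?_)
    have := norm_setIntegral_le_of_norm_le_const (μ := leb) (s := Set.Ioc u v) (C := 1 * b)
      (f := fun r => 𝒳.rate i j (r, ω)) (by rw [leb_Ioc]; simp) (fun r _ => by
        rw [rate, norm_mul]
        exact mul_le_mul (𝒳.abs_X_le_one _ _ _) (hb _ _ _) (norm_nonneg _) zero_le_one)
    rwa [leb_real_Ioc huv] at this

theorem jumpProd_Ioi_prod {T u : ℝ≥0} (hu : u ≤ T) {i j : Fin N} (hij : i ≠ j) {B : Set Ω}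
    (hB : MeasurableSet[𝒳.filtration u] B) :
    𝒳.jumpProd T hij (Set.Ioi u ×ˢ B) = 𝒳.rateProd T i j (Set.Ioi u ×ˢ B) := by
  have hB' := 𝒳.filtration.le u B hB
  have hm : MeasurableSet (Set.Ioi u ×ˢ B) := measurableSet_Ioi.prod hB'
  rw [← lintegral_indicator_one hm, ← lintegral_indicator_one hm,
    𝒳.lintegral_jumpProd T hij (measurable_one.indicator hm),
    𝒳.lintegral_rateProd T i j (measurable_one.indicator hm)]
  have h := 𝒳.setLIntegral_jumpCount hu hB hij
  rw [← lintegral_indicator hB', ← lintegral_indicator hB'] at h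
  convert h using 2
  · ext ω
    by_cases hω : ω ∈ B
    · rw [Set.indicator_of_mem hω, jumpCount, ← 𝒳.jumps_filter_lt (u := u) zero_le T ω,
        ENNReal.ofReal_sum_of_nonneg
          fun s _ => mul_nonneg (𝒳.Xleft_nonneg s ω i) (𝒳.X_nonneg s ω j), Finset.sum_filter]
      refine Finset.sum_congr rfl fun s _ => ?_
      by_cases hs : u < s <;> simp [hω, hs]
    · simp [hω]
  · ext ω
    by_cases hω : ω ∈ B
    · rw [Set.indicator_of_mem hω]
      have : Set.Ioc u T = Set.Ioi u ∩ Set.Ioc 0 T := by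
        ext s
        simp only [Set.mem_Ioc, Set.mem_inter_iff, Set.mem_Ioi]
        exact ⟨fun h => ⟨h.1, pos_of_gt h.1, h.2⟩, fun h => ⟨h.1, h.2.2⟩⟩
      rw [this, ← Measure.restrict_restrict measurableSet_Ioi, ← lintegral_indicator
        measurableSet_Ioi]
      refine lintegral_congr fun s => ?_
      by_cases hs : u < s <;> simp [hω, hs]
    · simp [hω]

/-- Two finite measures that agree on the rectangles `{0} × A` and `(u, ∞) × A`, a π-system
generating the predictable σ-algebra. On the full product σ-algebra they differ in general, one
being carried by the jump times and the other absolutely continuous in time; hence the trimming. -/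
theorem trim_jumpProd (T : ℝ≥0) {i j : Fin N} (hij : i ≠ j) :
    (𝒳.jumpProd T hij).trim 𝒳.predictable_le = (𝒳.rateProd T i j).trim 𝒳.predictable_le := by
  -- Neither measure charges times outside `(0, T]`, which settles the rectangles over time `0` and
  -- those that start after `T`.
  have hout : ∀ D : Set (ℝ≥0 × Ω), MeasurableSet D → (∀ p ∈ D, p.1 ∉ Set.Ioc 0 T) →
      𝒳.jumpProd T hij D = 0 ∧ 𝒳.rateProd T i j D = 0 := by
    intro D hD hout
    rw [← lintegral_indicator_one hD, ← lintegral_indicator_one hD,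
      𝒳.lintegral_jumpProd T hij (measurable_one.indicator hD),
      𝒳.lintegral_rateProd T i j (measurable_one.indicator hD)]
    constructor
    · refine (lintegral_congr fun ω => ?_).trans lintegral_zero
      refine Finset.sum_eq_zero fun s hs => ?_
      have : (s, ω) ∉ D := fun h => hout _ h (𝒳.jumps_subset 0 T ω hs)
      simp [this]
    · refine (lintegral_congr fun ω => ?_).trans lintegral_zero
      refine (setLIntegral_congr_fun measurableSet_Ioc fun s hs => ?_).trans lintegral_zero
      have : (s, ω) ∉ D := fun h => hout _ h hs
      simp [this]
  have hIoi : ∀ u B, MeasurableSet[𝒳.filtration u] B →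
      𝒳.jumpProd T hij (Set.Ioi u ×ˢ B) = 𝒳.rateProd T i j (Set.Ioi u ×ˢ B) := by
    intro u B hB
    rcases le_or_gt u T with hu | hu
    · exact 𝒳.jumpProd_Ioi_prod hu hij hB
    · obtain ⟨h1, h2⟩ := hout _ (measurableSet_Ioi.prod (𝒳.filtration.le u B hB))
        fun p hp h => absurd (hu.trans hp.1) (not_lt.2 h.2)
      rw [h1, h2]
  have huniv : 𝒳.jumpProd T hij Set.univ = 𝒳.rateProd T i j Set.univ := by
    have e : (Set.univ : Set (ℝ≥0 × Ω)) = Set.Ioi 0 ×ˢ Set.univ ∪ {0} ×ˢ Set.univ := by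
      ext ⟨s, ω⟩
      simp [pos_iff_ne_zero, em']
    have h0 := hout ({0} ×ˢ Set.univ) ((measurableSet_singleton 0).prod MeasurableSet.univ)
      (by rintro ⟨s, ω⟩ ⟨hs, -⟩ h; exact h.1.ne' hs)
    have hd : Disjoint (Set.Ioi 0 ×ˢ Set.univ : Set (ℝ≥0 × Ω)) ({0} ×ˢ Set.univ) :=
      Set.disjoint_prod.2 (Or.inl (by simp))
    have hm : MeasurableSet ({0} ×ˢ Set.univ : Set (ℝ≥0 × Ω)) :=
      (measurableSet_singleton 0).prod MeasurableSet.univ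
    rw [e, measure_union hd hm, measure_union hd hm, h0.1, h0.2,
      hIoi 0 _ MeasurableSet.univ]
  have hfin : IsFiniteMeasure (𝒳.jumpProd T hij) := by
    refine ⟨?_⟩
    rw [← lintegral_one, 𝒳.lintegral_jumpProd T hij (H := fun _ => 1) measurable_const]
    refine lt_of_le_of_lt (le_of_eq (lintegral_congr fun ω => ?_))
      (𝒳.lintegral_jumpCount_lt_top (zero_le (a := T)) hij)
    rw [jumpCount, ENNReal.ofReal_sum_of_nonneg
      fun s _ => mul_nonneg (𝒳.Xleft_nonneg s ω i) (𝒳.X_nonneg s ω j)]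
    simp
  refine @ext_of_generate_finite _ 𝒳.filtration.predictable _ _ _ rfl
    (isPiSystem_predictable_rectangles _) (isFiniteMeasure_trim _) ?_ ?_
  · rintro D (⟨A, hA, rfl⟩ | ⟨u, A, hA, rfl⟩)
    · have hm := measurableSet_predictable_singleton_bot_prod hA
      rw [trim_measurableSet_eq _ hm, trim_measurableSet_eq _ hm]
      obtain ⟨h1, h2⟩ := hout _ (𝒳.predictable_le _ hm)
        fun p hp h => h.1.ne' hp.1
      rw [h1, h2]
    · have hm := measurableSet_predictable_Ioi_prod hA
      rw [trim_measurableSet_eq _ hm, trim_measurableSet_eq _ hm, hIoi u A hA]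
  · rw [trim_measurableSet_eq _ MeasurableSet.univ, trim_measurableSet_eq _ MeasurableSet.univ,
      huniv]

/-- The compensation formula for nonnegative predictable integrands. -/
theorem lintegral_sum_jumps (T : ℝ≥0) {i j : Fin N} (hij : i ≠ j) {H : ℝ≥0 × Ω → ℝ≥0∞}
    (hH : Measurable[𝒳.filtration.predictable] H) :
    ∫⁻ ω, ∑ s ∈ 𝒳.jumps 0 T ω, ENNReal.ofReal (𝒳.Xleft s ω i * 𝒳.X s ω j) * H (s, ω) ∂μ
      = ∫⁻ ω, ∫⁻ s in Set.Ioc 0 T, ENNReal.ofReal (𝒳.rate i j (s, ω)) * H (s, ω) ∂leb ∂μ := by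
  have hH' := hH.mono 𝒳.predictable_le le_rfl
  rw [← 𝒳.lintegral_jumpProd T hij hH', ← 𝒳.lintegral_rateProd T i j hH',
    ← lintegral_trim 𝒳.predictable_le hH, ← lintegral_trim 𝒳.predictable_le hH,
    𝒳.trim_jumpProd T hij]

/-- The compensation formula for integrable predictable integrands. -/
theorem integral_sum_jumps (T : ℝ≥0) {i j : Fin N} (hij : i ≠ j) {H : ℝ≥0 × Ω → ℝ}
    (hH : Measurable[𝒳.filtration.predictable] H)
    (hfin : ∫⁻ ω, ∫⁻ s in Set.Ioc 0 T, ENNReal.ofReal (𝒳.rate i j (s, ω) * |H (s, ω)|) ∂leb ∂μ < ∞) :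
    Integrable (fun ω => ∑ s ∈ 𝒳.jumps 0 T ω, 𝒳.Xleft s ω i * 𝒳.X s ω j * H (s, ω)) μ ∧
    Integrable (fun ω => ∫ s in Set.Ioc 0 T, 𝒳.rate i j (s, ω) * H (s, ω) ∂leb) μ ∧
    ∫ ω, ∑ s ∈ 𝒳.jumps 0 T ω, 𝒳.Xleft s ω i * 𝒳.X s ω j * H (s, ω) ∂μ
      = ∫ ω, ∫ s in Set.Ioc 0 T, 𝒳.rate i j (s, ω) * H (s, ω) ∂leb ∂μ := by
  have hH' := hH.mono 𝒳.predictable_le le_rfl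
  have hm := 𝒳.measurable_rate i j
  have hi2 : Integrable H (𝒳.rateProd T i j) := by
    refine ⟨hH'.aestronglyMeasurable, ?_⟩
    rw [HasFiniteIntegral, 𝒳.lintegral_rateProd T i j hH'.enorm]
    refine lt_of_le_of_lt (le_of_eq (lintegral_congr fun ω => lintegral_congr fun s => ?_)) hfin
    rw [ENNReal.ofReal_mul (𝒳.rate_nonneg hij _), Real.enorm_eq_ofReal_abs]
  have hi1 : Integrable H (𝒳.jumpProd T hij) := by
    refine ⟨hH'.aestronglyMeasurable, ?_⟩
    have h1 := hi2.2
    rw [HasFiniteIntegral, 𝒳.lintegral_rateProd T i j hH'.enorm] at h1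
    rw [HasFiniteIntegral, 𝒳.lintegral_jumpProd T hij hH'.enorm]
    have := 𝒳.lintegral_sum_jumps T hij (measurable_enorm.comp hH)
    exact this.trans_lt h1
  have heq : ∫ p, H p ∂𝒳.jumpProd T hij = ∫ p, H p ∂𝒳.rateProd T i j := by
    rw [integral_trim 𝒳.predictable_le hH.stronglyMeasurable,
      integral_trim (μ := 𝒳.rateProd T i j) 𝒳.predictable_le hH.stronglyMeasurable,
      𝒳.trim_jumpProd T hij]
  have hc1 : Integrable (H ∘ Prod.swap) (μ.compProd (𝒳.jumpKernel T hij)) :=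
    (integrable_map_measure hH'.aestronglyMeasurable measurable_swap.aemeasurable).1 hi1
  have e1 : ∀ ω, ∫ s, (H ∘ Prod.swap) (ω, s) ∂𝒳.jumpKernel T hij ω
      = ∑ s ∈ 𝒳.jumps 0 T ω, 𝒳.Xleft s ω i * 𝒳.X s ω j * H (s, ω) := fun ω =>
    𝒳.integral_jumpMeasure i j T ω fun s => H (s, ω)
  have hi3 : Integrable (fun p => 𝒳.rate i j p * H p)
      ((leb.restrict (Set.Ioc 0 T)).prod μ) := by
    have := (integrable_withDensity_iff_integrable_smul' hm.ennreal_ofReal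
      (Eventually.of_forall fun p => ENNReal.ofReal_lt_top)).1 hi2
    simpa [ENNReal.toReal_ofReal (𝒳.rate_nonneg hij _)] using this
  refine ⟨?_, hi3.integral_prod_right, ?_⟩
  · have := hc1.integral_compProd
    simpa only [ProbabilityTheory.Kernel.prodMkLeft_apply, ProbabilityTheory.Kernel.const_apply,
      e1] using this
  · simp_rw [← e1]
    rw [← Measure.integral_compProd hc1, ← integral_prod_symm _ hi3]
    change ∫ p, H (Prod.swap p) ∂_ = _
    rw [← integral_map measurable_swap.aemeasurable hH'.aestronglyMeasurable]
    change ∫ p, H p ∂𝒳.jumpProd T hij = _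
    rw [heq, rateProd, integral_withDensity_eq_integral_toReal_smul hm.ennreal_ofReal
      (Eventually.of_forall fun p => ENNReal.ofReal_lt_top)]
    refine integral_congr_ae (Eventually.of_forall fun p => ?_)
    simp [ENNReal.toReal_ofReal (𝒳.rate_nonneg hij _)]

end probability

end MarkovChain

end MarkovRBSDE
end

/-! ### The quadratic form of `Ψ` as a sum over transitions -/

noncomputable section

namespace MarkovRBSDE

namespace MarkovChain

section algebra

variable {N : ℕ}

/-- Only the pair of the two occupied states survives in the double sum. Diagonal terms vanish, so
the sum can be restricted to genuine transitions, for which the rates are nonnegative. -/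
theorem dotProduct_sub_states {x y : Fin N → ℝ} (hx : x ∈ states N) (hy : y ∈ states N)
    (z : Fin N → ℝ) :
    z ⬝ᵥ (y - x) = ∑ i, ∑ j ∈ Finset.univ.erase i, x i * y j * (z j - z i) := by
  obtain ⟨l, rfl⟩ := hx
  obtain ⟨l', rfl⟩ := hy
  have h : ∀ i, ∑ j ∈ Finset.univ.erase i, (Pi.single l 1 : Fin N → ℝ) i *
      (Pi.single l' 1 : Fin N → ℝ) j * (z j - z i) = ∑ j, (Pi.single l 1 : Fin N → ℝ) i *
      (Pi.single l' 1 : Fin N → ℝ) j * (z j - z i) := fun i =>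
    Finset.sum_erase _ (by simp)
  simp_rw [h]
  simp [dotProduct_sub, Pi.single_apply]

theorem dotProduct_sub_states_sq {x y : Fin N → ℝ} (hx : x ∈ states N) (hy : y ∈ states N)
    (z : Fin N → ℝ) :
    (z ⬝ᵥ (y - x)) ^ 2 = ∑ i, ∑ j ∈ Finset.univ.erase i, x i * y j * (z j - z i) ^ 2 := by
  obtain ⟨l, rfl⟩ := hx
  obtain ⟨l', rfl⟩ := hy
  have h : ∀ i, ∑ j ∈ Finset.univ.erase i, (Pi.single l 1 : Fin N → ℝ) i *
      (Pi.single l' 1 : Fin N → ℝ) j * (z j - z i) ^ 2 = ∑ j, (Pi.single l 1 : Fin N → ℝ) i *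
      (Pi.single l' 1 : Fin N → ℝ) j * (z j - z i) ^ 2 := fun i =>
    Finset.sum_erase _ (by simp)
  simp_rw [h]
  simp [dotProduct_sub, Pi.single_apply]

/-- The zero column sums allow `z j` to be replaced by `z j - z i`, which puts the drift in the same
form as the jumps. -/
theorem dotProduct_mulVec_states {x : Fin N → ℝ} (hx : x ∈ states N)
    {A : Matrix (Fin N) (Fin N) ℝ} (hA : ∀ j, ∑ i, A i j = 0) (z : Fin N → ℝ) :
    z ⬝ᵥ (A *ᵥ x) = ∑ i, ∑ j ∈ Finset.univ.erase i, x i * A j i * (z j - z i) := by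
  obtain ⟨l, rfl⟩ := hx
  have h : ∀ i, ∑ j ∈ Finset.univ.erase i, (Pi.single l 1 : Fin N → ℝ) i * A j i * (z j - z i)
      = ∑ j, (Pi.single l 1 : Fin N → ℝ) i * A j i * (z j - z i) := fun i =>
    Finset.sum_erase _ (by simp)
  simp_rw [h, mul_assoc, ← Finset.mul_sum]
  simp only [Pi.single_apply, ite_mul, one_mul, zero_mul, Finset.sum_ite_eq', Finset.mem_univ,
    if_true, mul_sub, Finset.sum_sub_distrib, ← Finset.sum_mul, hA l, sub_zero]
  simp [dotProduct, mulVec, Pi.single_apply, mul_comm]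

/-- On expanding the square, the `z i ^ 2` terms cancel by the zero column sums; the `z j ^ 2` terms
are the first diagonal part, and the mixed terms are the two symmetric products. -/
theorem quadratic_form_eq (x : Fin N → ℝ)
    {A : Matrix (Fin N) (Fin N) ℝ} (hA : ∀ j, ∑ i, A i j = 0) (z : Fin N → ℝ) :
    z ⬝ᵥ ((diagonal (A *ᵥ x) - diagonal x * Aᵀ - A * diagonal x) *ᵥ z)
      = ∑ i, ∑ j ∈ Finset.univ.erase i, x i * A j i * (z j - z i) ^ 2 := by
  have h1 : z ⬝ᵥ (diagonal (A *ᵥ x) *ᵥ z) = ∑ j, z j ^ 2 * (A *ᵥ x) j := by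
    simp only [dotProduct, mulVec_diagonal]
    exact Finset.sum_congr rfl fun j _ => by ring
  have h2 : z ⬝ᵥ ((A * diagonal x) *ᵥ z) = ∑ i, ∑ j, x i * A j i * (z j * z i) := by
    simp only [dotProduct, mulVec, mul_diagonal, Finset.mul_sum]
    rw [Finset.sum_comm]
    exact Finset.sum_congr rfl fun i _ => Finset.sum_congr rfl fun j _ => by ring
  have h3 : z ⬝ᵥ ((diagonal x * Aᵀ) *ᵥ z) = ∑ i, ∑ j, x i * A j i * (z j * z i) := by
    simp only [dotProduct, mulVec, diagonal_mul, transpose_apply, Finset.mul_sum]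
    exact Finset.sum_congr rfl fun i _ => Finset.sum_congr rfl fun j _ => by ring
  have h4 : ∑ j, z j ^ 2 * (A *ᵥ x) j = ∑ i, ∑ j, x i * A j i * z j ^ 2 := by
    simp only [dotProduct, mulVec, Finset.mul_sum]
    rw [Finset.sum_comm]
    exact Finset.sum_congr rfl fun i _ => Finset.sum_congr rfl fun j _ => by ring
  have h5 : ∑ i, ∑ j, x i * A j i * z i ^ 2 = 0 := by
    refine Finset.sum_eq_zero fun i _ => ?_
    rw [← Finset.sum_mul, ← Finset.mul_sum, hA]; ring
  have h6 : ∀ i, ∑ j ∈ Finset.univ.erase i, x i * A j i * (z j - z i) ^ 2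
      = ∑ j, x i * A j i * (z j - z i) ^ 2 := fun i => Finset.sum_erase _ (by simp)
  rw [sub_mulVec, sub_mulVec, dotProduct_sub, dotProduct_sub, h1, h2, h3, h4]
  simp_rw [h6]
  have h7 : ∀ i j, x i * A j i * (z j - z i) ^ 2 = x i * A j i * z j ^ 2
      - 2 * (x i * A j i * (z j * z i)) + x i * A j i * z i ^ 2 := fun i j => by ring
  simp_rw [h7, Finset.sum_add_distrib, Finset.sum_sub_distrib, h5, ← Finset.mul_sum]
  ring

end algebra

variable {Ω : Type*} [mΩ : MeasurableSpace Ω] {N : ℕ} {μ : Measure Ω} (𝒳 : MarkovChain N μ)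

/-- The quadratic form `z' Ψ_t z` with `X_t` in place of `X_{t-}`. -/
def energy (t : ℝ≥0) (ω : Ω) (z : Fin N → ℝ) : ℝ :=
  ∑ i, ∑ j ∈ Finset.univ.erase i, 𝒳.rate i j (t, ω) * (z j - z i) ^ 2

theorem energy_nonneg (t : ℝ≥0) (ω : Ω) (z : Fin N → ℝ) : 0 ≤ 𝒳.energy t ω z :=
  Finset.sum_nonneg fun _ _ => Finset.sum_nonneg fun _ hj =>
    mul_nonneg (𝒳.rate_nonneg (Finset.ne_of_mem_erase hj).symm _) (sq_nonneg _)

theorem normSq_eq_energy {t : ℝ≥0} {ω : Ω} (h : 𝒳.Xleft t ω = 𝒳.X t ω) (z : Fin N → ℝ) :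
    𝒳.normSq t ω z = 𝒳.energy t ω z := by
  rw [normSq, Psi, h, quadratic_form_eq _ (𝒳.isRateMatrix.colSum_zero t)]
  rfl

theorem rate_mul_sq_le_energy {i j : Fin N} (hij : i ≠ j) (t : ℝ≥0) (ω : Ω) (z : Fin N → ℝ) :
    𝒳.rate i j (t, ω) * (z j - z i) ^ 2 ≤ 𝒳.energy t ω z := by
  have h1 : ∀ i, ∀ j ∈ Finset.univ.erase i, 0 ≤ 𝒳.rate i j (t, ω) * (z j - z i) ^ 2 :=
    fun i j hj => mul_nonneg (𝒳.rate_nonneg (Finset.ne_of_mem_erase hj).symm _) (sq_nonneg _)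
  exact (Finset.single_le_sum (h1 i) (Finset.mem_erase.2 ⟨hij.symm, Finset.mem_univ j⟩)).trans
    (Finset.single_le_sum (f := fun i => ∑ j ∈ Finset.univ.erase i,
      𝒳.rate i j (t, ω) * (z j - z i) ^ 2) (fun i _ => Finset.sum_nonneg (h1 i))
      (Finset.mem_univ i))

variable {Z : ℝ≥0 → Ω → (Fin N → ℝ)}

theorem lintegral_normSq_eq (T : ℝ≥0) (ω : Ω) :
    ∫⁻ t in Set.Icc 0 T, ENNReal.ofReal (𝒳.normSq t ω (Z t ω)) ∂leb
      = ∫⁻ t in Set.Ioc 0 T, ENNReal.ofReal (𝒳.energy t ω (Z t ω)) ∂leb := by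
  rw [setLIntegral_congr (leb_Icc_ae_eq T)]
  refine lintegral_congr_ae ?_
  filter_upwards [𝒳.ae_Xleft_eq_X ω leb 0 T] with t ht
  rw [𝒳.normSq_eq_energy ht]

end MarkovChain

end MarkovRBSDE
end

/-! ### The pathwise stochastic integral -/

noncomputable section

namespace MarkovRBSDE

namespace MarkovChain

variable {Ω : Type*} [mΩ : MeasurableSpace Ω] {N : ℕ} {μ : Measure Ω} (𝒳 : MarkovChain N μ)

/-- Predictable processes are progressive: restricted to times up to `t`, the predictable σ-algebra
lies in the product of the Borel sets with `F_t`. -/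
theorem measurable_stopped_of_predictable {E : Type*} [MeasurableSpace E] {g : ℝ≥0 × Ω → E}
    (hg : Measurable[𝒳.filtration.predictable] g) (t : ℝ≥0) :
    Measurable[Prod.instMeasurableSpace (m₂ := 𝒳.filtration t)]
      fun p : ℝ≥0 × Ω => g (min p.1 t, p.2) := by
  have h1 := hg.comp (measurable_inclusion_predictable (𝓕 := 𝒳.filtration) (i := t))
  have h2 : @Measurable (ℝ≥0 × Ω) (Set.Iic t × Ω)
      (Prod.instMeasurableSpace (m₂ := 𝒳.filtration t))
      (Prod.instMeasurableSpace (m₂ := 𝒳.filtration t))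
      fun p => (⟨min p.1 t, Set.mem_Iic.2 (min_le_right _ _)⟩, p.2) := by
    refine Measurable.prodMk ?_ measurable_snd
    refine Measurable.subtype_mk ?_
    exact (@measurable_fst _ _ _ (𝒳.filtration t)).min measurable_const
  exact h1.comp h2

variable {Z : ℝ≥0 → Ω → (Fin N → ℝ)}

theorem measurable_increment (hZ : IsStronglyPredictable 𝒳.filtration Z) (i j : Fin N) :
    Measurable[𝒳.filtration.predictable] fun p : ℝ≥0 × Ω => Z p.1 p.2 j - Z p.1 p.2 i :=
  ((measurable_pi_apply j).comp hZ.measurable).sub ((measurable_pi_apply i).comp hZ.measurable)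

theorem measurable_energy (hZ : IsStronglyPredictable 𝒳.filtration Z) :
    Measurable fun p : ℝ≥0 × Ω => 𝒳.energy p.1 p.2 (Z p.1 p.2) :=
  Finset.measurable_sum _ fun i _ => Finset.measurable_sum _ fun j _ =>
    (𝒳.measurable_rate i j).mul (((𝒳.measurable_increment hZ i j).mono 𝒳.predictable_le le_rfl).pow_const 2)

theorem measurable_rate_mul_increment (hZ : IsStronglyPredictable 𝒳.filtration Z) (i j : Fin N) :
    Measurable fun p : ℝ≥0 × Ω => 𝒳.rate i j p * (Z p.1 p.2 j - Z p.1 p.2 i) :=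
  (𝒳.measurable_rate i j).mul ((𝒳.measurable_increment hZ i j).mono 𝒳.predictable_le le_rfl)

theorem rate_le {b : ℝ} (hb : ∀ t i j, |𝒳.A t i j| ≤ b) (i j : Fin N) (p : ℝ≥0 × Ω) :
    𝒳.rate i j p ≤ b := by
  refine (le_abs_self _).trans ?_
  rw [rate, abs_mul]
  refine (mul_le_mul (𝒳.abs_X_le_one _ _ _) (hb _ _ _) (abs_nonneg _) zero_le_one).trans ?_
  rw [one_mul]

/-- The path of `Z` has finite energy on `[0, T]`. -/
def FiniteEnergy (Z : ℝ≥0 → Ω → (Fin N → ℝ)) (T : ℝ≥0) (ω : Ω) : Prop :=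
  ∫⁻ s in Set.Ioc 0 T, ENNReal.ofReal (𝒳.energy s ω (Z s ω)) ∂leb < ∞

variable {𝒳} in
theorem FiniteEnergy.integrableOn (hZ : IsStronglyPredictable 𝒳.filtration Z) {T : ℝ≥0} {ω : Ω}
    (h : 𝒳.FiniteEnergy Z T ω) :
    IntegrableOn (fun s => 𝒳.energy s ω (Z s ω)) (Set.Ioc 0 T) leb := by
  refine ⟨((𝒳.measurable_energy hZ).comp
    (measurable_id.prodMk measurable_const)).aestronglyMeasurable, ?_⟩
  rw [hasFiniteIntegral_iff_ofReal (Eventually.of_forall fun s => 𝒳.energy_nonneg _ _ _)]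
  exact h

variable {𝒳} in
-- With bounded rates, `|w| ≤ 1 + w²` makes finite energy control the first power as well.
theorem FiniteEnergy.integrableOn_rate_mul (hZ : IsStronglyPredictable 𝒳.filtration Z) {T : ℝ≥0}
    {ω : Ω} (h : 𝒳.FiniteEnergy Z T ω) {i j : Fin N} (hij : i ≠ j) :
    IntegrableOn (fun s => 𝒳.rate i j (s, ω) * (Z s ω j - Z s ω i)) (Set.Ioc 0 T) leb := by
  obtain ⟨b, hb0, hb⟩ := 𝒳.exists_rate_bound
  have hc : IntegrableOn (fun _ : ℝ≥0 => b) (Set.Ioc 0 T) leb :=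
    integrableOn_const (by rw [leb_Ioc]; simp)
  refine Integrable.mono' (hc.add (h.integrableOn hZ)) ((𝒳.measurable_rate_mul_increment hZ i
    j).comp (measurable_id.prodMk measurable_const)).aestronglyMeasurable
    (Eventually.of_forall fun s => ?_)
  have h1 := 𝒳.rate_mul_sq_le_energy hij s ω (Z s ω)
  have h2 := 𝒳.rate_le hb i j (s, ω)
  have h3 := 𝒳.rate_nonneg hij (s, ω)
  rw [norm_mul, Real.norm_of_nonneg h3, Real.norm_eq_abs]
  simp only [Pi.add_apply]
  have h4 : |Z s ω j - Z s ω i| ≤ 1 + (Z s ω j - Z s ω i) ^ 2 := by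
    rw [← sq_abs]; nlinarith [sq_nonneg (|Z s ω j - Z s ω i| - 1), abs_nonneg (Z s ω j - Z s ω i)]
  nlinarith [mul_le_mul_of_nonneg_left h4 h3]

theorem drift_term_eq (Z : ℝ≥0 → Ω → (Fin N → ℝ)) (s : ℝ≥0) (ω : Ω) :
    Z s ω ⬝ᵥ (𝒳.A s *ᵥ 𝒳.X s ω) = ∑ i, ∑ j ∈ Finset.univ.erase i,
      𝒳.rate i j (s, ω) * (Z s ω j - Z s ω i) :=
  dotProduct_mulVec_states (𝒳.X_mem_states s ω) (𝒳.isRateMatrix.colSum_zero s) _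

variable {𝒳} in
theorem FiniteEnergy.integrableOn_drift_term (hZ : IsStronglyPredictable 𝒳.filtration Z) {T : ℝ≥0}
    {ω : Ω} (h : 𝒳.FiniteEnergy Z T ω) :
    IntegrableOn (fun s => Z s ω ⬝ᵥ (𝒳.A s *ᵥ 𝒳.X s ω)) (Set.Ioc 0 T) leb := by
  simp_rw [drift_term_eq]
  exact integrable_finsetSum _ fun i _ => integrable_finsetSum _ fun j hj =>
    h.integrableOn_rate_mul hZ (Finset.ne_of_mem_erase hj).symm

/-- The summand vanishes off the finitely many jump times, so the `finsum` is an actual sum and not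
its default value. -/
theorem integral_eq_sum_jumps (Z : ℝ≥0 → Ω → (Fin N → ℝ)) (u v : ℝ≥0) (ω : Ω) :
    𝒳.integral Z u v ω = (∑ s ∈ 𝒳.jumps u v ω, Z s ω ⬝ᵥ (𝒳.X s ω - 𝒳.Xleft s ω))
      - ∫ s in Set.Ioc u v, Z s ω ⬝ᵥ (𝒳.A s *ᵥ 𝒳.X s ω) ∂leb := by
  rw [integral]
  congr 1
  refine finsum_mem_eq_sum_of_inter_support_eq _ ?_
  ext s
  simp only [Set.mem_inter_iff, Function.mem_support, Finset.mem_coe, mem_jumps]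
  constructor
  · rintro ⟨h1, h2⟩
    refine ⟨⟨h1, fun e => h2 ?_⟩, h2⟩
    simp [e]
  · rintro ⟨⟨h1, -⟩, h2⟩
    exact ⟨h1, h2⟩

/-- The stochastic integral as the sum of the compensated integrals over the jumps `i → j`. -/
theorem integral_eq_sum_pairs (hZ : IsStronglyPredictable 𝒳.filtration Z) {T : ℝ≥0}
    {ω : Ω} (h : 𝒳.FiniteEnergy Z T ω) {u v : ℝ≥0} (hv : v ≤ T) :
    𝒳.integral Z u v ω = ∑ i, ∑ j ∈ Finset.univ.erase i,
      ((∑ s ∈ 𝒳.jumps u v ω, 𝒳.Xleft s ω i * 𝒳.X s ω j * (Z s ω j - Z s ω i))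
        - ∫ s in Set.Ioc u v, 𝒳.rate i j (s, ω) * (Z s ω j - Z s ω i) ∂leb) := by
  have hsub : Set.Ioc u v ⊆ Set.Ioc 0 T := Set.Ioc_subset_Ioc zero_le hv
  rw [integral_eq_sum_jumps]
  simp_rw [drift_term_eq, dotProduct_sub_states (𝒳.Xleft_mem_states _ ω) (𝒳.X_mem_states _ ω),
    Finset.sum_sub_distrib]
  congr 1
  · rw [Finset.sum_comm]
    exact Finset.sum_congr rfl fun i _ => Finset.sum_comm
  · rw [integral_finsetSum _ fun i _ => integrable_finsetSum _ fun j hj =>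
      (h.integrableOn_rate_mul hZ (Finset.ne_of_mem_erase hj).symm).mono_set hsub]
    refine Finset.sum_congr rfl fun i _ => ?_
    rw [integral_finsetSum _ fun j hj =>
      (h.integrableOn_rate_mul hZ (Finset.ne_of_mem_erase hj).symm).mono_set hsub]

theorem jumps_union {u v w : ℝ≥0} (huv : u ≤ v) (hvw : v ≤ w) (ω : Ω) (g : ℝ≥0 → ℝ) :
    ∑ s ∈ 𝒳.jumps u w ω, g s = ∑ s ∈ 𝒳.jumps u v ω, g s + ∑ s ∈ 𝒳.jumps v w ω, g s := by
  have h1 := 𝒳.jumps_filter_le u w v ω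
  have h2 := 𝒳.jumps_filter_lt huv w ω
  rw [min_eq_right hvw] at h1
  rw [← h1, ← h2, ← Finset.sum_filter_add_sum_filter_not (𝒳.jumps u w ω) (· ≤ v)]
  simp only [not_le]

theorem integral_add (hZ : IsStronglyPredictable 𝒳.filtration Z) {T : ℝ≥0}
    {ω : Ω} (h : 𝒳.FiniteEnergy Z T ω) {u v w : ℝ≥0} (huv : u ≤ v) (hvw : v ≤ w) (hw : w ≤ T) :
    𝒳.integral Z u v ω + 𝒳.integral Z v w ω = 𝒳.integral Z u w ω := by
  have hi := h.integrableOn_drift_term hZ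
  rw [integral_eq_sum_jumps, integral_eq_sum_jumps, integral_eq_sum_jumps, 𝒳.jumps_union huv hvw,
    ← Set.Ioc_union_Ioc_eq_Ioc huv hvw, setIntegral_union (Set.Ioc_disjoint_Ioc_of_le le_rfl)
      measurableSet_Ioc]
  · ring
  · exact hi.mono_set (Set.Ioc_subset_Ioc zero_le (hvw.trans hw))
  · exact hi.mono_set (Set.Ioc_subset_Ioc zero_le hw)

/-- Dominated convergence: as `r` increases to `s`, the indicators of `(r, ∞)` on `(0, s]` tend to
zero except at the null point `s`. -/
theorem tendsto_setIntegral_Ioc_left {g : ℝ≥0 → ℝ} {T : ℝ≥0} (hg : IntegrableOn g (Set.Ioc 0 T) leb)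
    {s : ℝ≥0} (hs : s ≤ T) :
    Tendsto (fun r => ∫ x in Set.Ioc r s, g x ∂leb) (𝓝[<] s) (𝓝 0) := by
  have hg' : IntegrableOn g (Set.Ioc 0 s) leb := hg.mono_set (Set.Ioc_subset_Ioc le_rfl hs)
  have h1 : ∀ r, ∫ x in Set.Ioc r s, g x ∂leb
      = ∫ x in Set.Ioc 0 s, (Set.Ioi r).indicator g x ∂leb := fun r => by
    rw [setIntegral_indicator measurableSet_Ioi]
    congr 2
    ext x
    simp only [Set.mem_Ioc, Set.mem_inter_iff, Set.mem_Ioi]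
    exact ⟨fun h => ⟨⟨pos_of_gt h.1, h.2⟩, h.1⟩, fun h => ⟨h.2, h.1.2⟩⟩
  simp_rw [h1]
  rw [← integral_zero (μ := leb.restrict (Set.Ioc 0 s)) (α := ℝ≥0) (G := ℝ)]
  refine tendsto_integral_filter_of_dominated_convergence (fun x => ‖g x‖)
    (Eventually.of_forall fun r => hg'.aestronglyMeasurable.indicator measurableSet_Ioi)
    (Eventually.of_forall fun r => Eventually.of_forall fun x => norm_indicator_le_norm_self _ _)
    hg'.norm ?_
  have hne : ∀ᵐ x ∂leb, x ≠ s := measure_eq_zero_iff_ae_notMem.1 (leb_singleton s)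
  filter_upwards [ae_restrict_of_ae hne, ae_restrict_mem measurableSet_Ioc] with x hx hx'
  refine tendsto_const_nhds.congr' ?_
  filter_upwards [Ioo_mem_nhdsLT (lt_of_le_of_ne hx'.2 hx)] with r hr
  rw [Set.indicator_of_notMem]
  exact not_lt.2 hr.1.le

/-- As `r` increases to `s`, eventually `s` is the only possible jump time in `(r, s]`, and the
drift part tends to zero. This identifies the jump of the integral. -/
theorem tendsto_integral_left (hZ : IsStronglyPredictable 𝒳.filtration Z) {T : ℝ≥0}
    {ω : Ω} (h : 𝒳.FiniteEnergy Z T ω) {s : ℝ≥0} (hs : s ≤ T) :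
    Tendsto (fun r => 𝒳.integral Z r s ω) (𝓝[<] s)
      (𝓝 (Z s ω ⬝ᵥ (𝒳.X s ω - 𝒳.Xleft s ω))) := by
  have h1 := tendsto_setIntegral_Ioc_left (h.integrableOn_drift_term hZ) hs
  have h2 : ∀ᶠ r in 𝓝[<] s, ∑ x ∈ 𝒳.jumps r s ω, Z x ω ⬝ᵥ (𝒳.X x ω - 𝒳.Xleft x ω)
      = Z s ω ⬝ᵥ (𝒳.X s ω - 𝒳.Xleft s ω) := by
    have h3 : ∀ᶠ x in 𝓝[<] s, 𝒳.Xleft x ω = 𝒳.X x ω :=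
      nhdsWithin_mono _ (fun x hx => ne_of_lt hx) (𝒳.eventually_Xleft_eq_X s ω)
    rcases eq_or_ne s 0 with rfl | hs0
    · have : (𝓝[<] (0 : ℝ≥0)) = ⊥ := by
        rw [show Set.Iio (0 : ℝ≥0) = ∅ by ext x; simp]; simp
      rw [this]; exact eventually_bot
    obtain ⟨l, hl, hl'⟩ := (mem_nhdsLT_iff_exists_Ioo_subset' (pos_iff_ne_zero.2 hs0)).1 h3
    filter_upwards [Ioo_mem_nhdsLT hl] with r hr
    refine Finset.sum_eq_single s ?_ ?_
    · intro x hx hxs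
      obtain ⟨⟨hx1, hx2⟩, hx3⟩ := 𝒳.mem_jumps.1 hx
      exact absurd (hl' ⟨hr.1.trans hx1, lt_of_le_of_ne hx2 hxs⟩).symm hx3
    · intro hns
      have : 𝒳.X s ω = 𝒳.Xleft s ω := by
        by_contra hne
        exact hns (𝒳.mem_jumps.2 ⟨⟨hr.2, le_rfl⟩, hne⟩)
      simp [this]
  simp_rw [integral_eq_sum_jumps]
  have h4 := (tendsto_const_nhds.congr' (h2.mono fun r hr => hr.symm)).sub h1
  simpa using h4

/-- The stochastic integral is adapted. -/
theorem exists_measurable_integral (hZ : IsStronglyPredictable 𝒳.filtration Z) {t T : ℝ≥0}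
    (ht : t ≤ T) : ∃ g : Ω → ℝ, Measurable[𝒳.filtration t] g ∧
      ∀ ω, 𝒳.FiniteEnergy Z T ω → 𝒳.integral Z 0 t ω = g ω := by
  refine ⟨fun ω => ∑ i, ∑ j ∈ Finset.univ.erase i,
      ((∑ s ∈ 𝒳.jumps 0 t ω, 𝒳.Xleft s ω i * 𝒳.X s ω j * (Z s ω j - Z s ω i))
        - ∫ s in Set.Ioc 0 t, 𝒳.rate i j (s, ω) * (Z s ω j - Z s ω i) ∂leb), ?_,
    fun ω h => 𝒳.integral_eq_sum_pairs hZ h ht⟩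
  refine Finset.measurable_sum _ fun i _ => Finset.measurable_sum _ fun j hj =>
    Measurable.sub ?_ ?_
  · have h1 := 𝒳.measurable_sum_jumps t (Finset.ne_of_mem_erase hj).symm
      (𝒳.measurable_stopped_of_predictable (𝒳.measurable_increment hZ i j) t)
    convert h1 using 1
    funext ω
    refine Finset.sum_congr rfl fun s hs => ?_
    rw [min_eq_left (𝒳.jumps_subset 0 t ω hs).2]
  · have h2 : Measurable[Prod.instMeasurableSpace (m₂ := 𝒳.filtration t)]
        fun p : ℝ≥0 × Ω => 𝒳.X (min p.1 t) p.2 i * 𝒳.A p.1 j i *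
          (Z (min p.1 t) p.2 j - Z (min p.1 t) p.2 i) :=
      ((𝒳.measurable_stopped_X t i).mul ((𝒳.isRateMatrix.measurable j i).comp
        (@measurable_fst _ _ _ (𝒳.filtration t)))).mul
        (𝒳.measurable_stopped_of_predictable (𝒳.measurable_increment hZ i j) t)
    have h3 := (@StronglyMeasurable.integral_prod_left' _ _ _ _ (𝒳.filtration t)
      (leb.restrict (Set.Ioc 0 t)) _ _ _ _ h2.stronglyMeasurable).measurable
    convert h3 using 1
    funext ω
    refine setIntegral_congr_fun measurableSet_Ioc fun s hs => ?_
    simp only [min_eq_left hs.2, rate]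

end MarkovChain

end MarkovRBSDE
end

/-! ### Orthogonality to the past and expected squared jumps -/

noncomputable section

namespace MarkovRBSDE

namespace MarkovChain

variable {Ω : Type*} [mΩ : MeasurableSpace Ω] {N : ℕ} {μ : Measure Ω} (𝒳 : MarkovChain N μ)

/-- The preimage of `S` is the rectangle `(u, v] × H⁻¹ S`, together with the complement of the strip
`(u, v] × Ω` when `0 ∈ S`. -/
theorem measurable_indicator_predictable {H : Ω → ℝ} {u : ℝ≥0}
    (hH : Measurable[𝒳.filtration u] H) (v : ℝ≥0) :
    Measurable[𝒳.filtration.predictable]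
      fun p : ℝ≥0 × Ω => (Set.Ioc u v).indicator (fun _ => H p.2) p.1 := by
  intro S hS
  have h1 : MeasurableSet[𝒳.filtration.predictable] (Set.Ioc u v ×ˢ (H ⁻¹' S)) :=
    measurableSet_predictable_Ioc_prod u v (hH hS)
  have h2 : MeasurableSet[𝒳.filtration.predictable] (Set.Ioc u v ×ˢ (Set.univ : Set Ω)) :=
    measurableSet_predictable_Ioc_prod u v MeasurableSet.univ
  by_cases h0 : (0 : ℝ) ∈ S
  · convert h1.union h2.compl using 1
    ext ⟨s, ω⟩
    by_cases hs : s ∈ Set.Ioc u v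
    · simp [hs]
    · simp only [Set.mem_preimage, Set.indicator_of_notMem hs, h0, true_iff]
      exact Or.inr fun h => hs h.1
  · convert h1 using 1
    ext ⟨s, ω⟩
    by_cases hs : s ∈ Set.Ioc u v
    · simp [hs]
    · simp only [Set.mem_preimage, Set.indicator_of_notMem hs, h0, false_iff]
      exact fun h => hs h.1

variable {Z : ℝ≥0 → Ω → (Fin N → ℝ)}

theorem sum_jumps_Ioc {u v T : ℝ≥0} (hv : v ≤ T) (ω : Ω) (g : ℝ≥0 → ℝ) :
    ∑ s ∈ 𝒳.jumps 0 T ω, (Set.Ioc u v).indicator g s = ∑ s ∈ 𝒳.jumps u v ω, g s := by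
  have hsub : 𝒳.jumps u v ω ⊆ 𝒳.jumps 0 T ω := fun s hs => by
    obtain ⟨h1, h2⟩ := 𝒳.mem_jumps.1 hs
    exact 𝒳.mem_jumps.2 ⟨Set.Ioc_subset_Ioc zero_le hv h1, h2⟩
  rw [← Finset.sum_subset hsub]
  · refine Finset.sum_congr rfl fun s hs => ?_
    rw [Set.indicator_of_mem (𝒳.jumps_subset u v ω hs)]
  · intro s hs hs'
    rw [Set.indicator_of_notMem]
    exact fun h => hs' (𝒳.mem_jumps.2 ⟨h, (𝒳.mem_jumps.1 hs).2⟩)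

theorem setIntegral_indicator_Ioc {u v T : ℝ≥0} (hv : v ≤ T) (g : ℝ≥0 → ℝ) :
    ∫ s in Set.Ioc 0 T, (Set.Ioc u v).indicator g s ∂leb = ∫ s in Set.Ioc u v, g s ∂leb := by
  rw [setIntegral_indicator measurableSet_Ioc,
    Set.inter_eq_self_of_subset_right (Set.Ioc_subset_Ioc zero_le hv)]

theorem ae_finiteEnergy (hZ : IsStronglyPredictable 𝒳.filtration Z) {T : ℝ≥0}
    (hE : ∫⁻ ω, ∫⁻ s in Set.Ioc 0 T, ENNReal.ofReal (𝒳.energy s ω (Z s ω)) ∂leb ∂μ < ∞) :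
    ∀ᵐ ω ∂μ, 𝒳.FiniteEnergy Z T ω :=
  ae_lt_top ((𝒳.measurable_energy hZ).ennreal_ofReal.lintegral_prod_left') hE.ne

section probability

variable [IsProbabilityMeasure μ]

/-- The stochastic integral over `(u, v]` is orthogonal to the square-integrable random variables
that are known at time `u`. -/
theorem integral_mul_integral_eq_zero (hZ : IsStronglyPredictable 𝒳.filtration Z) {T : ℝ≥0}
    (hE : ∫⁻ ω, ∫⁻ s in Set.Ioc 0 T, ENNReal.ofReal (𝒳.energy s ω (Z s ω)) ∂leb ∂μ < ∞)
    {u v : ℝ≥0} (hv : v ≤ T) {H : Ω → ℝ} (hH : Measurable[𝒳.filtration u] H)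
    (hH2 : MemLp H 2 μ) :
    Integrable (fun ω => H ω * 𝒳.integral Z u v ω) μ ∧ ∫ ω, H ω * 𝒳.integral Z u v ω ∂μ = 0 := by
  obtain ⟨b, hb0, hb⟩ := 𝒳.exists_rate_bound
  -- Since `H` is known at time `u`, multiplying by `1_{(u,v]} H` keeps the integrand predictable,
  -- so `H ∫ Z' dM` is itself a sum of compensated jump sums.
  let W : Fin N → Fin N → ℝ≥0 × Ω → ℝ := fun i j p =>
    (Set.Ioc u v).indicator (fun _ => H p.2) p.1 * (Z p.1 p.2 j - Z p.1 p.2 i)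
  have hW : ∀ i j, Measurable[𝒳.filtration.predictable] (W i j) := fun i j =>
    (𝒳.measurable_indicator_predictable hH v).mul (𝒳.measurable_increment hZ i j)
  have hWeq : ∀ i j s ω, W i j (s, ω)
      = (Set.Ioc u v).indicator (fun s => H ω * (Z s ω j - Z s ω i)) s := by
    intro i j s ω
    by_cases hs : s ∈ Set.Ioc u v <;> simp [W, hs]
  have hfin : ∀ i, ∀ j ∈ Finset.univ.erase i,
      ∫⁻ ω, ∫⁻ s in Set.Ioc 0 T, ENNReal.ofReal (𝒳.rate i j (s, ω) * |W i j (s, ω)|) ∂leb ∂μ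
        < ∞ := by
    intro i j hj
    have hij := (Finset.ne_of_mem_erase hj).symm
    -- The product of `H` and the increment of `Z` is split into squares; the rate is bounded in
    -- front of `H²` and kept in front of the other square, where it gives the energy.
    have hpt : ∀ s ω, 𝒳.rate i j (s, ω) * |W i j (s, ω)|
        ≤ b * H ω ^ 2 + 𝒳.energy s ω (Z s ω) := by
      intro s ω
      have h1 := 𝒳.rate_mul_sq_le_energy hij s ω (Z s ω)
      have h2 := 𝒳.rate_le hb i j (s, ω)
      have h3 := 𝒳.rate_nonneg hij (s, ω)
      have h4 : |W i j (s, ω)| ≤ |H ω| * |Z s ω j - Z s ω i| := by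
        rw [hWeq, ← abs_mul]
        exact norm_indicator_le_norm_self (fun s => H ω * (Z s ω j - Z s ω i)) s
      have h5 : |H ω| * |Z s ω j - Z s ω i| ≤ H ω ^ 2 + (Z s ω j - Z s ω i) ^ 2 := by
        rw [← sq_abs (H ω), ← sq_abs (Z s ω j - Z s ω i)]
        nlinarith [sq_nonneg (|H ω| - |Z s ω j - Z s ω i|), sq_nonneg (|H ω|),
          sq_nonneg (|Z s ω j - Z s ω i|)]
      calc 𝒳.rate i j (s, ω) * |W i j (s, ω)|
          ≤ 𝒳.rate i j (s, ω) * (H ω ^ 2 + (Z s ω j - Z s ω i) ^ 2) :=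
            mul_le_mul_of_nonneg_left (h4.trans h5) h3
        _ ≤ _ := by nlinarith [mul_le_mul_of_nonneg_right h2 (sq_nonneg (H ω))]
    have hHm : Measurable H := hH.mono (𝒳.filtration.le u) le_rfl
    calc _ ≤ ∫⁻ ω, ∫⁻ s in Set.Ioc 0 T, (ENNReal.ofReal (b * H ω ^ 2)
          + ENNReal.ofReal (𝒳.energy s ω (Z s ω))) ∂leb ∂μ := by
          refine lintegral_mono fun ω => lintegral_mono fun s => ?_
          exact (ENNReal.ofReal_le_ofReal (hpt s ω)).trans ENNReal.ofReal_add_le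
      _ = ∫⁻ ω, (ENNReal.ofReal (b * H ω ^ 2) * leb (Set.Ioc 0 T)
          + ∫⁻ s in Set.Ioc 0 T, ENNReal.ofReal (𝒳.energy s ω (Z s ω)) ∂leb) ∂μ := by
          refine lintegral_congr fun ω => ?_
          rw [lintegral_add_left measurable_const, setLIntegral_const]
      _ = (∫⁻ ω, ENNReal.ofReal (b * H ω ^ 2) ∂μ) * leb (Set.Ioc 0 T)
          + ∫⁻ ω, ∫⁻ s in Set.Ioc 0 T, ENNReal.ofReal (𝒳.energy s ω (Z s ω)) ∂leb ∂μ := by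
          have hm : Measurable fun ω => ENNReal.ofReal (b * H ω ^ 2) :=
            ((hHm.pow_const 2).const_mul b).ennreal_ofReal
          rw [lintegral_add_left (hm.mul_const _), lintegral_mul_const _ hm]
      _ < ∞ := by
          refine ENNReal.add_lt_top.2 ⟨ENNReal.mul_lt_top ?_ (by rw [leb_Ioc]; simp), hE⟩
          rw [← hasFiniteIntegral_iff_ofReal (Eventually.of_forall fun ω => by positivity)]
          exact (hH2.integrable_sq.const_mul b).2
  have hCF := fun i j (hj : j ∈ Finset.univ.erase i) => 𝒳.integral_sum_jumps T
    (Finset.ne_of_mem_erase hj).symm (hW i j) (hfin i j hj)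
  have hae : (fun ω => H ω * 𝒳.integral Z u v ω) =ᵐ[μ] fun ω =>
      ∑ i, ∑ j ∈ Finset.univ.erase i,
        ((∑ s ∈ 𝒳.jumps 0 T ω, 𝒳.Xleft s ω i * 𝒳.X s ω j * W i j (s, ω))
          - ∫ s in Set.Ioc 0 T, 𝒳.rate i j (s, ω) * W i j (s, ω) ∂leb) := by
    filter_upwards [𝒳.ae_finiteEnergy hZ hE] with ω hω
    rw [𝒳.integral_eq_sum_pairs hZ hω hv, Finset.mul_sum]
    refine Finset.sum_congr rfl fun i _ => ?_
    rw [Finset.mul_sum]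
    refine Finset.sum_congr rfl fun j _ => ?_
    rw [mul_sub]
    congr 1
    · rw [Finset.mul_sum, ← 𝒳.sum_jumps_Ioc hv]
      refine Finset.sum_congr rfl fun s _ => ?_
      rw [hWeq]
      by_cases hs : s ∈ Set.Ioc u v
      · simp only [Set.indicator_of_mem hs]; ring
      · simp [hs]
    · rw [← integral_const_mul, ← setIntegral_indicator_Ioc hv]
      refine integral_congr_ae (Eventually.of_forall fun s => ?_)
      simp only [hWeq]
      by_cases hs : s ∈ Set.Ioc u v
      · simp only [Set.indicator_of_mem hs]; ring
      · simp [hs]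
  have hi : ∀ i, ∀ j ∈ Finset.univ.erase i, Integrable (fun ω =>
        (∑ s ∈ 𝒳.jumps 0 T ω, 𝒳.Xleft s ω i * 𝒳.X s ω j * W i j (s, ω))
          - ∫ s in Set.Ioc 0 T, 𝒳.rate i j (s, ω) * W i j (s, ω) ∂leb) μ := fun i j hj =>
    (hCF i j hj).1.sub (hCF i j hj).2.1
  refine ⟨(integrable_congr hae).2 (integrable_finsetSum _ fun i _ =>
    integrable_finsetSum _ (hi i)), ?_⟩
  rw [integral_congr_ae hae, integral_finsetSum _ fun i _ => integrable_finsetSum _ (hi i)]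
  refine Finset.sum_eq_zero fun i _ => ?_
  rw [integral_finsetSum _ (hi i)]
  refine Finset.sum_eq_zero fun j hj => ?_
  rw [integral_sub (hCF i j hj).1 (hCF i j hj).2.1, (hCF i j hj).2.2, sub_self]

/-- The expected sum of the squared jumps of the stochastic integral. -/
theorem lintegral_sum_jumps_sq (hZ : IsStronglyPredictable 𝒳.filtration Z) {t T : ℝ≥0} :
    ∫⁻ ω, ENNReal.ofReal (∑ s ∈ 𝒳.jumps t T ω, (Z s ω ⬝ᵥ (𝒳.X s ω - 𝒳.Xleft s ω)) ^ 2) ∂μ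
      = ∫⁻ ω, ∫⁻ s in Set.Ioc t T, ENNReal.ofReal (𝒳.energy s ω (Z s ω)) ∂leb ∂μ := by
  let W : Fin N → Fin N → ℝ≥0 × Ω → ℝ≥0∞ := fun i j p =>
    ENNReal.ofReal ((Set.Ioc t T).indicator (fun _ => (1 : ℝ)) p.1
      * (Z p.1 p.2 j - Z p.1 p.2 i) ^ 2)
  have hW : ∀ i j, Measurable[𝒳.filtration.predictable] (W i j) := fun i j =>
    ((𝒳.measurable_indicator_predictable (H := fun _ => 1) measurable_const T).mul
      ((𝒳.measurable_increment hZ i j).pow_const 2)).ennreal_ofReal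
  have hW' : ∀ i j, Measurable (W i j) := fun i j => (hW i j).mono 𝒳.predictable_le le_rfl
  have hw : ∀ i j s ω, 0 ≤ 𝒳.Xleft s ω i * 𝒳.X s ω j := fun i j s ω =>
    mul_nonneg (𝒳.Xleft_nonneg s ω i) (𝒳.X_nonneg s ω j)
  have e1 : ∀ ω, ENNReal.ofReal (∑ s ∈ 𝒳.jumps t T ω, (Z s ω ⬝ᵥ (𝒳.X s ω - 𝒳.Xleft s ω)) ^ 2)
      = ∑ i, ∑ j ∈ Finset.univ.erase i, ∑ s ∈ 𝒳.jumps 0 T ω,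
        ENNReal.ofReal (𝒳.Xleft s ω i * 𝒳.X s ω j) * W i j (s, ω) := by
    intro ω
    have hcomm : ∑ i, ∑ j ∈ Finset.univ.erase i, ∑ s ∈ 𝒳.jumps 0 T ω,
        ENNReal.ofReal (𝒳.Xleft s ω i * 𝒳.X s ω j) * W i j (s, ω)
        = ∑ s ∈ 𝒳.jumps 0 T ω, ∑ i, ∑ j ∈ Finset.univ.erase i,
          ENNReal.ofReal (𝒳.Xleft s ω i * 𝒳.X s ω j) * W i j (s, ω) := by
      rw [Finset.sum_comm]
      exact Finset.sum_congr rfl fun i _ => Finset.sum_comm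
    rw [hcomm, ← 𝒳.sum_jumps_Ioc le_rfl, ENNReal.ofReal_sum_of_nonneg
      fun s _ => Set.indicator_nonneg (fun _ _ => sq_nonneg _) s]
    refine Finset.sum_congr rfl fun s _ => ?_
    by_cases hs : s ∈ Set.Ioc t T
    · rw [Set.indicator_of_mem hs,
        dotProduct_sub_states_sq (𝒳.Xleft_mem_states s ω) (𝒳.X_mem_states s ω),
        ENNReal.ofReal_sum_of_nonneg fun i _ => Finset.sum_nonneg fun j _ =>
          mul_nonneg (hw i j s ω) (sq_nonneg _)]
      refine Finset.sum_congr rfl fun i _ => ?_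
      rw [ENNReal.ofReal_sum_of_nonneg fun j _ => mul_nonneg (hw i j s ω) (sq_nonneg _)]
      refine Finset.sum_congr rfl fun j _ => ?_
      simp only [W, Set.indicator_of_mem hs, one_mul]
      rw [ENNReal.ofReal_mul (hw i j s ω)]
    · simp [W, hs]
  have hWs : ∀ i j ω, Measurable fun s => ENNReal.ofReal (𝒳.rate i j (s, ω)) * W i j (s, ω) :=
    fun i j ω => (((𝒳.measurable_rate i j).ennreal_ofReal).mul (hW' i j)).comp
      (measurable_id.prodMk measurable_const)
  have e2 : ∀ ω, ∫⁻ s in Set.Ioc t T, ENNReal.ofReal (𝒳.energy s ω (Z s ω)) ∂leb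
      = ∑ i, ∑ j ∈ Finset.univ.erase i, ∫⁻ s in Set.Ioc 0 T,
        ENNReal.ofReal (𝒳.rate i j (s, ω)) * W i j (s, ω) ∂leb := by
    intro ω
    simp_rw [← lintegral_finsetSum _ fun j _ => hWs _ j ω]
    rw [← lintegral_finsetSum _ fun i _ => Finset.measurable_sum _ fun j _ => hWs i j ω,
      ← Set.inter_eq_self_of_subset_left (Set.Ioc_subset_Ioc (zero_le (a := t)) (le_refl T)),
      ← Measure.restrict_restrict measurableSet_Ioc, ← lintegral_indicator measurableSet_Ioc]
    refine lintegral_congr fun s => ?_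
    by_cases hs : s ∈ Set.Ioc t T
    · have hr : ∀ i, ∀ j ∈ Finset.univ.erase i, 0 ≤ 𝒳.rate i j (s, ω) * (Z s ω j - Z s ω i) ^ 2 :=
        fun i j hj => mul_nonneg (𝒳.rate_nonneg (Finset.ne_of_mem_erase hj).symm _) (sq_nonneg _)
      rw [Set.indicator_of_mem hs, energy,
        ENNReal.ofReal_sum_of_nonneg fun i _ => Finset.sum_nonneg (hr i)]
      refine Finset.sum_congr rfl fun i _ => ?_
      rw [ENNReal.ofReal_sum_of_nonneg (hr i)]
      refine Finset.sum_congr rfl fun j hj => ?_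
      simp only [W, Set.indicator_of_mem hs, one_mul]
      rw [ENNReal.ofReal_mul (𝒳.rate_nonneg (Finset.ne_of_mem_erase hj).symm _)]
    · simp [W, hs]
  have hm1 : ∀ i, ∀ j ∈ Finset.univ.erase i, Measurable fun ω => ∑ s ∈ 𝒳.jumps 0 T ω,
      ENNReal.ofReal (𝒳.Xleft s ω i * 𝒳.X s ω j) * W i j (s, ω) := by
    intro i j hj
    simp_rw [← 𝒳.lintegral_jumpMeasure i j T _ fun s => W i j (s, _)]
    exact Measurable.lintegral_kernel_prod_right'
      (κ := 𝒳.jumpKernel T (Finset.ne_of_mem_erase hj).symm) ((hW' i j).comp measurable_swap)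
  have hm2 : ∀ i j, Measurable fun ω => ∫⁻ s in Set.Ioc 0 T,
      ENNReal.ofReal (𝒳.rate i j (s, ω)) * W i j (s, ω) ∂leb := fun i j =>
    (((𝒳.measurable_rate i j).ennreal_ofReal).mul (hW' i j)).lintegral_prod_left'
  simp_rw [e1, e2]
  rw [lintegral_finsetSum _ fun i _ => Finset.measurable_sum _ (hm1 i),
    lintegral_finsetSum _ fun i _ => Finset.measurable_sum _ fun j _ => hm2 i j]
  refine Finset.sum_congr rfl fun i _ => ?_
  rw [lintegral_finsetSum _ (hm1 i), lintegral_finsetSum _ fun j _ => hm2 i j]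
  exact Finset.sum_congr rfl fun j hj =>
    𝒳.lintegral_sum_jumps T (Finset.ne_of_mem_erase hj).symm (hW i j)

end probability

end MarkovChain

end MarkovRBSDE
end

/-! ### Doob's maximal inequality in `L²` -/

noncomputable section

namespace MarkovRBSDE

/-- A pathwise form of Doob's inequality. -/
theorem sq_partialSups_le (y : ℕ → ℝ) (n : ℕ) :
    partialSups y n ^ 2 / 2 + ∑ k ∈ Finset.range n, partialSups y k * (y (k + 1) - y k)
      ≤ partialSups y n * y n := by
  induction n with
  | zero => simp only [partialSups_zero, Finset.range_zero, Finset.sum_empty]; nlinarith [sq_nonneg (y 0)]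
  | succ n ih =>
    rw [Finset.sum_range_succ, partialSups_add_one]
    -- Without a new maximum both sides grow by the same amount. With one, the slack is half the
    -- square of `y (n + 1) - partialSups y n`.
    rcases le_total (y (n + 1)) (partialSups y n) with h | h
    · rw [sup_eq_left.2 h]; linarith
    · rw [sup_eq_right.2 h]; nlinarith [sq_nonneg (y (n + 1) - partialSups y n)]

theorem memLp_partialSups {Ω : Type*} [MeasurableSpace Ω] {μ : Measure Ω} {Y : ℕ → Ω → ℝ} (hY : ∀ k, MemLp (Y k) 2 μ) (n : ℕ) :
    MemLp (fun ω => partialSups (fun k => Y k ω) n) 2 μ := by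
  induction n with
  | zero => simpa using hY 0
  | succ n ih =>
    simp only [partialSups_add_one]
    exact ih.sup (hY (n + 1))

theorem measurable_partialSups {Ω : Type*} {m : MeasurableSpace Ω} {Y : ℕ → Ω → ℝ} {n : ℕ}
    (hY : ∀ k ≤ n, Measurable (Y k)) : Measurable fun ω => partialSups (fun k => Y k ω) n := by
  induction n with
  | zero => simpa using hY 0 le_rfl
  | succ n ih =>
    simp only [partialSups_add_one]
    exact (ih fun k hk => hY k (hk.trans n.le_succ)).sup (hY (n + 1) le_rfl)

variable {Ω : Type*} [mΩ : MeasurableSpace Ω] {μ : Measure Ω} [IsProbabilityMeasure μ]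

/-- The known factor `H` is pulled inside the conditional expectation, which is then averaged out.
-/
theorem integral_mul_condExp {m : MeasurableSpace Ω} (hm : m ≤ mΩ) {H η : Ω → ℝ}
    (hH : Measurable[m] H) (hH2 : MemLp H 2 μ) (hη : MemLp η 2 μ) :
    ∫ ω, H ω * (μ[η | m]) ω ∂μ = ∫ ω, H ω * η ω ∂μ := by
  have hi : Integrable (H * η) μ := hH2.integrable_mul hη
  rw [← integral_condExp hm (f := fun ω => H ω * η ω)]
  refine integral_congr_ae ?_
  exact (condExp_mul_of_stronglyMeasurable_left hH.stronglyMeasurable hi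
    (hη.integrable one_le_two)).symm

/-- Doob's maximal inequality in `L²` along finitely many times. -/
theorem integral_sq_partialSups_condExp_le (𝓕 : Filtration ℝ≥0 mΩ) {τ : ℕ → ℝ≥0} (hτ : Monotone τ)
    {η : Ω → ℝ} (hη : MemLp η 2 μ) (n : ℕ) :
    ∫ ω, partialSups (fun k => (μ[η | 𝓕 (τ k)]) ω) n ^ 2 ∂μ ≤ 4 * ∫ ω, η ω ^ 2 ∂μ := by
  set Y : ℕ → Ω → ℝ := fun k => μ[η | 𝓕 (τ k)] with hYdef
  have hY2 : ∀ k, MemLp (Y k) 2 μ := fun k => hη.condExp one_le_two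
  have hYm : ∀ k, Measurable[𝓕 (τ k)] (Y k) := fun k => stronglyMeasurable_condExp.measurable
  have hMm : ∀ k, Measurable[𝓕 (τ k)] fun ω => partialSups (fun k => Y k ω) k := fun k =>
    measurable_partialSups fun l hl => (hYm l).mono (𝓕.mono (hτ hl)) le_rfl
  have hM2 := memLp_partialSups hY2
  have hprod : ∀ k l, Integrable (fun ω => partialSups (fun k => Y k ω) k * Y l ω) μ := fun k l =>
    (hM2 k).integrable_mul (hY2 l)
  -- The running maximum at step `k` is known at `τ k`, so both products have the expectation of
  -- that maximum times `η`.
  have hinc : ∀ k, ∫ ω, partialSups (fun k => Y k ω) k * (Y (k + 1) ω - Y k ω) ∂μ = 0 := by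
    intro k
    simp_rw [mul_sub]
    rw [integral_sub (hprod k (k + 1)) (hprod k k)]
    rw [integral_mul_condExp (𝓕.le _) (hMm k) (hM2 k) hη,
      integral_mul_condExp (𝓕.le _) ((hMm k).mono (𝓕.mono (hτ k.le_succ)) le_rfl) (hM2 k) hη,
      sub_self]
  have hterm : ∀ k, Integrable (fun ω =>
      partialSups (fun k => Y k ω) k * (Y (k + 1) ω - Y k ω)) μ := fun k =>
    (hM2 k).integrable_mul ((hY2 (k + 1)).sub (hY2 k))
  have hsum : Integrable (fun ω => ∑ k ∈ Finset.range n,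
      partialSups (fun k => Y k ω) k * (Y (k + 1) ω - Y k ω)) μ :=
    integrable_finsetSum _ fun k _ => hterm k
  have hsq : Integrable (fun ω => partialSups (fun k => Y k ω) n ^ 2) μ := (hM2 n).integrable_sq
  have h1 : ∫ ω, (partialSups (fun k => Y k ω) n ^ 2 / 2 + ∑ k ∈ Finset.range n,
      partialSups (fun k => Y k ω) k * (Y (k + 1) ω - Y k ω)) ∂μ
      ≤ ∫ ω, partialSups (fun k => Y k ω) n * Y n ω ∂μ :=
    integral_mono ((hsq.div_const 2).add hsum) (hprod n n) fun ω =>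
      sq_partialSups_le (fun k => Y k ω) n
  rw [integral_add (hsq.div_const 2) hsum, integral_finsetSum _ fun k _ => hterm k, Finset.sum_eq_zero fun k _ => hinc k,
    integral_div, integral_mul_condExp (𝓕.le _) (hMm n) (hM2 n) hη] at h1
  -- Young's inequality with a quarter of the squared maximum: half of it stands on the left, and
  -- the remaining quarter produces the factor `4`.
  have h2 : ∫ ω, partialSups (fun k => Y k ω) n * η ω ∂μ
      ≤ ∫ ω, (partialSups (fun k => Y k ω) n ^ 2 / 4 + η ω ^ 2) ∂μ := by
    refine integral_mono ((hM2 n).integrable_mul hη) ((hsq.div_const 4).add hη.integrable_sq)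
      fun ω => ?_
    simp only
    nlinarith [sq_nonneg (partialSups (fun k => Y k ω) n / 2 - η ω)]
  rw [integral_add (hsq.div_const 4) hη.integrable_sq, integral_div] at h2
  linarith

/-- Doob's maximal inequality in `L²` for a right-continuous process that is dominated by a closed
martingale. -/
theorem exists_sup_bound (𝓕 : Filtration ℝ≥0 mΩ) {T : ℝ≥0} {V : ℝ≥0 → Ω → ℝ}
    (hV : ∀ t ≤ T, Measurable (V t))
    (hc : ∀ᵐ ω ∂μ, ∀ t < T, ContinuousWithinAt (fun s => V s ω) (Set.Ici t) t)
    {η : Ω → ℝ} (hη : MemLp η 2 μ) (hle : ∀ t ≤ T, ∀ᵐ ω ∂μ, |V t ω| ≤ (μ[η | 𝓕 t]) ω) :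
    ∃ Q : Ω → ℝ≥0∞, Measurable Q ∧ ∫⁻ ω, Q ω ∂μ ≤ ENNReal.ofReal (4 * ∫ ω, η ω ^ 2 ∂μ) ∧
      ∀ᵐ ω ∂μ, ∀ t ≤ T, ENNReal.ofReal (V t ω ^ 2) ≤ Q ω := by
  let g : ℕ → Ω → ℝ≥0∞ := fun n ω => ⨆ k ∈ Finset.range (2 ^ n + 1),
    ENNReal.ofReal (V (part 0 T n k) ω ^ 2)
  have hpT : ∀ n, ∀ k ∈ Finset.range (2 ^ n + 1), part 0 T n k ≤ T := fun n k hk =>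
    part_le zero_le (Nat.lt_succ_iff.1 (Finset.mem_range.1 hk))
  have hgm : ∀ n, Measurable (g n) := fun n =>
    Measurable.biSup _ (Finset.countable_toSet _) fun k hk => ((hV _ (hpT n k hk)).pow_const 2).ennreal_ofReal
  -- The partitions are nested, point `k` of level `n` being point `2 * k` of level `n + 1`, so
  -- monotone convergence applies.
  have hmono : Monotone g := by
    refine monotone_nat_of_le_succ fun n ω => ?_
    refine iSup₂_le fun k hk => ?_
    have e : part 0 T n k = part 0 T (n + 1) (2 * k) := by
      simp only [part, pow_succ, Nat.cast_mul, Nat.cast_ofNat]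
      rw [mul_comm (2 : ℝ≥0) k, mul_div_mul_right _ _ two_ne_zero]
    rw [e]
    refine le_iSup₂ (f := fun k (_ : k ∈ Finset.range (2 ^ (n + 1) + 1)) =>
      ENNReal.ofReal (V (part 0 T (n + 1) k) ω ^ 2)) (2 * k) ?_
    rw [Finset.mem_range] at hk ⊢
    rw [pow_succ]; omega
  refine ⟨fun ω => ⨆ n, g n ω, Measurable.iSup hgm, ?_, ?_⟩
  · rw [lintegral_iSup hgm hmono]
    refine iSup_le fun n => ?_
    have hM2 := memLp_partialSups (μ := μ)
      (Y := fun k => μ[η | 𝓕 (part 0 T n k)]) (fun k => hη.condExp one_le_two) (2 ^ n)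
    refine le_trans ?_ (ENNReal.ofReal_le_ofReal
      (integral_sq_partialSups_condExp_le 𝓕 (part_mono (a := 0) (b := T) (n := n)) hη (2 ^ n)))
    rw [ofReal_integral_eq_lintegral_ofReal hM2.integrable_sq
      (Eventually.of_forall fun ω => sq_nonneg _)]
    refine lintegral_mono_ae ?_
    have hall : ∀ᵐ ω ∂μ, ∀ k ∈ Finset.range (2 ^ n + 1),
        |V (part 0 T n k) ω| ≤ (μ[η | 𝓕 (part 0 T n k)]) ω :=
      (ae_ball_iff (Finset.countable_toSet _)).2 fun k hk => hle _ (hpT n k hk)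
    filter_upwards [hall] with ω hω
    refine iSup₂_le fun k hk => ENNReal.ofReal_le_ofReal ?_
    have h1 := (hω k hk).trans (le_partialSups_of_le (fun k => (μ[η | 𝓕 (part 0 T n k)]) ω)
      (Nat.lt_succ_iff.1 (Finset.mem_range.1 hk)))
    rw [← sq_abs]
    exact pow_le_pow_left₀ (abs_nonneg _) h1 2
  · filter_upwards [hc] with ω hω t ht
    have hmem : ∀ n k, k ≤ 2 ^ n → ENNReal.ofReal (V (part 0 T n k) ω ^ 2) ≤ ⨆ n, g n ω := by
      intro n k hk
      refine le_trans ?_ (le_iSup (fun n => g n ω) n)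
      exact le_iSup₂ (f := fun k (_ : k ∈ Finset.range (2 ^ n + 1)) =>
        ENNReal.ofReal (V (part 0 T n k) ω ^ 2)) k (Finset.mem_range.2 (Nat.lt_succ_iff.2 hk))
    -- The endpoints are grid points; an interior time is a limit of grid points from the right.
    rcases eq_or_ne t 0 with rfl | ht0
    · simpa using hmem 0 0 (by simp)
    rcases ht.eq_or_lt with rfl | hlt
    · simpa only [part_last (zero_le (a := t))] using hmem 0 (2 ^ 0) le_rfl
    have hts : t ∈ Set.Ioc 0 T := ⟨pos_iff_ne_zero.2 ht0, ht⟩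
    have h1 : Tendsto (fun n => ENNReal.ofReal (V (part 0 T n (idx 0 T n t + 1)) ω ^ 2)) atTop
        (𝓝 (ENNReal.ofReal (V t ω ^ 2))) :=
      (ENNReal.continuous_ofReal.tendsto _).comp
        (((hω t hlt).tendsto.comp (tendsto_part_idx_succ hts)).pow 2)
    exact le_of_tendsto' h1 fun n => hmem n _ (idx_lt (hts.1.trans_le hts.2) hts)

end MarkovRBSDE
end

/-! ### Reflected paths: basic properties and the supremum estimate -/

noncomputable section

namespace MarkovRBSDE

variable {Ω : Type*} [mΩ : MeasurableSpace Ω] {N : ℕ} {μ : Measure Ω}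

/-- The reflected equation `dV = -F dt - dK + Z' dM`, `V_T = ξ`, along a given driver path `F`,
with a right-continuous version of `V` and without the condition that `K` is minimal. -/
structure IsReflectedPath (𝒳 : MarkovChain N μ) (T : ℝ≥0) (ξ : Ω → ℝ) (F V : ℝ≥0 → Ω → ℝ)
    (Z : ℝ≥0 → Ω → (Fin N → ℝ)) (K : ℝ≥0 → Ω → ℝ) : Prop where
  ξ_memL2 : 𝒳.MemL2 T ξ
  V_adapted : ∀ t ≤ T, Measurable[𝒳.filtration t] (V t)
  V_right : ∀ ω, ∀ t < T, ContinuousWithinAt (fun s => V s ω) (Set.Ici t) t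
  Z_predictable : IsStronglyPredictable 𝒳.filtration Z
  Z_energy : ∫⁻ ω, ∫⁻ s in Set.Ioc 0 T, ENNReal.ofReal (𝒳.energy s ω (Z s ω)) ∂leb ∂μ < ∞
  F_progressive : ∀ t ≤ T, Measurable[Prod.instMeasurableSpace (m₂ := 𝒳.filtration t)]
    fun p : ℝ≥0 × Ω => F (min p.1 t) p.2
  F_integrable : ∀ᵐ ω ∂μ, IntegrableOn (fun s => F s ω) (Set.Ioc 0 T) leb
  F_memLp : MemLp (fun ω => ∫ s in Set.Ioc 0 T, |F s ω| ∂leb) 2 μ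
  K_memL2 : 𝒳.MemL2 T (K T)
  equation : ∀ᵐ ω ∂μ, ∀ t ≤ T,
    V t ω = ξ ω + (∫ s in Set.Ioc t T, F s ω ∂leb) + K T ω - K t ω - 𝒳.integral Z t T ω
  K_zero : ∀ᵐ ω ∂μ, K 0 ω = 0
  K_mono : ∀ᵐ ω ∂μ, MonotoneOn (fun t => K t ω) (Set.Icc 0 T)
  K_cont : ∀ᵐ ω ∂μ, ContinuousOn (fun t => K t ω) (Set.Icc 0 T)

namespace IsReflectedPath

variable {𝒳 : MarkovChain N μ} {T : ℝ≥0} {ξ : Ω → ℝ} {F V : ℝ≥0 → Ω → ℝ}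
  {Z : ℝ≥0 → Ω → (Fin N → ℝ)} {K : ℝ≥0 → Ω → ℝ}

/-- The almost sure properties of a solution at a fixed scenario. -/
structure Good (𝒳 : MarkovChain N μ) (T : ℝ≥0) (ξ : Ω → ℝ) (F V : ℝ≥0 → Ω → ℝ)
    (Z : ℝ≥0 → Ω → (Fin N → ℝ)) (K : ℝ≥0 → Ω → ℝ) (ω : Ω) : Prop where
  energy : 𝒳.FiniteEnergy Z T ω
  integrable : IntegrableOn (fun s => F s ω) (Set.Ioc 0 T) leb
  equation : ∀ t ≤ T,
    V t ω = ξ ω + (∫ s in Set.Ioc t T, F s ω ∂leb) + K T ω - K t ω - 𝒳.integral Z t T ω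
  zero : K 0 ω = 0
  mono : MonotoneOn (fun t => K t ω) (Set.Icc 0 T)
  cont : ContinuousOn (fun t => K t ω) (Set.Icc 0 T)

theorem ae_good (h : IsReflectedPath 𝒳 T ξ F V Z K) : ∀ᵐ ω ∂μ, Good 𝒳 T ξ F V Z K ω := by
  filter_upwards [𝒳.ae_finiteEnergy h.Z_predictable h.Z_energy, h.F_integrable, h.equation,
    h.K_zero, h.K_mono, h.K_cont] with ω h1 h2 h3 h4 h5 h6 using ⟨h1, h2, h3, h4, h5, h6⟩

theorem Good.K_nonneg {ω : Ω} (g : Good 𝒳 T ξ F V Z K ω) {t : ℝ≥0} (ht : t ≤ T) : 0 ≤ K t ω := by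
  rw [← g.zero]
  exact g.mono ⟨le_rfl, zero_le⟩ ⟨zero_le, ht⟩ zero_le

theorem Good.K_le {ω : Ω} (g : Good 𝒳 T ξ F V Z K ω) {s t : ℝ≥0} (hst : s ≤ t) (ht : t ≤ T) :
    K s ω ≤ K t ω :=
  g.mono ⟨zero_le, hst.trans ht⟩ ⟨zero_le, ht⟩ hst

theorem Good.increment (h : IsReflectedPath 𝒳 T ξ F V Z K) {ω : Ω} (g : Good 𝒳 T ξ F V Z K ω)
    {s t : ℝ≥0} (hst : s ≤ t) (ht : t ≤ T) :
    V s ω = V t ω + (∫ r in Set.Ioc s t, F r ω ∂leb) + (K t ω - K s ω) - 𝒳.integral Z s t ω := by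
  have h1 := 𝒳.integral_add h.Z_predictable g.energy hst ht le_rfl
  have h2 : ∫ r in Set.Ioc s T, F r ω ∂leb
      = (∫ r in Set.Ioc s t, F r ω ∂leb) + ∫ r in Set.Ioc t T, F r ω ∂leb := by
    rw [← Set.Ioc_union_Ioc_eq_Ioc hst ht, setIntegral_union (Set.Ioc_disjoint_Ioc_of_le le_rfl)
      measurableSet_Ioc]
    · exact g.integrable.mono_set (Set.Ioc_subset_Ioc zero_le ht)
    · exact g.integrable.mono_set (Set.Ioc_subset_Ioc zero_le le_rfl)
  rw [g.equation s (hst.trans ht), g.equation t ht, h2, ← h1]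
  ring

theorem Good.V_last {ω : Ω} (g : Good 𝒳 T ξ F V Z K ω) : V T ω = ξ ω := by
  have h2 := g.equation T le_rfl
  rw [MarkovChain.integral_eq_sum_jumps] at h2
  have : 𝒳.jumps T T ω = ∅ := by
    ext s; simp [MarkovChain.mem_jumps]
  simpa [this] using h2

/-- The terms with `F` and `K` are continuous in time, so `V` jumps exactly as the stochastic
integral does. -/
theorem Good.tendsto_left (h : IsReflectedPath 𝒳 T ξ F V Z K) {ω : Ω}
    (g : Good 𝒳 T ξ F V Z K ω) {s : ℝ≥0} (hs : s ≤ T) :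
    Tendsto (fun r => V r ω) (𝓝[<] s) (𝓝 (V s ω - Z s ω ⬝ᵥ (𝒳.X s ω - 𝒳.Xleft s ω))) := by
  have h1 := MarkovChain.tendsto_setIntegral_Ioc_left g.integrable hs
  have h2 := 𝒳.tendsto_integral_left h.Z_predictable g.energy hs
  have h3 : Tendsto (fun r => K s ω - K r ω) (𝓝[<] s) (𝓝 0) := by
    have hc : Tendsto (fun r => K r ω) (𝓝[<] s) (𝓝 (K s ω)) :=
      (g.cont s ⟨zero_le, hs⟩).tendsto.mono_left (nhdsWithin_le_iff.2
        (mem_of_superset self_mem_nhdsWithin fun r hr => ⟨zero_le, (le_of_lt hr).trans hs⟩))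
    simpa using (tendsto_const_nhds (x := K s ω)).sub hc
  have h4 := ((tendsto_const_nhds (x := V s ω)).add h1).add h3 |>.sub h2
  rw [add_zero, add_zero] at h4
  refine h4.congr' ?_
  filter_upwards [self_mem_nhdsWithin] with r hr
  rw [g.increment h (le_of_lt hr) hs]

theorem Good.abs_setIntegral_le {ω : Ω} (g : Good 𝒳 T ξ F V Z K ω) {s t : ℝ≥0} (ht : t ≤ T) :
    |∫ r in Set.Ioc s t, F r ω ∂leb| ≤ ∫ r in Set.Ioc 0 T, |F r ω| ∂leb :=
  (norm_integral_le_integral_norm _).trans (setIntegral_mono_set g.integrable.norm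
    (Eventually.of_forall fun _ => norm_nonneg _)
    (Set.Ioc_subset_Ioc zero_le ht).eventuallyLE)

theorem measurable_setIntegral (h : IsReflectedPath 𝒳 T ξ F V Z K) (s : ℝ≥0) {t : ℝ≥0} (ht : t ≤ T) :
    Measurable[𝒳.filtration t] fun ω => ∫ r in Set.Ioc s t, F r ω ∂leb := by
  have h3 := (@StronglyMeasurable.integral_prod_left' _ _ _ _ (𝒳.filtration t)
      (leb.restrict (Set.Ioc s t)) _ _ _ _ (h.F_progressive t ht).stronglyMeasurable).measurable
  convert h3 using 1
  funext ω
  refine setIntegral_congr_fun measurableSet_Ioc fun r hr => ?_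
  simp only [min_eq_left hr.2]

/-- The increasing process of a solution is adapted up to null sets. -/
theorem exists_measurable_K (h : IsReflectedPath 𝒳 T ξ F V Z K) {t : ℝ≥0} (ht : t ≤ T) :
    ∃ k : Ω → ℝ, Measurable[𝒳.filtration t] k ∧ K t =ᵐ[μ] k := by
  obtain ⟨I, hI, hI'⟩ := 𝒳.exists_measurable_integral h.Z_predictable ht
  refine ⟨fun ω => V 0 ω - V t ω - (∫ r in Set.Ioc 0 t, F r ω ∂leb) + I ω, ?_, ?_⟩
  · exact ((((h.V_adapted 0 zero_le).mono (𝒳.filtration.mono zero_le) le_rfl).sub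
      (h.V_adapted t ht)).sub (h.measurable_setIntegral 0 ht)).add hI
  · filter_upwards [h.ae_good] with ω g
    have := g.increment h (zero_le (a := t)) ht
    rw [g.zero, hI' ω g.energy] at this
    linarith

/-- Monotonicity gives `0 ≤ K_t ≤ K_T`. Measurability of `K_t` must be read off the equation,
because only `K_T` is assumed measurable. -/
theorem memLp_K (h : IsReflectedPath 𝒳 T ξ F V Z K) {t : ℝ≥0} (ht : t ≤ T) : MemLp (K t) 2 μ := by
  obtain ⟨k, hk, hk'⟩ := h.exists_measurable_K ht
  refine h.K_memL2.2.mono ?_ ?_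
  · exact ((hk.mono (𝒳.filtration.le t) le_rfl).aestronglyMeasurable).congr hk'.symm
  · filter_upwards [h.ae_good] with ω g
    rw [Real.norm_of_nonneg (g.K_nonneg ht), Real.norm_of_nonneg (g.K_nonneg le_rfl)]
    exact g.K_le ht le_rfl

theorem memLp_setIntegral (h : IsReflectedPath 𝒳 T ξ F V Z K) (s : ℝ≥0) {t : ℝ≥0} (ht : t ≤ T) :
    MemLp (fun ω => ∫ r in Set.Ioc s t, F r ω ∂leb) 2 μ := by
  refine h.F_memLp.mono ((h.measurable_setIntegral s ht).mono (𝒳.filtration.le t)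
    le_rfl).aestronglyMeasurable ?_
  filter_upwards [h.ae_good] with ω g
  refine (g.abs_setIntegral_le ht).trans (le_abs_self _)

theorem memLp_sup_bound (h : IsReflectedPath 𝒳 T ξ F V Z K) :
    MemLp (fun ω => |ξ ω| + (∫ s in Set.Ioc 0 T, |F s ω| ∂leb) + K T ω) 2 μ :=
  (h.ξ_memL2.2.abs.add h.F_memLp).add h.K_memL2.2

section probability

variable [IsProbabilityMeasure μ]

theorem integrable_integral (h : IsReflectedPath 𝒳 T ξ F V Z K) (s : ℝ≥0) {t : ℝ≥0} (ht : t ≤ T) :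
    Integrable (𝒳.integral Z s t) μ := by
  simpa using (𝒳.integral_mul_integral_eq_zero h.Z_predictable h.Z_energy (u := s) ht
    (H := fun _ => 1) measurable_const (memLp_const 1)).1

/-- Orthogonality tested with indicators of events known at time `s`. -/
theorem condExp_integral (h : IsReflectedPath 𝒳 T ξ F V Z K) (s : ℝ≥0) {t : ℝ≥0} (ht : t ≤ T) :
    μ[𝒳.integral Z s t | 𝒳.filtration s] =ᵐ[μ] 0 := by
  refine (ae_eq_condExp_of_forall_setIntegral_eq (𝒳.filtration.le s) (h.integrable_integral s ht)
    (fun _ _ _ => (integrable_zero _ _ _).integrableOn) (fun B hB _ => ?_)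
    aestronglyMeasurable_zero).symm
  have hB' := 𝒳.filtration.le s B hB
  have h1 := (𝒳.integral_mul_integral_eq_zero h.Z_predictable h.Z_energy (u := s) ht
    (H := B.indicator fun _ => 1) (measurable_const.indicator hB)
    ((memLp_const 1).indicator hB')).2
  rw [show ∫ ω in B, (0 : Ω → ℝ) ω ∂μ = 0 by simp, ← integral_indicator hB', ← h1]
  refine integral_congr_ae (Eventually.of_forall fun ω => ?_)
  by_cases hω : ω ∈ B <;> simp [hω]

/-- The random variable whose conditional expectations dominate `|V|`. -/
theorem abs_V_le_condExp (h : IsReflectedPath 𝒳 T ξ F V Z K) {t : ℝ≥0} (ht : t ≤ T) :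
    ∀ᵐ ω ∂μ, |V t ω| ≤
      (μ[fun ω => |ξ ω| + (∫ s in Set.Ioc 0 T, |F s ω| ∂leb) + K T ω | 𝒳.filtration t]) ω := by
  set η : Ω → ℝ := fun ω => |ξ ω| + (∫ s in Set.Ioc 0 T, |F s ω| ∂leb) + K T ω with hη
  have hηi : Integrable η μ := ((h.ξ_memL2.2.integrable one_le_two).abs.add
    (h.F_memLp.integrable one_le_two)).add (h.K_memL2.2.integrable one_le_two)
  set ζ : Ω → ℝ := fun ω => ξ ω + (∫ s in Set.Ioc t T, F s ω ∂leb) + K T ω - K t ω with hζ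
  have hζi : Integrable ζ μ := (((h.ξ_memL2.2.integrable one_le_two).add
    ((h.memLp_setIntegral t le_rfl).integrable one_le_two)).add
    (h.K_memL2.2.integrable one_le_two)).sub ((h.memLp_K ht).integrable one_le_two)
  have hI := h.integrable_integral t le_rfl
  have hVeq : V t =ᵐ[μ] ζ - 𝒳.integral Z t T := by
    filter_upwards [h.ae_good] with ω g
    exact g.equation t ht
  have hVi : Integrable (V t) μ := (integrable_congr hVeq).2 (hζi.sub hI)
  -- Conditioning leaves `V t` unchanged, since it is adapted, and removes the stochastic integral
  -- after `t`.
  have hVc : V t =ᵐ[μ] μ[ζ | 𝒳.filtration t] := by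
    have h1 : μ[V t | 𝒳.filtration t] = V t := condExp_of_stronglyMeasurable (𝒳.filtration.le t)
      (h.V_adapted t ht).stronglyMeasurable hVi
    have h2 := (condExp_congr_ae (m := 𝒳.filtration t) hVeq).trans
      (condExp_sub hζi hI (𝒳.filtration t))
    rw [h1] at h2
    filter_upwards [h2, h.condExp_integral t le_rfl] with ω h3 h4
    rw [h3, Pi.sub_apply, h4]
    simp
  have hb : ∀ᵐ ω ∂μ, |ζ ω| ≤ η ω := by
    filter_upwards [h.ae_good] with ω g
    have h1 := g.abs_setIntegral_le (s := t) le_rfl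
    have h2 := g.K_nonneg ht
    have h3 := g.K_le ht le_rfl
    simp only [hζ, hη]
    rw [abs_le] at h1 ⊢
    constructor <;> linarith [neg_abs_le (ξ ω), le_abs_self (ξ ω)]
  have hup := condExp_mono (m := 𝒳.filtration t) hζi hηi
    (hb.mono fun ω hω => (le_abs_self _).trans hω)
  have hlo := condExp_mono (m := 𝒳.filtration t) hηi.neg hζi
    (hb.mono fun ω hω => by
      simp only [Pi.neg_apply]
      linarith [neg_abs_le (ζ ω)])
  filter_upwards [hVc, hup, hlo, condExp_neg (μ := μ) η (𝒳.filtration t)] with ω h1 h2 h3 h4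
  rw [h1, abs_le]
  rw [h4, Pi.neg_apply] at h3
  exact ⟨h3, h2⟩

/-- The maximal inequality for `V`. -/
theorem exists_sup (h : IsReflectedPath 𝒳 T ξ F V Z K) :
    ∃ S : Ω → ℝ, MemLp S 2 μ ∧ (∀ᵐ ω ∂μ, 0 ≤ S ω ∧ ∀ t ≤ T, |V t ω| ≤ S ω) ∧
      ∫ ω, S ω ^ 2 ∂μ ≤
        4 * ∫ ω, (|ξ ω| + (∫ s in Set.Ioc 0 T, |F s ω| ∂leb) + K T ω) ^ 2 ∂μ := by
  obtain ⟨Q, hQ, hQi, hQV⟩ := exists_sup_bound 𝒳.filtration (T := T) (V := V)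
    (fun t ht => (h.V_adapted t ht).mono (𝒳.filtration.le t) le_rfl)
    (Eventually.of_forall h.V_right) h.memLp_sup_bound fun t ht => h.abs_V_le_condExp ht
  have hfin : ∀ᵐ ω ∂μ, Q ω < ∞ := ae_lt_top hQ (hQi.trans_lt ENNReal.ofReal_lt_top).ne
  have hsq : ∀ ω, (√(Q ω).toReal) ^ 2 = (Q ω).toReal := fun ω => Real.sq_sqrt ENNReal.toReal_nonneg
  refine ⟨fun ω => √(Q ω).toReal, ?_, ?_, ?_⟩
  · refine (memLp_two_iff_integrable_sq hQ.ennreal_toReal.sqrt.aestronglyMeasurable).2 ?_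
    simp_rw [hsq]
    exact integrable_toReal_of_lintegral_ne_top hQ.aemeasurable
      (hQi.trans_lt ENNReal.ofReal_lt_top).ne
  · filter_upwards [hfin, hQV] with ω h1 h2
    refine ⟨Real.sqrt_nonneg _, fun t ht => Real.abs_le_sqrt ?_⟩
    exact (ENNReal.ofReal_le_iff_le_toReal h1.ne).1 (h2 t ht)
  · simp_rw [hsq]
    rw [integral_toReal hQ.aemeasurable hfin]
    exact ENNReal.toReal_le_of_le_ofReal (by positivity) hQi

theorem memLp_V (h : IsReflectedPath 𝒳 T ξ F V Z K) {t : ℝ≥0} (ht : t ≤ T) : MemLp (V t) 2 μ := by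
  obtain ⟨S, hS, hSV, -⟩ := h.exists_sup
  refine hS.mono ((h.V_adapted t ht).mono (𝒳.filtration.le t) le_rfl).aestronglyMeasurable ?_
  filter_upwards [hSV] with ω hω
  exact (hω.2 t ht).trans (le_abs_self _)

end probability

end IsReflectedPath

end MarkovRBSDE
end

/-! ### Energy inequality and estimate of the increasing process -/

noncomputable section

namespace MarkovRBSDE

variable {Ω : Type*} [mΩ : MeasurableSpace Ω] {N : ℕ} {μ : Measure Ω}

open Classical in
/-- The Stieltjes measure `dK` on `[0, T]` of a path, zero if the path is not continuous and
increasing. -/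
def pathMeasure (T : ℝ≥0) (K : ℝ≥0 → Ω → ℝ) (ω : Ω) : Measure ℝ≥0 :=
  if h : MonotoneOn (fun t => K t ω) (Set.Icc 0 T) ∧ ContinuousOn (fun t => K t ω) (Set.Icc 0 T) then
    (pathStieltjes T (fun t => K t ω) h.1 h.2).measure
  else 0

namespace IsReflectedPath

variable {𝒳 : MarkovChain N μ} {T : ℝ≥0} {ξ : Ω → ℝ} {F V : ℝ≥0 → Ω → ℝ}
  {Z : ℝ≥0 → Ω → (Fin N → ℝ)} {K : ℝ≥0 → Ω → ℝ}

section path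

variable {ω : Ω}

theorem Good.pathMeasure_eq (g : Good 𝒳 T ξ F V Z K ω) :
    pathMeasure T K ω = (pathStieltjes T (fun t => K t ω) g.mono g.cont).measure := by
  rw [pathMeasure, dif_pos ⟨g.mono, g.cont⟩]

theorem Good.pathMeasure_real_Ioc (g : Good 𝒳 T ξ F V Z K ω) {s t : ℝ≥0} (hst : s ≤ t)
    (ht : t ≤ T) : (pathMeasure T K ω).real (Set.Ioc s t) = K t ω - K s ω := by
  rw [Measure.real, g.pathMeasure_eq, StieltjesFunction.measure_Ioc, ENNReal.toReal_ofReal]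
  · change K (min t T) ω - K (min s T) ω = _
    rw [min_eq_left ht, min_eq_left (hst.trans ht)]
  · exact sub_nonneg.2 ((pathStieltjes T (fun t => K t ω) g.mono g.cont).mono hst)

theorem Good.isFiniteMeasure (g : Good 𝒳 T ξ F V Z K ω) : IsFiniteMeasure (pathMeasure T K ω) := by
  rw [g.pathMeasure_eq]
  refine StieltjesFunction.isFiniteMeasure_of_forall_abs_le _ (C := K T ω) fun t => ?_
  change |K (min t T) ω| ≤ K T ω
  rw [abs_of_nonneg (g.K_nonneg (min_le_right _ _))]
  exact g.K_le (min_le_right _ _) le_rfl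

/-- Continuity of `K` excludes atoms, so the jump times of the chain are negligible for `dK`. -/
theorem Good.nullSingletonClass (g : Good 𝒳 T ξ F V Z K ω) :
    NullSingletonClass (pathMeasure T K ω) := by
  refine ⟨fun a => ?_⟩
  rw [g.pathMeasure_eq, StieltjesFunction.measure_singleton]
  have hc : Continuous (pathStieltjes T (fun t => K t ω) g.mono g.cont) :=
    g.cont.comp_continuous (continuous_id.min continuous_const)
      fun _ => ⟨zero_le, min_le_right _ _⟩
  rw [hc.continuousWithinAt.leftLim_eq]
  simp

theorem tendsto_right (h : IsReflectedPath 𝒳 T ξ F V Z K) (ω : Ω) {t s : ℝ≥0}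
    (hs : s ∈ Set.Ioc t T) :
    Tendsto (fun n => V (part t T n (idx t T n s + 1)) ω) atTop (𝓝 (V s ω)) := by
  rcases hs.2.eq_or_lt with rfl | hlt
  · have : ∀ n, part t s n (idx t s n s + 1) = s := fun n =>
      le_antisymm (part_idx_succ_le hs) (le_part_idx_succ hs)
    simp [this]
  · exact (h.V_right ω s hlt).tendsto.comp (tendsto_part_idx_succ hs)

theorem Good.tendsto_left_of_no_jump (h : IsReflectedPath 𝒳 T ξ F V Z K)
    (g : Good 𝒳 T ξ F V Z K ω) {t s : ℝ≥0} (hs : s ∈ Set.Ioc t T) (hX : 𝒳.Xleft s ω = 𝒳.X s ω) :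
    Tendsto (fun n => V (part t T n (idx t T n s)) ω) atTop (𝓝 (V s ω)) := by
  have h1 := (g.tendsto_left h hs.2).comp (tendsto_part_idx hs)
  simpa [hX, Function.comp_def] using h1

theorem Good.tendsto_sum_F (h : IsReflectedPath 𝒳 T ξ F V Z K) (g : Good 𝒳 T ξ F V Z K ω)
    {t : ℝ≥0} (ht : t ≤ T) {C : ℝ} (hC : ∀ s ≤ T, |V s ω| ≤ C) :
    Tendsto (fun n => ∑ k ∈ Finset.range (2 ^ n), V (part t T n k) ω *
      ∫ s in Set.Ioc (part t T n k) (part t T n (k + 1)), F s ω ∂leb) atTop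
      (𝓝 (∫ s in Set.Ioc t T, V s ω * F s ω ∂leb)) := by
  refine tendsto_sum_mul_setIntegral_part ht leb
    (g.integrable.mono_set (Set.Ioc_subset_Ioc zero_le le_rfl))
    (c := fun n k => V (part t T n k) ω) (fun n k hk => hC _ (part_le ht hk.le)) ?_
  filter_upwards [𝒳.ae_Xleft_eq_X ω leb t T, ae_restrict_mem measurableSet_Ioc] with s h1 h2
  exact g.tendsto_left_of_no_jump h h2 h1

theorem Good.tendsto_sum_K (g : Good 𝒳 T ξ F V Z K ω)
    {t : ℝ≥0} (ht : t ≤ T) {c : ℕ → ℕ → ℝ} {C : ℝ} (hC : ∀ n, ∀ k < 2 ^ n, |c n k| ≤ C)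
    {v : ℝ≥0 → ℝ} (hlim : ∀ᵐ s ∂(pathMeasure T K ω).restrict (Set.Ioc t T),
      Tendsto (fun n => c n (idx t T n s)) atTop (𝓝 (v s))) :
    Tendsto (fun n => ∑ k ∈ Finset.range (2 ^ n), c n k *
      (K (part t T n (k + 1)) ω - K (part t T n k) ω)) atTop
      (𝓝 (∫ s in Set.Ioc t T, v s ∂pathMeasure T K ω)) := by
  have hfin := g.isFiniteMeasure
  have h1 := tendsto_sum_mul_setIntegral_part ht (pathMeasure T K ω) (f := fun _ => 1)
    (integrable_const 1).integrableOn hC hlim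
  simp only [mul_one] at h1
  refine h1.congr fun n => Finset.sum_congr rfl fun k hk => ?_
  rw [setIntegral_const, g.pathMeasure_real_Ioc part_le_succ (part_le ht (Finset.mem_range.1 hk)),
    smul_eq_mul, mul_one]

/-- The values at left endpoints tend to the left limit of `V`, which is `V s` except at jump times;
these are null for `dK`. -/
theorem Good.tendsto_sum_V_K (h : IsReflectedPath 𝒳 T ξ F V Z K) (g : Good 𝒳 T ξ F V Z K ω)
    {t : ℝ≥0} (ht : t ≤ T) {C : ℝ} (hC : ∀ s ≤ T, |V s ω| ≤ C) :
    Tendsto (fun n => ∑ k ∈ Finset.range (2 ^ n), V (part t T n k) ω *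
      (K (part t T n (k + 1)) ω - K (part t T n k) ω)) atTop
      (𝓝 (∫ s in Set.Ioc t T, V s ω ∂pathMeasure T K ω)) := by
  have hnull := g.nullSingletonClass
  refine g.tendsto_sum_K ht (c := fun n k => V (part t T n k) ω)
    (fun n k hk => hC _ (part_le ht hk.le)) ?_
  filter_upwards [𝒳.ae_Xleft_eq_X ω _ t T, ae_restrict_mem measurableSet_Ioc] with s h1 h2
  exact g.tendsto_left_of_no_jump h h2 h1

theorem Good.sum_increments_K (g : Good 𝒳 T ξ F V Z K ω) {t : ℝ≥0} (ht : t ≤ T) (n : ℕ) :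
    ∑ k ∈ Finset.range (2 ^ n), (K (part t T n (k + 1)) ω - K (part t T n k) ω) ≤ K T ω := by
  rw [Finset.sum_range_sub fun k => K (part t T n k) ω, part_last ht, part_zero]
  linarith [g.K_nonneg ht]

theorem Good.abs_sum_mul_K_le (g : Good 𝒳 T ξ F V Z K ω) {t : ℝ≥0} (ht : t ≤ T) (n : ℕ)
    {c : ℕ → ℝ} {C : ℝ} (hC0 : 0 ≤ C) (hC : ∀ k < 2 ^ n, |c k| ≤ C) :
    |∑ k ∈ Finset.range (2 ^ n), c k * (K (part t T n (k + 1)) ω - K (part t T n k) ω)|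
      ≤ C * K T ω := by
  refine (Finset.abs_sum_le_sum_abs _ _).trans ?_
  refine le_trans ?_ (mul_le_mul_of_nonneg_left (g.sum_increments_K ht n) hC0)
  rw [Finset.mul_sum]
  refine Finset.sum_le_sum fun k hk => ?_
  have hk' := Finset.mem_range.1 hk
  rw [abs_mul, abs_of_nonneg (sub_nonneg.2 (g.K_le part_le_succ (part_le ht hk')))]
  exact mul_le_mul_of_nonneg_right (hC k hk')
    (sub_nonneg.2 (g.K_le part_le_succ (part_le ht hk')))

theorem Good.abs_sum_mul_F_le (g : Good 𝒳 T ξ F V Z K ω) {t : ℝ≥0} (ht : t ≤ T) (n : ℕ)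
    {c : ℕ → ℝ} {C : ℝ} (hC0 : 0 ≤ C) (hC : ∀ k < 2 ^ n, |c k| ≤ C) :
    |∑ k ∈ Finset.range (2 ^ n), c k *
      ∫ s in Set.Ioc (part t T n k) (part t T n (k + 1)), F s ω ∂leb|
      ≤ C * ∫ s in Set.Ioc 0 T, |F s ω| ∂leb := by
  have hF : IntegrableOn (fun s => |F s ω|) (Set.Ioc t T) leb :=
    IntegrableOn.mono_set g.integrable.abs (Set.Ioc_subset_Ioc zero_le le_rfl)
  have h1 := sum_mul_setIntegral_part (n := n) ht leb hF fun _ => (1 : ℝ)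
  simp only [one_mul] at h1
  calc _ ≤ ∑ k ∈ Finset.range (2 ^ n),
        C * ∫ s in Set.Ioc (part t T n k) (part t T n (k + 1)), |F s ω| ∂leb := by
        refine (Finset.abs_sum_le_sum_abs _ _).trans (Finset.sum_le_sum fun k hk => ?_)
        rw [abs_mul]
        exact mul_le_mul (hC k (Finset.mem_range.1 hk)) abs_integral_le_integral_abs
          (abs_nonneg _) hC0
    _ = C * ∫ s in Set.Ioc t T, |F s ω| ∂leb := by rw [← Finset.mul_sum, h1]
    _ ≤ _ := mul_le_mul_of_nonneg_left (setIntegral_mono_set g.integrable.abs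
        (Eventually.of_forall fun _ => abs_nonneg _)
        (Set.Ioc_subset_Ioc zero_le le_rfl).eventuallyLE) hC0

/-- Cells without jumps are discarded, and in every other cell the increment of `V` tends to its
jump. Only this direction is needed for Fatou. -/
theorem Good.jumps_sq_le_liminf (h : IsReflectedPath 𝒳 T ξ F V Z K) (g : Good 𝒳 T ξ F V Z K ω)
    (t : ℝ≥0) :
    ENNReal.ofReal (∑ s ∈ 𝒳.jumps t T ω, (Z s ω ⬝ᵥ (𝒳.X s ω - 𝒳.Xleft s ω)) ^ 2)
      ≤ liminf (fun n => ENNReal.ofReal (∑ k ∈ Finset.range (2 ^ n),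
        (V (part t T n (k + 1)) ω - V (part t T n k) ω) ^ 2)) atTop := by
  have h1 : Tendsto (fun n => ENNReal.ofReal (∑ s ∈ 𝒳.jumps t T ω,
      (V (part t T n (idx t T n s + 1)) ω - V (part t T n (idx t T n s)) ω) ^ 2)) atTop
      (𝓝 (ENNReal.ofReal (∑ s ∈ 𝒳.jumps t T ω, (Z s ω ⬝ᵥ (𝒳.X s ω - 𝒳.Xleft s ω)) ^ 2))) := by
    refine (ENNReal.continuous_ofReal.tendsto _).comp (tendsto_finsetSum _ fun s hs => ?_)
    have hs' := 𝒳.jumps_subset t T ω hs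
    have h2 := (h.tendsto_right ω hs').sub ((g.tendsto_left h hs'.2).comp (tendsto_part_idx hs'))
    rw [sub_sub_cancel] at h2
    exact h2.pow 2
  rw [← h1.liminf_eq]
  refine liminf_le_liminf ?_
  filter_upwards [eventually_injOn_idx (𝒳.jumps t T ω).finite_toSet (𝒳.jumps_subset t T ω)]
    with n hn
  refine ENNReal.ofReal_le_ofReal ?_
  rw [← Finset.sum_image (f := fun k => (V (part t T n (k + 1)) ω - V (part t T n k) ω) ^ 2) hn]
  refine Finset.sum_le_sum_of_subset_of_nonneg ?_ fun _ _ _ => sq_nonneg _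
  intro k hk
  obtain ⟨s, hs, rfl⟩ := Finset.mem_image.1 hk
  have hs' := 𝒳.jumps_subset t T ω hs
  exact Finset.mem_range.2 (idx_lt (hs'.1.trans_le hs'.2) hs')

/-- On each cell `y² - x² = (y - x)² + 2 x (y - x)`. Expanding around the left endpoint makes the
factor of the stochastic integral known when that integral starts. -/
theorem Good.sum_sq_increments (h : IsReflectedPath 𝒳 T ξ F V Z K) (g : Good 𝒳 T ξ F V Z K ω)
    {t : ℝ≥0} (ht : t ≤ T) (n : ℕ) :
    ∑ k ∈ Finset.range (2 ^ n), (V (part t T n (k + 1)) ω - V (part t T n k) ω) ^ 2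
      = ξ ω ^ 2 - V t ω ^ 2
        + 2 * ((∑ k ∈ Finset.range (2 ^ n), V (part t T n k) ω *
          ∫ s in Set.Ioc (part t T n k) (part t T n (k + 1)), F s ω ∂leb)
        + ∑ k ∈ Finset.range (2 ^ n), V (part t T n k) ω *
          (K (part t T n (k + 1)) ω - K (part t T n k) ω))
        - 2 * ∑ k ∈ Finset.range (2 ^ n), V (part t T n k) ω *
          𝒳.integral Z (part t T n k) (part t T n (k + 1)) ω := by
  have h1 : ξ ω ^ 2 - V t ω ^ 2 = ∑ k ∈ Finset.range (2 ^ n),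
      (V (part t T n (k + 1)) ω ^ 2 - V (part t T n k) ω ^ 2) := by
    rw [Finset.sum_range_sub fun k => V (part t T n k) ω ^ 2, part_last ht, part_zero, g.V_last]
  rw [h1, Finset.mul_sum, ← Finset.sum_add_distrib, Finset.mul_sum, ← Finset.sum_add_distrib,
    ← Finset.sum_sub_distrib]
  refine Finset.sum_congr rfl fun k hk => ?_
  have h2 := g.increment h (part_le_succ (a := t) (b := T) (n := n) (k := k))
    (part_le ht (Finset.mem_range.1 hk))
  generalize V (part t T n k) ω = x at *
  generalize V (part t T n (k + 1)) ω = y at *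
  generalize (∫ s in Set.Ioc (part t T n k) (part t T n (k + 1)), F s ω ∂leb) = a at *
  generalize 𝒳.integral Z (part t T n k) (part t T n (k + 1)) ω = b at *
  generalize K (part t T n (k + 1)) ω - K (part t T n k) ω = c at *
  have : c = x - y - a + b := by linarith
  rw [this]; ring

end path

section probability

variable [IsProbabilityMeasure μ]

theorem V_mul_integral (h : IsReflectedPath 𝒳 T ξ F V Z K) {s t : ℝ≥0} (hst : s ≤ t) (ht : t ≤ T) :
    Integrable (fun ω => V s ω * 𝒳.integral Z s t ω) μ ∧
      ∫ ω, V s ω * 𝒳.integral Z s t ω ∂μ = 0 :=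
  𝒳.integral_mul_integral_eq_zero h.Z_predictable h.Z_energy ht (h.V_adapted s (hst.trans ht))
    (h.memLp_V (hst.trans ht))

/-- The energy inequality for the square of `V`. -/
theorem energy_le (h : IsReflectedPath 𝒳 T ξ F V Z K) {t : ℝ≥0} (ht : t ≤ T) :
    Integrable (fun ω => (∫ s in Set.Ioc t T, V s ω * F s ω ∂leb)
      + ∫ s in Set.Ioc t T, V s ω ∂pathMeasure T K ω) μ ∧
    ∫⁻ ω, ∫⁻ s in Set.Ioc t T, ENNReal.ofReal (𝒳.energy s ω (Z s ω)) ∂leb ∂μ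
      ≤ ENNReal.ofReal ((∫ ω, ξ ω ^ 2 ∂μ) - (∫ ω, V t ω ^ 2 ∂μ)
        + 2 * ∫ ω, ((∫ s in Set.Ioc t T, V s ω * F s ω ∂leb)
          + ∫ s in Set.Ioc t T, V s ω ∂pathMeasure T K ω) ∂μ) ∧
    0 ≤ (∫ ω, ξ ω ^ 2 ∂μ) - (∫ ω, V t ω ^ 2 ∂μ)
        + 2 * ∫ ω, ((∫ s in Set.Ioc t T, V s ω * F s ω ∂leb)
          + ∫ s in Set.Ioc t T, V s ω ∂pathMeasure T K ω) ∂μ := by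
  obtain ⟨S, hS, hSV, -⟩ := h.exists_sup
  set L : Ω → ℝ := fun ω => (∫ s in Set.Ioc t T, V s ω * F s ω ∂leb)
      + ∫ s in Set.Ioc t T, V s ω ∂pathMeasure T K ω with hL
  set R : ℕ → Ω → ℝ := fun n ω => (∑ k ∈ Finset.range (2 ^ n), V (part t T n k) ω *
          ∫ s in Set.Ioc (part t T n k) (part t T n (k + 1)), F s ω ∂leb)
        + ∑ k ∈ Finset.range (2 ^ n), V (part t T n k) ω *
          (K (part t T n (k + 1)) ω - K (part t T n k) ω) with hR
  have hkT : ∀ n, ∀ k ∈ Finset.range (2 ^ n), part t T n (k + 1) ≤ T := fun n k hk =>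
    part_le ht (Finset.mem_range.1 hk)
  have hkT' : ∀ n, ∀ k ∈ Finset.range (2 ^ n), part t T n k ≤ T := fun n k hk =>
    part_le ht (Finset.mem_range.1 hk).le
  have hRi : ∀ n, Integrable (R n) μ := fun n =>
    (integrable_finsetSum _ fun k hk => (h.memLp_V (hkT' n k hk)).integrable_mul
      (h.memLp_setIntegral _ (hkT n k hk))).add
    (integrable_finsetSum _ fun k hk => (h.memLp_V (hkT' n k hk)).integrable_mul
      ((h.memLp_K (hkT n k hk)).sub (h.memLp_K (hkT' n k hk))))
  have hRL : ∀ᵐ ω ∂μ, Tendsto (fun n => R n ω) atTop (𝓝 (L ω)) := by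
    filter_upwards [h.ae_good, hSV] with ω g hω
    exact (g.tendsto_sum_F h ht hω.2).add (g.tendsto_sum_V_K h ht hω.2)
  -- The supremum `S` of `|V|` dominates both Riemann sums, uniformly in the partition.
  set B : Ω → ℝ := fun ω => S ω * (∫ s in Set.Ioc 0 T, |F s ω| ∂leb) + S ω * K T ω with hB
  have hBi : Integrable B μ :=
    (hS.integrable_mul h.F_memLp).add (hS.integrable_mul h.K_memL2.2)
  have hRB : ∀ n, ∀ᵐ ω ∂μ, ‖R n ω‖ ≤ B ω := by
    intro n
    filter_upwards [h.ae_good, hSV] with ω g hω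
    refine (abs_add_le _ _).trans (add_le_add ?_ ?_)
    · exact g.abs_sum_mul_F_le ht n hω.1 fun k hk => hω.2 _ (part_le ht hk.le)
    · exact g.abs_sum_mul_K_le ht n hω.1 fun k hk => hω.2 _ (part_le ht hk.le)
  have hLi : Integrable L μ := by
    refine hBi.mono' (aestronglyMeasurable_of_tendsto_ae atTop
      (fun n => (hRi n).aestronglyMeasurable) hRL) ?_
    filter_upwards [hRL, ae_all_iff.2 hRB] with ω h1 h2
    exact le_of_tendsto' h1.norm h2
  refine ⟨hLi, ?_⟩
  have hlim : Tendsto (fun n => ∫ ω, R n ω ∂μ) atTop (𝓝 (∫ ω, L ω ∂μ)) :=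
    tendsto_integral_of_dominated_convergence B (fun n => (hRi n).aestronglyMeasurable) hBi hRB hRL
  have hξ := h.ξ_memL2.2.integrable_sq
  have hV := (h.memLp_V ht).integrable_sq
  have hI : ∀ n, Integrable (fun ω => ∑ k ∈ Finset.range (2 ^ n), V (part t T n k) ω *
      𝒳.integral Z (part t T n k) (part t T n (k + 1)) ω) μ := fun n =>
    integrable_finsetSum _ fun k hk => (h.V_mul_integral part_le_succ (hkT n k hk)).1
  have hI0 : ∀ n, ∫ ω, ∑ k ∈ Finset.range (2 ^ n), V (part t T n k) ω *
      𝒳.integral Z (part t T n k) (part t T n (k + 1)) ω ∂μ = 0 := fun n => by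
    rw [integral_finsetSum _ fun k hk => (h.V_mul_integral part_le_succ (hkT n k hk)).1]
    exact Finset.sum_eq_zero fun k hk => (h.V_mul_integral part_le_succ (hkT n k hk)).2
  have hsq : ∀ n, Integrable (fun ω => ∑ k ∈ Finset.range (2 ^ n),
      (V (part t T n (k + 1)) ω - V (part t T n k) ω) ^ 2) μ ∧
      ∫ ω, ∑ k ∈ Finset.range (2 ^ n), (V (part t T n (k + 1)) ω - V (part t T n k) ω) ^ 2 ∂μ
      = (∫ ω, ξ ω ^ 2 ∂μ) - (∫ ω, V t ω ^ 2 ∂μ) + 2 * ∫ ω, R n ω ∂μ := by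
    intro n
    have hae : (fun ω => ∑ k ∈ Finset.range (2 ^ n),
        (V (part t T n (k + 1)) ω - V (part t T n k) ω) ^ 2) =ᵐ[μ] fun ω =>
        ξ ω ^ 2 - V t ω ^ 2 + 2 * R n ω - 2 * ∑ k ∈ Finset.range (2 ^ n), V (part t T n k) ω *
          𝒳.integral Z (part t T n k) (part t T n (k + 1)) ω := by
      filter_upwards [h.ae_good] with ω g using g.sum_sq_increments h ht n
    have hi1 : Integrable (fun ω => ξ ω ^ 2 - V t ω ^ 2) μ := hξ.sub hV
    have hi2 : Integrable (fun ω => ξ ω ^ 2 - V t ω ^ 2 + 2 * R n ω) μ :=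
      hi1.add ((hRi n).const_mul 2)
    refine ⟨(integrable_congr hae).2 (hi2.sub ((hI n).const_mul 2)), ?_⟩
    rw [integral_congr_ae hae,
      integral_sub hi2 ((hI n).const_mul 2),
      integral_add hi1 ((hRi n).const_mul 2), integral_sub hξ hV, integral_const_mul,
      integral_const_mul, hI0, mul_zero, sub_zero]
  have hlim' := (hlim.const_mul 2).const_add ((∫ ω, ξ ω ^ 2 ∂μ) - ∫ ω, V t ω ^ 2 ∂μ)
  -- The limit is nonnegative as a limit of expectations of sums of squares. This is recorded
  -- because `ENNReal.ofReal` truncates and the bound is later needed over the reals.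
  refine ⟨?_, ge_of_tendsto' hlim' fun n => ?_⟩
  swap
  · rw [← (hsq n).2]
    exact integral_nonneg fun ω => Finset.sum_nonneg fun k _ => sq_nonneg _
  -- The energy is the expected sum of squared jumps, to which Fatou applies.
  rw [← 𝒳.lintegral_sum_jumps_sq h.Z_predictable]
  calc _ ≤ ∫⁻ ω, liminf (fun n => ENNReal.ofReal (∑ k ∈ Finset.range (2 ^ n),
        (V (part t T n (k + 1)) ω - V (part t T n k) ω) ^ 2)) atTop ∂μ := by
        refine lintegral_mono_ae ?_
        filter_upwards [h.ae_good] with ω g using g.jumps_sq_le_liminf h t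
    _ ≤ liminf (fun n => ∫⁻ ω, ENNReal.ofReal (∑ k ∈ Finset.range (2 ^ n),
        (V (part t T n (k + 1)) ω - V (part t T n k) ω) ^ 2) ∂μ) atTop := by
        refine lintegral_liminf_le fun n => ?_
        have hm : ∀ s ≤ T, Measurable (V s) := fun s hs =>
          (h.V_adapted s hs).mono (𝒳.filtration.le s) le_rfl
        exact (Finset.measurable_sum _ fun k hk =>
          ((hm _ (hkT n k hk)).sub (hm _ (hkT' n k hk))).pow_const 2).ennreal_ofReal
    _ = _ := by
        simp_rw [fun n => (ofReal_integral_eq_lintegral_ofReal (hsq n).1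
          (Eventually.of_forall fun ω => Finset.sum_nonneg fun k _ => sq_nonneg _)).symm,
          fun n => (hsq n).2]
        exact Tendsto.liminf_eq ((ENNReal.continuous_ofReal.tendsto _).comp hlim')

/-- Almost surely `K` agrees at each time with a variable known at that time, so an increment up to
`t` is orthogonal to the integral over `(t, T]`. -/
theorem K_increment_mul_integral (h : IsReflectedPath 𝒳 T ξ F V Z K) {s t : ℝ≥0} (hst : s ≤ t)
    (ht : t ≤ T) :
    Integrable (fun ω => (K t ω - K s ω) * 𝒳.integral Z t T ω) μ ∧
      ∫ ω, (K t ω - K s ω) * 𝒳.integral Z t T ω ∂μ = 0 := by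
  obtain ⟨k, hk, hk'⟩ := h.exists_measurable_K ht
  obtain ⟨k₀, hk₀, hk₀'⟩ := h.exists_measurable_K (hst.trans ht)
  have h1 := 𝒳.integral_mul_integral_eq_zero h.Z_predictable h.Z_energy (u := t) le_rfl
    (H := k - k₀) (hk.sub (hk₀.mono (𝒳.filtration.mono hst) le_rfl))
    (((h.memLp_K ht).sub (h.memLp_K (hst.trans ht))).ae_eq (hk'.sub hk₀'))
  have hae : (fun ω => (k - k₀) ω * 𝒳.integral Z t T ω)
      =ᵐ[μ] fun ω => (K t ω - K s ω) * 𝒳.integral Z t T ω := by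
    filter_upwards [hk', hk₀'] with ω e1 e2
    simp [e1, e2]
  exact ⟨(integrable_congr hae).1 h1.1, by rw [← integral_congr_ae hae, h1.2]⟩

/-- The estimate of the increasing process. -/
theorem integral_sq_K_le (h : IsReflectedPath 𝒳 T ξ F V Z K) :
    Integrable (fun ω => ∫ s in Set.Ioc 0 T, max (V s ω) 0 ∂pathMeasure T K ω) μ ∧
    ∫ ω, K T ω ^ 2 ∂μ ≤ 2 * (∫ ω, ∫ s in Set.Ioc 0 T, max (V s ω) 0 ∂pathMeasure T K ω ∂μ)
      + 2 * ∫ ω, K T ω * (|ξ ω| + ∫ s in Set.Ioc 0 T, |F s ω| ∂leb) ∂μ := by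
  obtain ⟨S, hS, hSV, -⟩ := h.exists_sup
  have hT : (0 : ℝ≥0) ≤ T := zero_le
  set q : Ω → ℝ := fun ω => ∫ s in Set.Ioc 0 T, max (V s ω) 0 ∂pathMeasure T K ω with hq
  set D : ℕ → ℕ → Ω → ℝ := fun n k ω => K (part 0 T n (k + 1)) ω - K (part 0 T n k) ω with hD
  -- The telescoped difference of `(K_T - K)²` over a cell is `D² + 2 D (K_T - K_{k+1})`. The
  -- summand `D` of `c` accounts for `D²` and disappears in the limit by continuity of `K`. Right
  -- endpoints are used so that `D` is known when the remaining stochastic integral starts.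
  set c : ℕ → ℕ → Ω → ℝ := fun n k ω => D n k ω + 2 * max (V (part 0 T n (k + 1)) ω) 0 with hc
  set R : ℕ → Ω → ℝ := fun n ω => ∑ k ∈ Finset.range (2 ^ n), c n k ω * D n k ω with hR
  have hkT : ∀ n, ∀ k ∈ Finset.range (2 ^ n), part 0 T n (k + 1) ≤ T := fun n k hk =>
    part_le hT (Finset.mem_range.1 hk)
  have hkT' : ∀ n, ∀ k ∈ Finset.range (2 ^ n), part 0 T n k ≤ T := fun n k hk =>
    part_le hT (Finset.mem_range.1 hk).le
  have hDm : ∀ n, ∀ k ∈ Finset.range (2 ^ n), MemLp (D n k) 2 μ := fun n k hk =>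
    (h.memLp_K (hkT n k hk)).sub (h.memLp_K (hkT' n k hk))
  have hcm : ∀ n, ∀ k ∈ Finset.range (2 ^ n), MemLp (c n k) 2 μ := fun n k hk =>
    (hDm n k hk).add (((h.memLp_V (hkT n k hk)).sup (memLp_const 0)).const_mul 2)
  have hRi : ∀ n, Integrable (R n) μ := fun n =>
    integrable_finsetSum _ fun k hk => (hcm n k hk).integrable_mul (hDm n k hk)
  have hcb : ∀ᵐ ω ∂μ, ∀ n, ∀ k < 2 ^ n, |c n k ω| ≤ K T ω + 2 * S ω := by
    filter_upwards [h.ae_good, hSV] with ω g hω n k hk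
    have hk1 := part_le (n := n) (k := k + 1) hT hk
    have h1 : 0 ≤ D n k ω := sub_nonneg.2 (g.K_le part_le_succ hk1)
    have h2 : D n k ω ≤ K T ω := by
      have := g.K_le hk1 le_rfl
      have := g.K_nonneg (part_le (n := n) (k := k) hT hk.le)
      simp only [hD]; linarith
    have h3 : 0 ≤ max (V (part 0 T n (k + 1)) ω) 0 := le_max_right _ _
    have h4 : max (V (part 0 T n (k + 1)) ω) 0 ≤ S ω :=
      max_le ((le_abs_self _).trans (hω.2 _ hk1)) hω.1
    simp only [hc]
    rw [abs_of_nonneg (by positivity)]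
    linarith
  have hRq : ∀ᵐ ω ∂μ, Tendsto (fun n => R n ω) atTop (𝓝 (2 * q ω)) := by
    filter_upwards [h.ae_good, hcb] with ω g hω
    have h1 := g.tendsto_sum_K hT (c := fun n k => c n k ω) (v := fun s => 2 * max (V s ω) 0)
      hω (by
        filter_upwards [ae_restrict_mem measurableSet_Ioc] with s hs
        have e1 : Tendsto (fun n => K (part 0 T n (idx 0 T n s + 1)) ω) atTop (𝓝 (K s ω)) := by
          refine (g.cont s ⟨zero_le, hs.2⟩).tendsto.comp (tendsto_nhdsWithin_iff.2
            ⟨(tendsto_part_idx_succ hs).mono_right nhdsWithin_le_nhds, ?_⟩)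
          exact Eventually.of_forall fun n => ⟨zero_le, part_idx_succ_le hs⟩
        have e2 : Tendsto (fun n => K (part 0 T n (idx 0 T n s)) ω) atTop (𝓝 (K s ω)) := by
          refine (g.cont s ⟨zero_le, hs.2⟩).tendsto.comp (tendsto_nhdsWithin_iff.2
            ⟨(tendsto_part_idx hs).mono_right nhdsWithin_le_nhds, ?_⟩)
          exact Eventually.of_forall fun n => ⟨zero_le, (part_idx_lt hs).le.trans hs.2⟩
        have e3 := (e1.sub e2).add
          (((h.tendsto_right ω hs).max (tendsto_const_nhds (x := (0 : ℝ)))).const_mul 2)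
        rw [sub_self, zero_add] at e3
        exact e3)
    rw [integral_const_mul] at h1
    exact h1
  set B : Ω → ℝ := fun ω => (K T ω + 2 * S ω) * K T ω with hB
  have hBi : Integrable B μ := (h.K_memL2.2.add (hS.const_mul 2)).integrable_mul h.K_memL2.2
  have hRB : ∀ n, ∀ᵐ ω ∂μ, ‖R n ω‖ ≤ B ω := by
    intro n
    filter_upwards [h.ae_good, hSV, hcb] with ω g hω hω'
    have := g.K_nonneg le_rfl
    exact g.abs_sum_mul_K_le hT n (by linarith [hω.1]) (hω' n)
  have hqi : Integrable q μ := by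
    have h1 : Integrable (fun ω => 2 * q ω) μ := by
      refine hBi.mono' (aestronglyMeasurable_of_tendsto_ae atTop
        (fun n => (hRi n).aestronglyMeasurable) hRq) ?_
      filter_upwards [hRq, ae_all_iff.2 hRB] with ω h1 h2
      exact le_of_tendsto' h1.norm h2
    have h2 := h1.const_mul (1 / 2)
    refine (integrable_congr (Eventually.of_forall fun ω => ?_)).1 h2
    ring
  refine ⟨hqi, ?_⟩
  have hlim : Tendsto (fun n => ∫ ω, R n ω ∂μ) atTop (𝓝 (∫ ω, 2 * q ω ∂μ)) :=
    tendsto_integral_of_dominated_convergence B (fun n => (hRi n).aestronglyMeasurable) hBi hRB hRq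
  rw [integral_const_mul] at hlim
  set E : Ω → ℝ := fun ω => K T ω * (|ξ ω| + ∫ s in Set.Ioc 0 T, |F s ω| ∂leb) with hE
  have hEi : Integrable E μ := h.K_memL2.2.integrable_mul (h.ξ_memL2.2.abs.add h.F_memLp)
  have hIi : ∀ n, ∀ k ∈ Finset.range (2 ^ n), Integrable (fun ω =>
      D n k ω * 𝒳.integral Z (part 0 T n (k + 1)) T ω) μ := fun n k hk =>
    (h.K_increment_mul_integral part_le_succ (hkT n k hk)).1
  have hI0 : ∀ n, ∫ ω, ∑ k ∈ Finset.range (2 ^ n),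
      D n k ω * 𝒳.integral Z (part 0 T n (k + 1)) T ω ∂μ = 0 := fun n => by
    rw [integral_finsetSum _ (hIi n)]
    exact Finset.sum_eq_zero fun k hk => (h.K_increment_mul_integral part_le_succ (hkT n k hk)).2
  have hbound : ∀ n, ∫ ω, K T ω ^ 2 ∂μ ≤ (∫ ω, R n ω ∂μ) + 2 * ∫ ω, E ω ∂μ := by
    intro n
    have hpt : ∀ᵐ ω ∂μ, K T ω ^ 2 ≤ R n ω + 2 * E ω
        + 2 * ∑ k ∈ Finset.range (2 ^ n), D n k ω * 𝒳.integral Z (part 0 T n (k + 1)) T ω := by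
      filter_upwards [h.ae_good] with ω g
      have hDn : ∀ k ∈ Finset.range (2 ^ n), 0 ≤ D n k ω := fun k hk =>
        sub_nonneg.2 (g.K_le part_le_succ (hkT n k hk))
      have e1 : K T ω ^ 2 = ∑ k ∈ Finset.range (2 ^ n),
          ((K T ω - K (part 0 T n k) ω) ^ 2 - (K T ω - K (part 0 T n (k + 1)) ω) ^ 2) := by
        rw [Finset.sum_range_sub' fun k => (K T ω - K (part 0 T n k) ω) ^ 2, part_last hT,
          part_zero, g.zero]
        ring
      have e2 : ∀ k ∈ Finset.range (2 ^ n),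
          (K T ω - K (part 0 T n k) ω) ^ 2 - (K T ω - K (part 0 T n (k + 1)) ω) ^ 2
          ≤ c n k ω * D n k ω
            + 2 * (D n k ω * (|ξ ω| + ∫ s in Set.Ioc 0 T, |F s ω| ∂leb))
            + 2 * (D n k ω * 𝒳.integral Z (part 0 T n (k + 1)) T ω) := by
        intro k hk
        have h1 := g.equation _ (hkT n k hk)
        have h2 := g.abs_setIntegral_le (s := part 0 T n (k + 1)) (t := T) le_rfl
        have h3 := hDn k hk
        -- The equation at the right endpoint is solved for the remaining growth of `K`; only the
        -- stochastic integral keeps its sign, since it is to vanish in expectation.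
        have h4 : K T ω - K (part 0 T n (k + 1)) ω ≤ max (V (part 0 T n (k + 1)) ω) 0
            + (|ξ ω| + ∫ s in Set.Ioc 0 T, |F s ω| ∂leb)
            + 𝒳.integral Z (part 0 T n (k + 1)) T ω := by
          linarith [le_max_left (V (part 0 T n (k + 1)) ω) 0, neg_abs_le (ξ ω),
            neg_abs_le (∫ r in Set.Ioc (part 0 T n (k + 1)) T, F r ω ∂leb)]
        have h5 := mul_le_mul_of_nonneg_left h4 h3
        have h6 : (K T ω - K (part 0 T n k) ω) ^ 2 - (K T ω - K (part 0 T n (k + 1)) ω) ^ 2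
            = D n k ω * D n k ω + 2 * (D n k ω * (K T ω - K (part 0 T n (k + 1)) ω)) := by
          simp only [hD]; ring
        rw [h6]
        simp only [hc]
        nlinarith [h5]
      rw [e1]
      refine (Finset.sum_le_sum e2).trans ?_
      rw [Finset.sum_add_distrib, Finset.sum_add_distrib, ← Finset.mul_sum, ← Finset.mul_sum,
        ← Finset.sum_mul]
      have e3 := g.sum_increments_K hT n
      have e4 : 0 ≤ |ξ ω| + ∫ s in Set.Ioc 0 T, |F s ω| ∂leb :=
        add_nonneg (abs_nonneg _) (integral_nonneg fun s => abs_nonneg _)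
      have e5 := mul_le_mul_of_nonneg_right e3 e4
      simp only [hR, hE]
      simp only [hD] at e5 ⊢
      linarith
    have hi1 : Integrable (fun ω => R n ω + 2 * E ω) μ := (hRi n).add (hEi.const_mul 2)
    have hi2 : Integrable (fun ω => 2 * ∑ k ∈ Finset.range (2 ^ n),
        D n k ω * 𝒳.integral Z (part 0 T n (k + 1)) T ω) μ :=
      (integrable_finsetSum _ (hIi n)).const_mul 2
    have h1 := integral_mono_ae h.K_memL2.2.integrable_sq (hi1.add hi2) hpt
    simp only [Pi.add_apply] at h1
    rwa [integral_add hi1 hi2, integral_add (hRi n) (hEi.const_mul 2), integral_const_mul,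
      integral_const_mul, hI0, mul_zero, add_zero] at h1
  exact ge_of_tendsto' (hlim.add_const _) hbound

end probability

end IsReflectedPath

end MarkovRBSDE
end

/-! ### Integrability along paths and integrals of `V²` -/

noncomputable section

namespace MarkovRBSDE

variable {Ω : Type*} [mΩ : MeasurableSpace Ω] {N : ℕ} {μ : Measure Ω}

instance isFiniteMeasure_leb_Ioc (s t : ℝ≥0) : IsFiniteMeasure (leb.restrict (Set.Ioc s t)) :=
  ⟨by rw [Measure.restrict_apply_univ, leb_Ioc]; simp⟩

/-- The Cauchy–Schwarz inequality on a finite measure space. -/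
theorem sq_integral_abs_le {α : Type*} [MeasurableSpace α] (ρ : Measure α) [IsFiniteMeasure ρ]
    {u : α → ℝ} (hu : MemLp u 2 ρ) :
    (∫ x, |u x| ∂ρ) ^ 2 ≤ ρ.real Set.univ * ∫ x, u x ^ 2 ∂ρ := by
  rcases eq_or_ne ρ 0 with rfl | hρ
  · simp
  set m := ρ.real Set.univ
  have : NeZero ρ := ⟨hρ⟩
  have hm : 0 < m := measureReal_univ_pos
  set a := ∫ x, |u x| ∂ρ
  have h1 := (hu.integrable one_le_two).abs
  have h2 := hu.integrable_sq
  -- The integrand is `(m |u| - a)²`, where `m` is the total mass and `a` the integral of `|u|`.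
  have h3 : 0 ≤ ∫ x, (m ^ 2 * u x ^ 2 - 2 * m * a * |u x| + a ^ 2) ∂ρ := by
    refine integral_nonneg fun x => ?_
    have : m ^ 2 * u x ^ 2 - 2 * m * a * |u x| + a ^ 2 = (m * |u x| - a) ^ 2 := by
      rw [← sq_abs (u x)]; ring
    simpa [this] using sq_nonneg _
  have h4 : Integrable (fun x => m ^ 2 * u x ^ 2 - 2 * m * a * |u x|) ρ :=
    (h2.const_mul _).sub (h1.const_mul _)
  rw [integral_add h4 (integrable_const _), integral_sub (h2.const_mul _) (h1.const_mul _),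
    integral_const_mul, integral_const_mul, integral_const, smul_eq_mul] at h3
  have h5 : 0 ≤ m * (m * (∫ x, u x ^ 2 ∂ρ) - a ^ 2) := by
    have e : m * (m * (∫ x, u x ^ 2 ∂ρ) - a ^ 2)
      = m ^ 2 * (∫ x, u x ^ 2 ∂ρ) - 2 * m * a * a + m * a ^ 2 := by ring
    rw [e]; exact h3
  linarith [nonneg_of_mul_nonneg_right h5 hm]

namespace IsReflectedPath

variable {𝒳 : MarkovChain N μ} {T : ℝ≥0} {ξ : Ω → ℝ} {F V : ℝ≥0 → Ω → ℝ}
  {Z : ℝ≥0 → Ω → (Fin N → ℝ)} {K : ℝ≥0 → Ω → ℝ}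

theorem measurable_V (h : IsReflectedPath 𝒳 T ξ F V Z K) :
    Measurable fun p : ℝ≥0 × Ω => V (min p.1 T) p.2 :=
  measurable_stopped_of_rightContinuous
    (fun s hs => (h.V_adapted s hs).mono (𝒳.filtration.le s) le_rfl) h.V_right

theorem aestronglyMeasurable_V (h : IsReflectedPath 𝒳 T ξ F V Z K) (ω : Ω) (ρ : Measure ℝ≥0)
    {A : Set ℝ≥0} (hA : MeasurableSet A) (hAT : A ⊆ Set.Icc 0 T) :
    AEStronglyMeasurable (fun s => V s ω) (ρ.restrict A) := by
  have h1 : Measurable fun s => V (min s T) ω := h.measurable_V.comp measurable_prodMk_right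
  refine h1.aestronglyMeasurable.congr ?_
  filter_upwards [ae_restrict_mem hA] with s hs
  rw [min_eq_left (hAT hs).2]

theorem memLp_V_path (h : IsReflectedPath 𝒳 T ξ F V Z K) {ω : Ω} {C : ℝ}
    (hC : ∀ s ≤ T, |V s ω| ≤ C) (t : ℝ≥0) : MemLp (fun s => V s ω) 2 (leb.restrict (Set.Ioc t T)) := by
  refine MemLp.of_bound (h.aestronglyMeasurable_V ω leb measurableSet_Ioc
    fun s hs => ⟨zero_le, hs.2⟩) C ?_
  filter_upwards [ae_restrict_mem measurableSet_Ioc] with s hs using hC s hs.2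

theorem setIntegral_min {t T : ℝ≥0} (s : ℝ≥0) (ht : t ≤ T) (v : ℝ≥0 → ℝ) (ρ : Measure ℝ≥0) :
    ∫ r in Set.Ioc s t, v (min r T) ∂ρ = ∫ r in Set.Ioc s t, v r ∂ρ :=
  setIntegral_congr_fun measurableSet_Ioc fun r hr => by simp only [min_eq_left (hr.2.trans ht)]

theorem integrable_energy (h : IsReflectedPath 𝒳 T ξ F V Z K) (t : ℝ≥0) :
    Integrable (fun ω => ∫ s in Set.Ioc t T, 𝒳.energy s ω (Z s ω) ∂leb) μ ∧
    ∫⁻ ω, ∫⁻ s in Set.Ioc t T, ENNReal.ofReal (𝒳.energy s ω (Z s ω)) ∂leb ∂μ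
      = ENNReal.ofReal (∫ ω, ∫ s in Set.Ioc t T, 𝒳.energy s ω (Z s ω) ∂leb ∂μ) := by
  have hm := 𝒳.measurable_energy h.Z_predictable
  have h1 : ∀ᵐ ω ∂μ, ∫⁻ s in Set.Ioc t T, ENNReal.ofReal (𝒳.energy s ω (Z s ω)) ∂leb
      = ENNReal.ofReal (∫ s in Set.Ioc t T, 𝒳.energy s ω (Z s ω) ∂leb) := by
    filter_upwards [h.ae_good] with ω g
    exact (ofReal_integral_eq_lintegral_ofReal
      ((g.energy.integrableOn h.Z_predictable).mono_set (Set.Ioc_subset_Ioc zero_le le_rfl))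
      (Eventually.of_forall fun s => 𝒳.energy_nonneg _ _ _)).symm
  have h2 : ∫⁻ ω, ENNReal.ofReal (∫ s in Set.Ioc t T, 𝒳.energy s ω (Z s ω) ∂leb) ∂μ < ∞ := by
    rw [← lintegral_congr_ae h1]
    refine lt_of_le_of_lt (lintegral_mono fun ω => ?_) h.Z_energy
    exact lintegral_mono_set (Set.Ioc_subset_Ioc zero_le le_rfl)
  have h3 : ∀ ω, 0 ≤ ∫ s in Set.Ioc t T, 𝒳.energy s ω (Z s ω) ∂leb := fun ω =>
    integral_nonneg fun s => 𝒳.energy_nonneg _ _ _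
  have h4 : Integrable (fun ω => ∫ s in Set.Ioc t T, 𝒳.energy s ω (Z s ω) ∂leb) μ := by
    refine ⟨?_, (hasFiniteIntegral_iff_ofReal (Eventually.of_forall h3)).2 h2⟩
    exact (hm.stronglyMeasurable.integral_prod_left').aestronglyMeasurable
  exact ⟨h4, by rw [lintegral_congr_ae h1,
    ofReal_integral_eq_lintegral_ofReal h4 (Eventually.of_forall h3)]⟩

/-- The positive part is nonnegative, so the domain may be enlarged to `(0, T]` and the bound no
longer depends on `t`. -/
theorem setIntegral_le_pathMeasure (h : IsReflectedPath 𝒳 T ξ F V Z K) {ω : Ω}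
    (g : Good 𝒳 T ξ F V Z K ω) {C : ℝ} (hC : ∀ s ≤ T, |V s ω| ≤ C) (t : ℝ≥0) :
    ∫ s in Set.Ioc t T, V s ω ∂pathMeasure T K ω
      ≤ ∫ s in Set.Ioc 0 T, max (V s ω) 0 ∂pathMeasure T K ω := by
  have hfin := g.isFiniteMeasure
  have hi : IntegrableOn (fun s => V s ω) (Set.Ioc 0 T) (pathMeasure T K ω) := by
    refine Integrable.of_bound (h.aestronglyMeasurable_V ω _ measurableSet_Ioc
      fun s hs => ⟨zero_le, hs.2⟩) C ?_
    filter_upwards [ae_restrict_mem measurableSet_Ioc] with s hs using hC s hs.2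
  have hsub : Set.Ioc t T ⊆ Set.Ioc 0 T := Set.Ioc_subset_Ioc zero_le le_rfl
  have hp : IntegrableOn (fun s => max (V s ω) 0) (Set.Ioc 0 T) (pathMeasure T K ω) := hi.pos_part
  exact (setIntegral_mono (hi.mono_set hsub) (hp.mono_set hsub) fun s => le_max_left _ _).trans
    (setIntegral_mono_set hp (Eventually.of_forall fun s => le_max_right _ _) hsub.eventuallyLE)

section probability

variable [IsProbabilityMeasure μ]

theorem integrable_prod_sq_V (h : IsReflectedPath 𝒳 T ξ F V Z K) (s t : ℝ≥0) :
    Integrable (fun p : Ω × ℝ≥0 => V (min p.2 T) p.1 ^ 2)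
      (μ.prod (leb.restrict (Set.Ioc s t))) := by
  obtain ⟨S, hS, hSV, -⟩ := h.exists_sup
  have h1 : Integrable (fun p : Ω × ℝ≥0 => S p.1 ^ 2) (μ.prod (leb.restrict (Set.Ioc s t))) :=
    hS.integrable_sq.comp_fst _
  refine h1.mono' ((h.measurable_V.comp measurable_swap).pow_const 2).aestronglyMeasurable ?_
  filter_upwards [Measure.quasiMeasurePreserving_fst.ae hSV] with p hp
  rw [Real.norm_of_nonneg (sq_nonneg _), ← sq_abs]
  exact pow_le_pow_left₀ (abs_nonneg _) (hp.2 _ (min_le_right _ _)) 2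

theorem integrable_integral_sq_V (h : IsReflectedPath 𝒳 T ξ F V Z K) (s : ℝ≥0) {t : ℝ≥0}
    (ht : t ≤ T) : Integrable (fun ω => ∫ r in Set.Ioc s t, V r ω ^ 2 ∂leb) μ := by
  have h1 := (h.integrable_prod_sq_V s t).integral_prod_left
  simpa only [fun ω => setIntegral_min s ht (fun r => V r ω ^ 2) leb] using h1

/-- Fubini on the piece over `(s, t]`; this is the increment inequality that the backward Grönwall
lemma takes as input. -/
theorem integral_sq_V_le (h : IsReflectedPath 𝒳 T ξ F V Z K) {s t : ℝ≥0} (hst : s ≤ t)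
    (ht : t ≤ T) {M : ℝ} (hM : ∀ r ∈ Set.Ioc s t, ∫ ω, V r ω ^ 2 ∂μ ≤ M) :
    ∫ ω, ∫ r in Set.Ioc s T, V r ω ^ 2 ∂leb ∂μ
      ≤ (∫ ω, ∫ r in Set.Ioc t T, V r ω ^ 2 ∂leb ∂μ) + (t - s) * M := by
  obtain ⟨S, hS, hSV, -⟩ := h.exists_sup
  have h1 : ∫ ω, ∫ r in Set.Ioc s T, V r ω ^ 2 ∂leb ∂μ
      = (∫ ω, ∫ r in Set.Ioc s t, V r ω ^ 2 ∂leb ∂μ)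
        + ∫ ω, ∫ r in Set.Ioc t T, V r ω ^ 2 ∂leb ∂μ := by
    rw [← integral_add (h.integrable_integral_sq_V s ht) (h.integrable_integral_sq_V t le_rfl)]
    refine integral_congr_ae ?_
    filter_upwards [hSV] with ω hω
    have hi := (h.memLp_V_path hω.2 s).integrable_sq
    rw [← Set.Ioc_union_Ioc_eq_Ioc hst ht, setIntegral_union (Set.Ioc_disjoint_Ioc_of_le le_rfl)
      measurableSet_Ioc]
    · exact IntegrableOn.mono_set hi (Set.Ioc_subset_Ioc le_rfl ht)
    · exact IntegrableOn.mono_set hi (Set.Ioc_subset_Ioc hst le_rfl)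
  have h2 : ∫ ω, ∫ r in Set.Ioc s t, V r ω ^ 2 ∂leb ∂μ ≤ (t - s) * M := by
    have h3 := integral_integral_swap (f := fun ω r => V (min r T) ω ^ 2)
      (h.integrable_prod_sq_V s t)
    simp only [fun ω => setIntegral_min s ht (fun r => V r ω ^ 2) leb] at h3
    rw [h3]
    have h4 : ∫ r in Set.Ioc s t, ∫ ω, V (min r T) ω ^ 2 ∂μ ∂leb ≤ ∫ r in Set.Ioc s t, M ∂leb := by
      refine setIntegral_mono_on (h.integrable_prod_sq_V s t).integral_prod_right
        (integrable_const _) measurableSet_Ioc fun r hr => ?_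
      rw [min_eq_left (hr.2.trans ht)]
      exact hM r hr
    rwa [setIntegral_const, leb_real_Ioc hst, smul_eq_mul] at h4
  rw [h1]
  linarith

end probability

end IsReflectedPath

end MarkovRBSDE
end

/-! ### Grönwall, absorption, and the estimate for controlled paths -/

noncomputable section

namespace MarkovRBSDE

/-- The constant of the backward Grönwall inequality on `[0, T]`. -/
def gronwallConst (b : ℝ) (T : ℝ≥0) : ℝ := 2 ^ (⌈2 * b * T⌉₊ + 2) * T

theorem gronwallConst_nonneg (b : ℝ) (T : ℝ≥0) : 0 ≤ gronwallConst b T := by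
  unfold gronwallConst; positivity

/-- A backward Grönwall inequality. -/
theorem le_gronwallConst_mul {ψ : ℝ≥0 → ℝ} {a b : ℝ} {T : ℝ≥0} (ha : 0 ≤ a) (hT : ψ T = 0)
    (h0 : ∀ t, 0 ≤ ψ t)
    (h : ∀ s t, s ≤ t → t ≤ T → ψ s ≤ ψ t + (t - s) * (a + b * ψ s)) :
    ψ 0 ≤ gronwallConst b T * a := by
  -- With this many steps the mesh `δ = T / n` satisfies `δ * b ≤ 1 / 2`, so the term `b * ψ s` can
  -- be moved to the left.
  set n := ⌈2 * b * T⌉₊ + 1 with hn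
  have hn0 : (0 : ℝ) < n := by positivity
  set δ : ℝ := T / n with hδ
  have hδ0 : 0 ≤ δ := by positivity
  have hδb : δ * b ≤ 1 / 2 := by
    have h1 : 2 * b * T ≤ n := (Nat.le_ceil _).trans (by rw [hn]; push_cast; linarith)
    rw [hδ, div_mul_eq_mul_div, div_le_iff₀ hn0]
    linarith
  -- Each step back gives `ψ s ≤ 2 ψ t + 2 δ a`, hence `ψ + 2 δ a` at most doubles.
  have key : ∀ k j : ℕ, j + k = n → ψ (T * j / n) + 2 * δ * a ≤ 2 ^ k * (2 * δ * a) := by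
    intro k
    induction k with
    | zero =>
      intro j hj
      have : T * j / n = T := by
        rw [show j = n by omega]
        exact mul_div_cancel_right₀ _ (by positivity)
      rw [this, hT]; simp
    | succ k ih =>
      intro j hj
      have h1 := ih (j + 1) (by omega)
      have hle : (T * (j + 1 : ℕ) / n : ℝ≥0) ≤ T := by
        rw [div_le_iff₀ (by positivity)]
        gcongr
        omega
      have h2 := h (T * j / n) (T * (j + 1 : ℕ) / n) (by gcongr; omega) hle
      have h3 : ((T * (j + 1 : ℕ) / n : ℝ≥0) : ℝ) - (T * j / n : ℝ≥0) = δ := by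
        push_cast; rw [hδ]; ring
      rw [h3] at h2
      have h4 := h0 (T * j / n)
      have h5 := mul_le_mul_of_nonneg_right hδb h4
      rw [pow_succ]
      nlinarith
  have h1 := key n 0 (by simp)
  have h2 : δ ≤ T := div_le_self T.2 (by rw [hn]; push_cast; linarith [Nat.cast_nonneg (α := ℝ) ⌈2 * b * T⌉₊])
  have h3 : (2 : ℝ) ^ n * (2 * δ * a) ≤ 2 ^ n * (2 * T * a) := by gcongr
  have h4 : 0 ≤ δ * a := mul_nonneg hδ0 ha
  simp only [Nat.cast_zero, mul_zero, zero_div] at h1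
  rw [gronwallConst, show ⌈2 * b * T⌉₊ + 2 = n + 1 from rfl, pow_succ]
  linarith

/-- The absorption argument that closes the a priori estimate. -/
theorem exists_absorption_const {c₁ c₂ c₃ c₄ : ℝ} (h₁ : 0 ≤ c₁) (h₂ : 0 ≤ c₂) (h₃ : 0 ≤ c₃)
    (h₄ : 0 ≤ c₄) :
    ∃ C : ℝ, 0 < C ∧ ∀ x g h y z k S F a : ℝ, 0 ≤ x → 0 ≤ g → 0 ≤ h → 0 ≤ a →
      y ≤ c₁ * a → z ≤ 2 * a + c₂ * y → F ≤ 3 * h + c₃ * y + c₄ * z →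
      k ≤ 8 * g + 16 * x + 16 * F → S ≤ 12 * (x + F + k) →
      (∀ ε : ℝ, 0 < ε → a ≤ x + ε * S + h / ε + ε * k + g / ε) →
      S + z + k ≤ C * (x + g + h) := by
  -- In the application `x`, `g`, `h` are the second moments of `ξ`, of the obstacle bound and of `∫
  -- |f(·,0,0)|`; `y` and `z` are the expected integrals of `V²` and of the energy; `k`, `S`, `F`
  -- are the second moments of `K_T`, of the supremum bound and of `∫ |F|`; and `a` is the
  -- right-hand side of the energy inequality. First `z ≤ d a` and `F ≤ 3 h + e a`, so `a` is the
  -- only quantity left to bound.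
  set d := 2 + c₂ * c₁ with hd
  set e := c₃ * c₁ + c₄ * d with he
  have hd0 : 0 ≤ d := by positivity
  have he0 : 0 ≤ e := by positivity
  -- Eliminating `k` gives `S + k ≤ 220 (x + F) + 104 g`, where `220 = 12 + 13 * 16` and `104 = 13 *
  -- 8`. The resulting term `220 e a`, multiplied by this `ε`, is at most `a / 2`.
  set ε : ℝ := 1 / (2 * (220 * e + 1)) with hε
  have hε0 : 0 < ε := by positivity
  set m : ℝ := 2 * (1 + ε * 1000 + 1 / ε) with hm
  have hm0 : 0 < m := by positivity
  refine ⟨1000 + (220 * e + d) * m, by positivity, ?_⟩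
  intro x g h y z k S F a hx hg hh ha hy hz hF hk hS hyoung
  set D := x + g + h with hD
  have hD0 : 0 ≤ D := by positivity
  have hz' : z ≤ d * a := by
    have := mul_le_mul_of_nonneg_left hy h₂
    rw [hd]; linarith
  have hF' : F ≤ 3 * h + e * a := by
    have e1 := mul_le_mul_of_nonneg_left hy h₃
    have e2 := mul_le_mul_of_nonneg_left hz' h₄
    rw [he]; linarith
  have hSk : S + k ≤ 1000 * D + 220 * e * a := by
    rw [hD]; linarith
  have ha' : a ≤ m * D := by
    have e1 := hyoung ε hε0
    have e2 := mul_le_mul_of_nonneg_left hSk hε0.le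
    have e3 : h / ε + g / ε ≤ 1 / ε * D := by
      rw [← add_div, one_div, div_eq_inv_mul]
      gcongr
      rw [hD]; linarith
    have e4 : ε * (220 * e) ≤ 1 / 2 := by
      rw [hε, div_mul_eq_mul_div, div_le_iff₀ (by positivity)]
      linarith
    have e5 := mul_le_mul_of_nonneg_right e4 ha
    rw [hm]
    have e6 : x ≤ D := by rw [hD]; linarith
    linarith
  have e1 := mul_le_mul_of_nonneg_left ha' (by positivity : 0 ≤ 220 * e + d)
  linarith

variable {Ω : Type*} [mΩ : MeasurableSpace Ω] {N : ℕ} {μ : Measure Ω}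

/-- Control of the driver path `F` by a linear growth bound, and of the reflection by a
square-integrable `g` that dominates `V` where `K` increases. -/
structure IsControlled (𝒳 : MarkovChain N μ) (T : ℝ≥0) (c' c'' : ℝ) (F V : ℝ≥0 → Ω → ℝ)
    (Z : ℝ≥0 → Ω → (Fin N → ℝ)) (K f₀ : ℝ≥0 → Ω → ℝ) (g : Ω → ℝ) : Prop where
  f₀_nonneg : ∀ s ω, 0 ≤ f₀ s ω
  f₀_integrable : ∀ᵐ ω ∂μ, IntegrableOn (fun s => f₀ s ω) (Set.Ioc 0 T) leb
  f₀_memLp : MemLp (fun ω => ∫ s in Set.Ioc 0 T, f₀ s ω ∂leb) 2 μ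
  F_le : ∀ᵐ ω ∂μ, ∀ᵐ s ∂leb.restrict (Set.Ioc 0 T),
    |F s ω| ≤ f₀ s ω + c' * |V s ω| + c'' * √(𝒳.energy s ω (Z s ω))
  g_memLp : MemLp g 2 μ
  K_le : ∀ᵐ ω ∂μ, ∫ s in Set.Ioc 0 T, max (V s ω) 0 ∂pathMeasure T K ω ≤ g ω * K T ω

namespace IsControlled

variable {𝒳 : MarkovChain N μ} {T : ℝ≥0} {c' c'' : ℝ} {ξ : Ω → ℝ} {F V : ℝ≥0 → Ω → ℝ}
  {Z : ℝ≥0 → Ω → (Fin N → ℝ)} {K f₀ : ℝ≥0 → Ω → ℝ} {g : Ω → ℝ}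

/-- A quarter of the energy is allowed because the energy inequality doubles this term, and half of
the energy must survive on the left. -/
theorem mul_sqrt_le {c v e : ℝ} (he : 0 ≤ e) : |v| * (c * √e) ≤ c ^ 2 * v ^ 2 + e / 4 := by
  have h1 := sq_nonneg (c * |v| - √e / 2)
  have h2 := Real.sq_sqrt he
  have h3 := sq_abs v
  rw [← h3]
  nlinarith

theorem ae_abs_integral_mul_le (hc : IsControlled 𝒳 T c' c'' F V Z K f₀ g)
    (h : IsReflectedPath 𝒳 T ξ F V Z K) {S : Ω → ℝ}
    (hS : ∀ᵐ ω ∂μ, 0 ≤ S ω ∧ ∀ t ≤ T, |V t ω| ≤ S ω) (t : ℝ≥0) :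
    ∀ᵐ ω ∂μ, ∫ s in Set.Ioc t T, V s ω * F s ω ∂leb
      ≤ S ω * (∫ s in Set.Ioc 0 T, f₀ s ω ∂leb)
        + (c' + c'' ^ 2) * (∫ s in Set.Ioc t T, V s ω ^ 2 ∂leb)
        + (∫ s in Set.Ioc t T, 𝒳.energy s ω (Z s ω) ∂leb) / 4 := by
  filter_upwards [h.ae_good, hS, hc.f₀_integrable, hc.F_le] with ω hg hω hf hF
  have hsub : Set.Ioc t T ⊆ Set.Ioc 0 T := Set.Ioc_subset_Ioc zero_le le_rfl
  have i1 : IntegrableOn (fun s => S ω * f₀ s ω) (Set.Ioc t T) leb :=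
    (hf.mono_set hsub).const_mul _
  have i2 : IntegrableOn (fun s => (c' + c'' ^ 2) * V s ω ^ 2) (Set.Ioc t T) leb :=
    (h.memLp_V_path hω.2 t).integrable_sq.const_mul _
  have i3 : IntegrableOn (fun s => 𝒳.energy s ω (Z s ω) / 4) (Set.Ioc t T) leb :=
    ((hg.energy.integrableOn h.Z_predictable).mono_set hsub).div_const 4
  have hle : ∫ s in Set.Ioc t T, |V s ω * F s ω| ∂leb
      ≤ ∫ s in Set.Ioc t T, (S ω * f₀ s ω + (c' + c'' ^ 2) * V s ω ^ 2
        + 𝒳.energy s ω (Z s ω) / 4) ∂leb := by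
    refine integral_mono_of_nonneg (Eventually.of_forall fun s => abs_nonneg _)
      ((i1.add i2).add i3) ?_
    filter_upwards [ae_restrict_of_ae_restrict_of_subset hsub hF,
      ae_restrict_mem measurableSet_Ioc] with s hs hsT
    have e1 := mul_le_mul_of_nonneg_left hs (abs_nonneg (V s ω))
    have e2 := mul_le_mul_of_nonneg_right (hω.2 s hsT.2) (hc.f₀_nonneg s ω)
    have e3 := mul_sqrt_le (c := c'') (v := V s ω) (𝒳.energy_nonneg s ω (Z s ω))
    have e4 : |V s ω| * (c' * |V s ω|) = c' * V s ω ^ 2 := by rw [← sq_abs (V s ω)]; ring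
    rw [abs_mul]
    linarith
  have i12 : IntegrableOn (fun s => S ω * f₀ s ω + (c' + c'' ^ 2) * V s ω ^ 2) (Set.Ioc t T) leb :=
    i1.add i2
  rw [integral_add i12 i3, integral_add i1 i2, integral_const_mul, integral_const_mul,
    integral_div] at hle
  have h1 : S ω * (∫ s in Set.Ioc t T, f₀ s ω ∂leb) ≤ S ω * ∫ s in Set.Ioc 0 T, f₀ s ω ∂leb :=
    mul_le_mul_of_nonneg_left (setIntegral_mono_set hf
      (Eventually.of_forall fun s => hc.f₀_nonneg s ω) hsub.eventuallyLE) hω.1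
  have h2 : ∫ s in Set.Ioc t T, V s ω * F s ω ∂leb ≤ ∫ s in Set.Ioc t T, |V s ω * F s ω| ∂leb :=
    (le_abs_self _).trans abs_integral_le_integral_abs
  linarith

/-- The square of the three-term growth bound costs a factor `3`, and Cauchy–Schwarz in time a
factor `T`. -/
theorem ae_sq_integral_abs_F_le (hc : IsControlled 𝒳 T c' c'' F V Z K f₀ g)
    (h : IsReflectedPath 𝒳 T ξ F V Z K) {S : Ω → ℝ}
    (hS : ∀ᵐ ω ∂μ, 0 ≤ S ω ∧ ∀ t ≤ T, |V t ω| ≤ S ω) :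
    ∀ᵐ ω ∂μ, (∫ s in Set.Ioc 0 T, |F s ω| ∂leb) ^ 2
      ≤ 3 * (∫ s in Set.Ioc 0 T, f₀ s ω ∂leb) ^ 2
        + 3 * c' ^ 2 * T * (∫ s in Set.Ioc 0 T, V s ω ^ 2 ∂leb)
        + 3 * c'' ^ 2 * T * (∫ s in Set.Ioc 0 T, 𝒳.energy s ω (Z s ω) ∂leb) := by
  filter_upwards [h.ae_good, hS, hc.f₀_integrable, hc.F_le] with ω hg hω hf hF
  have hV := h.memLp_V_path hω.2 0
  have he := hg.energy.integrableOn h.Z_predictable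
  have hsq : ∀ s, √(𝒳.energy s ω (Z s ω)) ^ 2 = 𝒳.energy s ω (Z s ω) := fun s =>
    Real.sq_sqrt (𝒳.energy_nonneg _ _ _)
  have hE : MemLp (fun s => √(𝒳.energy s ω (Z s ω))) 2 (leb.restrict (Set.Ioc 0 T)) := by
    refine (memLp_two_iff_integrable_sq
      (Real.continuous_sqrt.comp_aestronglyMeasurable he.aestronglyMeasurable)).2 ?_
    simp only [hsq]
    exact he
  have hm : (leb.restrict (Set.Ioc 0 T)).real Set.univ = T := by
    rw [measureReal_restrict_apply_univ, leb_real_Ioc zero_le]; simp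
  have hV2 := sq_integral_abs_le _ hV
  have hE2 := sq_integral_abs_le _ hE
  rw [hm] at hV2 hE2
  simp only [hsq] at hE2
  have i2 := (hV.integrable one_le_two).abs
  have i3 := (hE.integrable one_le_two).abs
  have i12 : IntegrableOn (fun s => f₀ s ω + c' * |V s ω|) (Set.Ioc 0 T) leb :=
    hf.add (i2.const_mul c')
  have hle : ∫ s in Set.Ioc 0 T, |F s ω| ∂leb ≤ ∫ s in Set.Ioc 0 T,
      (f₀ s ω + c' * |V s ω| + c'' * |√(𝒳.energy s ω (Z s ω))|) ∂leb := by
    refine integral_mono_of_nonneg (Eventually.of_forall fun s => abs_nonneg _)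
      (i12.add (i3.const_mul c'')) ?_
    filter_upwards [hF] with s hs
    rw [abs_of_nonneg (Real.sqrt_nonneg _)]
    exact hs
  rw [integral_add i12 (i3.const_mul c''), integral_add hf (i2.const_mul c'), integral_const_mul,
    integral_const_mul] at hle
  have h0 : 0 ≤ ∫ s in Set.Ioc 0 T, |F s ω| ∂leb := integral_nonneg fun s => abs_nonneg _
  generalize (∫ s in Set.Ioc 0 T, |F s ω| ∂leb) = A at *
  generalize (∫ s in Set.Ioc 0 T, f₀ s ω ∂leb) = B at *
  generalize (∫ s in Set.Ioc 0 T, |V s ω| ∂leb) = D at *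
  generalize (∫ s in Set.Ioc 0 T, |√(𝒳.energy s ω (Z s ω))| ∂leb) = E at *
  have h1 : A ^ 2 ≤ (B + c' * D + c'' * E) ^ 2 := pow_le_pow_left₀ h0 hle 2
  have h2 : (B + c' * D + c'' * E) ^ 2 ≤ 3 * B ^ 2 + 3 * c' ^ 2 * D ^ 2 + 3 * c'' ^ 2 * E ^ 2 := by
    nlinarith [sq_nonneg (B - c' * D), sq_nonneg (B - c'' * E), sq_nonneg (c' * D - c'' * E)]
  have h3 := mul_le_mul_of_nonneg_left hV2 (by positivity : 0 ≤ 3 * c' ^ 2)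
  have h4 := mul_le_mul_of_nonneg_left hE2 (by positivity : 0 ≤ 3 * c'' ^ 2)
  linarith

theorem two_mul_integral_mul_le {u v : Ω → ℝ} (hu : MemLp u 2 μ) (hv : MemLp v 2 μ) {ε : ℝ}
    (hε : 0 < ε) :
    2 * ∫ ω, u ω * v ω ∂μ ≤ ε * (∫ ω, u ω ^ 2 ∂μ) + (∫ ω, v ω ^ 2 ∂μ) / ε := by
  rw [← integral_const_mul, ← integral_const_mul, ← integral_div, ← integral_add
    (hu.integrable_sq.const_mul _) (hv.integrable_sq.div_const _)]
  have i1 : Integrable (fun ω => u ω * v ω) μ := hu.integrable_mul hv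
  refine integral_mono (i1.const_mul 2)
    ((hu.integrable_sq.const_mul _).add (hv.integrable_sq.div_const _)) fun ω => ?_
  change 2 * (u ω * v ω) ≤ ε * u ω ^ 2 + v ω ^ 2 / ε
  have h1 : ε * u ω ^ 2 + v ω ^ 2 / ε - 2 * (u ω * v ω) = (ε * u ω - v ω) ^ 2 / ε := by
    field_simp
    ring
  have h2 : 0 ≤ (ε * u ω - v ω) ^ 2 / ε := by positivity
  linarith

section probability

variable [IsProbabilityMeasure μ]

/-- The growth bound for `F` and the reflection bound are inserted in the energy inequality, and
half of the energy is absorbed. -/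
theorem energy_le (hc : IsControlled 𝒳 T c' c'' F V Z K f₀ g) (h : IsReflectedPath 𝒳 T ξ F V Z K)
    {S : Ω → ℝ} (hSm : MemLp S 2 μ) (hS : ∀ᵐ ω ∂μ, 0 ≤ S ω ∧ ∀ t ≤ T, |V t ω| ≤ S ω)
    {t : ℝ≥0} (ht : t ≤ T) :
    (∫ ω, V t ω ^ 2 ∂μ) + (∫ ω, ∫ s in Set.Ioc t T, 𝒳.energy s ω (Z s ω) ∂leb ∂μ) / 2
      ≤ (∫ ω, ξ ω ^ 2 ∂μ) + 2 * (∫ ω, S ω * (∫ s in Set.Ioc 0 T, f₀ s ω ∂leb) ∂μ)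
        + 2 * (∫ ω, g ω * K T ω ∂μ)
        + 2 * (c' + c'' ^ 2) * ∫ ω, ∫ s in Set.Ioc t T, V s ω ^ 2 ∂leb ∂μ := by
  obtain ⟨hLi, hL1, hL2⟩ := h.energy_le ht
  obtain ⟨hei, hee⟩ := h.integrable_energy t
  rw [hee, ENNReal.ofReal_le_ofReal_iff hL2] at hL1
  have i1 : Integrable (fun ω => S ω * ∫ s in Set.Ioc 0 T, f₀ s ω ∂leb) μ :=
    hSm.integrable_mul hc.f₀_memLp
  have i2 : Integrable (fun ω => g ω * K T ω) μ := hc.g_memLp.integrable_mul h.K_memL2.2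
  have i3 := h.integrable_integral_sq_V t le_rfl
  have i4 : Integrable (fun ω => S ω * (∫ s in Set.Ioc 0 T, f₀ s ω ∂leb)
      + (c' + c'' ^ 2) * (∫ s in Set.Ioc t T, V s ω ^ 2 ∂leb)) μ := i1.add (i3.const_mul _)
  have i5 : Integrable (fun ω => S ω * (∫ s in Set.Ioc 0 T, f₀ s ω ∂leb)
      + (c' + c'' ^ 2) * (∫ s in Set.Ioc t T, V s ω ^ 2 ∂leb)
      + (∫ s in Set.Ioc t T, 𝒳.energy s ω (Z s ω) ∂leb) / 4) μ := i4.add (hei.div_const 4)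
  have hle := integral_mono_ae hLi (i5.add i2) (by
    filter_upwards [hc.ae_abs_integral_mul_le h hS t, h.ae_good, hS, hc.K_le] with ω h1 h2 h3 h4
    exact add_le_add h1 ((h.setIntegral_le_pathMeasure h2 h3.2 t).trans h4))
  simp only [Pi.add_apply] at hle
  rw [integral_add i5 i2, integral_add i4 (hei.div_const 4), integral_add i1 (i3.const_mul _),
    integral_const_mul, integral_div] at hle
  linarith

theorem integral_sq_abs_F_le (hc : IsControlled 𝒳 T c' c'' F V Z K f₀ g)
    (h : IsReflectedPath 𝒳 T ξ F V Z K) :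
    ∫ ω, (∫ s in Set.Ioc 0 T, |F s ω| ∂leb) ^ 2 ∂μ
      ≤ 3 * (∫ ω, (∫ s in Set.Ioc 0 T, f₀ s ω ∂leb) ^ 2 ∂μ)
        + 3 * c' ^ 2 * T * (∫ ω, ∫ s in Set.Ioc 0 T, V s ω ^ 2 ∂leb ∂μ)
        + 3 * c'' ^ 2 * T * (∫ ω, ∫ s in Set.Ioc 0 T, 𝒳.energy s ω (Z s ω) ∂leb ∂μ) := by
  obtain ⟨S, hSm, hS, -⟩ := h.exists_sup
  have i1 := hc.f₀_memLp.integrable_sq.const_mul 3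
  have i2 := (h.integrable_integral_sq_V 0 le_rfl).const_mul (3 * c' ^ 2 * T)
  have i3 := (h.integrable_energy 0).1.const_mul (3 * c'' ^ 2 * T)
  have i12 : Integrable (fun ω => 3 * (∫ s in Set.Ioc 0 T, f₀ s ω ∂leb) ^ 2
        + 3 * c' ^ 2 * T * (∫ s in Set.Ioc 0 T, V s ω ^ 2 ∂leb)) μ := i1.add i2
  have hle := integral_mono_ae h.F_memLp.integrable_sq (i12.add i3)
    (hc.ae_sq_integral_abs_F_le h hS)
  simp only [Pi.add_apply] at hle
  rwa [integral_add i12 i3, integral_add i1 i2, integral_const_mul, integral_const_mul,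
    integral_const_mul] at hle

/-- Each of the two products with `K_T` is split so as to cost an eighth of `K_T²`; after doubling,
half of `E K_T²` remains on the left. -/
theorem integral_sq_K_le (hc : IsControlled 𝒳 T c' c'' F V Z K f₀ g)
    (h : IsReflectedPath 𝒳 T ξ F V Z K) :
    ∫ ω, K T ω ^ 2 ∂μ ≤ 8 * (∫ ω, g ω ^ 2 ∂μ) + 16 * (∫ ω, ξ ω ^ 2 ∂μ)
      + 16 * ∫ ω, (∫ s in Set.Ioc 0 T, |F s ω| ∂leb) ^ 2 ∂μ := by
  obtain ⟨hq, hle⟩ := h.integral_sq_K_le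
  have iK := h.K_memL2.2.integrable_sq
  have ig := hc.g_memLp.integrable_sq
  have iξ := h.ξ_memL2.2.integrable_sq
  have iF := h.F_memLp.integrable_sq
  have iE : Integrable (fun ω => K T ω * (|ξ ω| + ∫ s in Set.Ioc 0 T, |F s ω| ∂leb)) μ :=
    h.K_memL2.2.integrable_mul (h.ξ_memL2.2.abs.add h.F_memLp)
  have i1 : Integrable (fun ω => K T ω ^ 2 / 8 + 2 * g ω ^ 2) μ :=
    (iK.div_const 8).add (ig.const_mul 2)
  have h1 := integral_mono_ae hq i1 (by
    filter_upwards [hc.K_le] with ω hω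
    refine hω.trans ?_
    have := sq_nonneg (K T ω / 4 - g ω)
    change g ω * K T ω ≤ K T ω ^ 2 / 8 + 2 * g ω ^ 2
    nlinarith [sq_nonneg (g ω)])
  have i2 : Integrable (fun ω => K T ω ^ 2 / 8 + 4 * ξ ω ^ 2) μ :=
    (iK.div_const 8).add (iξ.const_mul 4)
  have i3 : Integrable (fun ω => K T ω ^ 2 / 8 + 4 * ξ ω ^ 2
      + 4 * (∫ s in Set.Ioc 0 T, |F s ω| ∂leb) ^ 2) μ := i2.add (iF.const_mul 4)
  have h2 := integral_mono iE i3 (fun ω => by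
    change K T ω * (|ξ ω| + ∫ s in Set.Ioc 0 T, |F s ω| ∂leb) ≤ K T ω ^ 2 / 8 + 4 * ξ ω ^ 2
      + 4 * (∫ s in Set.Ioc 0 T, |F s ω| ∂leb) ^ 2
    rw [← sq_abs (ξ ω)]
    linarith [sq_nonneg (K T ω / 4 - 2 * |ξ ω|), sq_nonneg (K T ω / 4 -
      2 * ∫ s in Set.Ioc 0 T, |F s ω| ∂leb)])
  rw [integral_add (iK.div_const 8) (ig.const_mul 2), integral_const_mul, integral_div] at h1
  rw [integral_add i2 (iF.const_mul 4), integral_add (iK.div_const 8) (iξ.const_mul 4),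
    integral_const_mul, integral_const_mul, integral_div] at h2
  linarith

end probability

end IsControlled

/-- The a priori estimate for a controlled reflected path, with a constant depending only on the
growth constants and the horizon. -/
theorem exists_const_estimate {c' c'' : ℝ} (hc' : 0 ≤ c') (T : ℝ≥0) :
    ∃ C : ℝ, 0 < C ∧ ∀ {Ω : Type*} [MeasurableSpace Ω] (μ : Measure Ω) [IsProbabilityMeasure μ]
      (N : ℕ) (𝒳 : MarkovChain N μ) (ξ : Ω → ℝ) (F V : ℝ≥0 → Ω → ℝ) (Z : ℝ≥0 → Ω → (Fin N → ℝ))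
      (K f₀ : ℝ≥0 → Ω → ℝ) (g : Ω → ℝ), IsReflectedPath 𝒳 T ξ F V Z K →
      IsControlled 𝒳 T c' c'' F V Z K f₀ g →
      ∃ S : Ω → ℝ, MemLp S 2 μ ∧ (∀ᵐ ω ∂μ, ∀ t ≤ T, |V t ω| ≤ S ω) ∧
        (∫ ω, S ω ^ 2 ∂μ) + (∫ ω, ∫ s in Set.Ioc 0 T, 𝒳.energy s ω (Z s ω) ∂leb ∂μ)
          + (∫ ω, K T ω ^ 2 ∂μ)
        ≤ C * ((∫ ω, ξ ω ^ 2 ∂μ) + (∫ ω, g ω ^ 2 ∂μ)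
          + ∫ ω, (∫ s in Set.Ioc 0 T, f₀ s ω ∂leb) ^ 2 ∂μ) := by
  set b : ℝ := 2 * (c' + c'' ^ 2) with hb
  have hb0 : 0 ≤ b := by positivity
  obtain ⟨C, hC, hfin⟩ := exists_absorption_const (gronwallConst_nonneg b T)
    (by positivity : 0 ≤ 2 * b) (by positivity : 0 ≤ 3 * c' ^ 2 * T)
    (by positivity : 0 ≤ 3 * c'' ^ 2 * T)
  refine ⟨C, hC, ?_⟩
  intro Ω _ μ _ N 𝒳 ξ F V Z K f₀ g h hc
  obtain ⟨S, hSm, hS, hSle⟩ := h.exists_sup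
  refine ⟨S, hSm, hS.mono fun ω hω => hω.2, ?_⟩
  -- All terms of the energy inequality that do not depend on `t`. The unknowns `S` and `K T` still
  -- occur here, in products with the data that will be absorbed.
  set a : ℝ := (∫ ω, ξ ω ^ 2 ∂μ) + 2 * (∫ ω, S ω * (∫ s in Set.Ioc 0 T, f₀ s ω ∂leb) ∂μ)
        + 2 * (∫ ω, g ω * K T ω ∂μ) with ha
  set ψ : ℝ≥0 → ℝ := fun t => ∫ ω, ∫ s in Set.Ioc t T, V s ω ^ 2 ∂leb ∂μ with hψ
  have hsqV : ∀ t, 0 ≤ ∫ ω, V t ω ^ 2 ∂μ := fun t => integral_nonneg fun ω => sq_nonneg _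
  have hz0 : ∀ t, 0 ≤ ∫ ω, ∫ s in Set.Ioc t T, 𝒳.energy s ω (Z s ω) ∂leb ∂μ := fun t =>
    integral_nonneg fun ω => integral_nonneg fun s => 𝒳.energy_nonneg _ _ _
  have henergy : ∀ t ≤ T, (∫ ω, V t ω ^ 2 ∂μ)
      + (∫ ω, ∫ s in Set.Ioc t T, 𝒳.energy s ω (Z s ω) ∂leb ∂μ) / 2 ≤ a + b * ψ t :=
    fun t ht => hc.energy_le h hSm hS ht
  have hψT : ψ T = 0 := by simp [hψ]
  have hψ0 : ∀ t, 0 ≤ ψ t := fun t => integral_nonneg fun ω => integral_nonneg fun s => sq_nonneg _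
  have ha0 : 0 ≤ a := by
    have := henergy T le_rfl
    rw [hψT] at this
    linarith [hsqV T, hz0 T]
  have hψmono : ∀ s t, s ≤ t → t ≤ T → ψ t ≤ ψ s := by
    intro s t hst ht
    refine integral_mono_ae (h.integrable_integral_sq_V t le_rfl)
      (h.integrable_integral_sq_V s le_rfl) ?_
    filter_upwards [hS] with ω hω
    exact setIntegral_mono_set (h.memLp_V_path hω.2 s).integrable_sq
      (Eventually.of_forall fun r => sq_nonneg _) (Set.Ioc_subset_Ioc hst le_rfl).eventuallyLE
  -- For `r` in `(s, t]` the energy inequality gives `E V_r² ≤ a + b ψ r`, and `ψ r ≤ ψ s` because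
  -- the domain of integration shrinks.
  have hgr : ψ 0 ≤ gronwallConst b T * a := by
    refine le_gronwallConst_mul ha0 hψT hψ0 fun s t hst ht => ?_
    refine h.integral_sq_V_le hst ht fun r hr => ?_
    have h1 := henergy r (hr.2.trans ht)
    have h2 := mul_le_mul_of_nonneg_left (hψmono s r hr.1.le (hr.2.trans ht)) hb0
    linarith [hz0 r]
  refine hfin _ _ _ (ψ 0) _ _ _ (∫ ω, (∫ s in Set.Ioc 0 T, |F s ω| ∂leb) ^ 2 ∂μ) a
    (integral_nonneg fun ω => sq_nonneg _) (integral_nonneg fun ω => sq_nonneg _)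
    (integral_nonneg fun ω => sq_nonneg _) ha0 hgr ?_ (hc.integral_sq_abs_F_le h)
    (hc.integral_sq_K_le h) ?_ ?_
  · linarith [henergy 0 zero_le, hsqV 0]
  -- The factor `12` is Doob's `4` times the `3` from squaring a sum of three terms.
  · have i1 := h.ξ_memL2.2.integrable_sq
    have i2 := h.F_memLp.integrable_sq
    have i3 := h.K_memL2.2.integrable_sq
    have i12 : Integrable (fun ω => ξ ω ^ 2 + (∫ s in Set.Ioc 0 T, |F s ω| ∂leb) ^ 2) μ := i1.add i2
    have h1 := integral_mono h.memLp_sup_bound.integrable_sq ((i12.add i3).const_mul 3)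
      (fun ω => by
        change (|ξ ω| + (∫ s in Set.Ioc 0 T, |F s ω| ∂leb) + K T ω) ^ 2
          ≤ 3 * (ξ ω ^ 2 + (∫ s in Set.Ioc 0 T, |F s ω| ∂leb) ^ 2 + K T ω ^ 2)
        rw [← sq_abs (ξ ω)]
        generalize (∫ s in Set.Ioc 0 T, |F s ω| ∂leb) = A
        nlinarith [sq_nonneg (|ξ ω| - A), sq_nonneg (|ξ ω| - K T ω), sq_nonneg (A - K T ω)])
    rw [integral_const_mul] at h1
    simp only [Pi.add_apply] at h1
    rw [integral_add i12 i3, integral_add i1 i2] at h1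
    linarith
  · intro ε hε
    have h1 := IsControlled.two_mul_integral_mul_le hSm hc.f₀_memLp hε
    have h2 := IsControlled.two_mul_integral_mul_le h.K_memL2.2 hc.g_memLp hε
    simp only [mul_comm (K T _)] at h2
    linarith

end MarkovRBSDE
end

/-! ### From a solution of the reflected equation to a controlled path -/

noncomputable section

namespace MarkovRBSDE

variable {Ω : Type*} [mΩ : MeasurableSpace Ω] {N : ℕ} {μ : Measure Ω}

/-- Cauchy–Schwarz in time, then integration over the probability space. -/
theorem memLp_integral_abs_of_lintegral_sq_lt_top {u : ℝ≥0 × Ω → ℝ} (hu : Measurable u) {T : ℝ≥0}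
    (hfin : ∫⁻ ω, ∫⁻ t in Set.Ioc 0 T, ENNReal.ofReal (u (t, ω) ^ 2) ∂leb ∂μ < ∞) :
    (∀ᵐ ω ∂μ, MemLp (fun s => u (s, ω)) 2 (leb.restrict (Set.Ioc 0 T))) ∧
      MemLp (fun ω => ∫ s in Set.Ioc 0 T, |u (s, ω)| ∂leb) 2 μ := by
  have hm2 : Measurable fun ω => ∫⁻ t in Set.Ioc 0 T, ENNReal.ofReal (u (t, ω) ^ 2) ∂leb :=
    (hu.pow_const 2).ennreal_ofReal.lintegral_prod_left'
  have hmem : ∀ᵐ ω ∂μ, MemLp (fun s => u (s, ω)) 2 (leb.restrict (Set.Ioc 0 T)) := by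
    filter_upwards [ae_lt_top hm2 hfin.ne] with ω hω
    have h1 : Measurable fun s => u (s, ω) := hu.comp measurable_prodMk_right
    refine (memLp_two_iff_integrable_sq h1.aestronglyMeasurable).2
      ⟨(h1.pow_const 2).aestronglyMeasurable, ?_⟩
    exact (hasFiniteIntegral_iff_ofReal (Eventually.of_forall fun _ => sq_nonneg _)).2 hω
  refine ⟨hmem, ?_⟩
  have hm1 : Measurable fun ω => ∫ s in Set.Ioc 0 T, |u (s, ω)| ∂leb :=
    (hu.abs.stronglyMeasurable.integral_prod_left').measurable
  refine (memLp_two_iff_integrable_sq hm1.aestronglyMeasurable).2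
    ⟨(hm1.pow_const 2).aestronglyMeasurable, ?_⟩
  rw [hasFiniteIntegral_iff_ofReal (Eventually.of_forall fun _ => sq_nonneg _)]
  have hle : ∀ᵐ ω ∂μ, ENNReal.ofReal ((∫ s in Set.Ioc 0 T, |u (s, ω)| ∂leb) ^ 2)
      ≤ T * ∫⁻ t in Set.Ioc 0 T, ENNReal.ofReal (u (t, ω) ^ 2) ∂leb := by
    filter_upwards [hmem] with ω hω
    have h1 := sq_integral_abs_le _ hω
    rw [measureReal_restrict_apply_univ, leb_real_Ioc zero_le, NNReal.coe_zero, sub_zero] at h1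
    refine (ENNReal.ofReal_le_ofReal h1).trans ?_
    rw [ENNReal.ofReal_mul T.coe_nonneg, ENNReal.ofReal_coe_nnreal, ofReal_integral_eq_lintegral_ofReal
      hω.integrable_sq (Eventually.of_forall fun _ => sq_nonneg _)]
  refine (lintegral_mono_ae hle).trans_lt ?_
  rw [lintegral_const_mul _ hm2]
  exact ENNReal.mul_lt_top ENNReal.coe_lt_top hfin

theorem MarkovChain.measurableSet_filtration_of_null (𝒳 : MarkovChain N μ) {B : Set Ω}
    (hB : MeasurableSet B) (hB0 : μ B = 0) (t : ℝ≥0) : MeasurableSet[𝒳.filtration t] B :=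
  (le_sup_right : MeasurableSpace.generateFrom {B | MeasurableSet B ∧ μ B = 0} ≤ _) _
    (MeasurableSpace.measurableSet_generateFrom ⟨hB, hB0⟩)

/-- An adapted process with almost surely right-continuous paths has an adapted version all of
whose paths are right-continuous. -/
theorem MarkovChain.exists_rightContinuous_version (𝒳 : MarkovChain N μ) {T : ℝ≥0}
    {V : ℝ≥0 → Ω → ℝ} (hV : ∀ t ≤ T, Measurable[𝒳.filtration t] (V t))
    (hc : ∀ᵐ ω ∂μ, IsRCLLOn T fun t => V t ω) :
    ∃ W : ℝ≥0 → Ω → ℝ, (∀ᵐ ω ∂μ, ∀ t, W t ω = V t ω) ∧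
      (∀ t ≤ T, Measurable[𝒳.filtration t] (W t)) ∧
      ∀ ω, ∀ t < T, ContinuousWithinAt (fun s => W s ω) (Set.Ici t) t := by
  -- The exceptional scenarios lie in a measurable null set, which belongs to every `F_t` by
  -- completion; setting `V` to zero there preserves adaptedness.
  set B := toMeasurable μ {ω | ¬ IsRCLLOn T fun t => V t ω} with hB
  have hB0 : μ B = 0 := by rw [hB, measure_toMeasurable]; exact hc
  have hBm : MeasurableSet B := measurableSet_toMeasurable _ _
  refine ⟨fun t => Bᶜ.indicator (V t), ?_, fun t ht => ?_, fun ω t ht => ?_⟩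
  · filter_upwards [measure_eq_zero_iff_ae_notMem.1 hB0] with ω hω t
    exact Set.indicator_of_mem hω _
  · exact (hV t ht).indicator (𝒳.measurableSet_filtration_of_null hBm hB0 t).compl
  · by_cases hω : ω ∈ B
    · simp only [Set.indicator_of_notMem (Set.notMem_compl_iff.2 hω)]
      exact continuousWithinAt_const
    · simp only [Set.indicator_of_mem (show ω ∈ Bᶜ from hω)]
      have : IsRCLLOn T fun t => V t ω := by
        by_contra hn
        exact hω (subset_toMeasurable _ _ hn)
      exact this.1 t ht

namespace IsDriver

variable {𝒳 : MarkovChain N μ} {T : ℝ≥0} {c' c'' : ℝ} {f : ℝ≥0 → Ω → ℝ → (Fin N → ℝ) → ℝ}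

theorem measurable_zero (hf : IsDriver 𝒳 T c' c'' f) :
    Measurable fun p : ℝ≥0 × Ω => f p.1 p.2 0 0 := by
  have h1 : Measurable[𝒳.filtration.predictable] fun p : ℝ≥0 × Ω => f p.1 p.2 0 0 :=
    hf.measurable.comp (Measurable.prodMk (@measurable_id _ 𝒳.filtration.predictable)
      (measurable_const (a := ((0 : ℝ), (0 : Fin N → ℝ)))))
  exact h1.mono 𝒳.predictable_le le_rfl

/-- The driver along a right-continuous adapted process and a predictable one is progressive. -/
theorem progressive (hf : IsDriver 𝒳 T c' c'' f) {V : ℝ≥0 → Ω → ℝ} {Z : ℝ≥0 → Ω → (Fin N → ℝ)}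
    (hV : ∀ t ≤ T, Measurable[𝒳.filtration t] (V t))
    (hVc : ∀ ω, ∀ t < T, ContinuousWithinAt (fun s => V s ω) (Set.Ici t) t)
    (hZ : IsStronglyPredictable 𝒳.filtration Z) {t : ℝ≥0} (ht : t ≤ T) :
    Measurable[Prod.instMeasurableSpace (m₂ := 𝒳.filtration t)]
      fun p : ℝ≥0 × Ω => f (min p.1 t) p.2 (V (min p.1 t) p.2) (Z (min p.1 t) p.2) := by
  have h1 := @MarkovChain.measurable_stopped_of_predictable _ _ _ _ 𝒳 (ℝ≥0 × Ω)
    𝒳.filtration.predictable id (@measurable_id _ 𝒳.filtration.predictable) t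
  have h2 := measurable_stopped_of_rightContinuous (m := 𝒳.filtration t) (t := t) (Y := V)
    (fun s hs => (hV s (hs.trans ht)).mono (𝒳.filtration.mono hs) le_rfl)
    (fun ω s hs => hVc ω s (hs.trans_le ht))
  have h3 := 𝒳.measurable_stopped_of_predictable hZ.measurable t
  exact hf.measurable.comp (Measurable.prodMk h1 (Measurable.prodMk h2 h3))

/-- The Lipschitz condition compares with the arguments `(0, 0)`. The semi-norm built on `X_{s-}`
equals the square root of the energy except at the null set of jump times. -/
theorem ae_abs_le (hf : IsDriver 𝒳 T c' c'' f) (V : ℝ≥0 → Ω → ℝ) (Z : ℝ≥0 → Ω → (Fin N → ℝ)) :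
    ∀ᵐ ω ∂μ, ∀ᵐ s ∂leb.restrict (Set.Ioc 0 T), |f s ω (V s ω) (Z s ω)|
      ≤ |f s ω 0 0| + c' * |V s ω| + c'' * √(𝒳.energy s ω (Z s ω)) := by
  filter_upwards [hf.lipschitz] with ω hω
  filter_upwards [𝒳.ae_Xleft_eq_X ω leb 0 T, ae_restrict_mem measurableSet_Ioc] with s h1 h2
  have h3 := hω s h2.1 h2.2 (V s ω) 0 (Z s ω) 0
  rw [sub_zero, sub_zero, MarkovChain.seminorm, 𝒳.normSq_eq_energy h1] at h3
  have h4 := abs_add_le (f s ω 0 0) (f s ω (V s ω) (Z s ω) - f s ω 0 0)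
  rw [add_sub_cancel] at h4
  linarith

theorem lintegral_sq_zero_lt_top (hf : IsDriver 𝒳 T c' c'' f) :
    ∫⁻ ω, ∫⁻ t in Set.Ioc 0 T, ENNReal.ofReal (f t ω 0 0 ^ 2) ∂leb ∂μ < ∞ := by
  have h := hf.sqIntegrable
  simpa only [fun ω => setLIntegral_congr (f := fun t => ENNReal.ofReal (f t ω 0 0 ^ 2))
    (leb_Icc_ae_eq T)] using h

end IsDriver

namespace IsSolution

variable {𝒳 : MarkovChain N μ} {T : ℝ≥0} {c' c'' : ℝ} {ξ : Ω → ℝ}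
  {f : ℝ≥0 → Ω → ℝ → (Fin N → ℝ) → ℝ} {G V W : ℝ≥0 → Ω → ℝ} {Z : ℝ≥0 → Ω → (Fin N → ℝ)}
  {K : ℝ≥0 → Ω → ℝ}

/-- The point is the square integrability of `∫ |F|`: by the growth bound it reduces to that of the
time integrals of `|f(·,0,0)|`, `|V|` and the root of the energy. -/
theorem isReflectedPath (h : IsSolution 𝒳 T ξ f G V Z K) (hξ : 𝒳.MemL2 T ξ)
    (hf : IsDriver 𝒳 T c' c'' f)
    (hWV : ∀ᵐ ω ∂μ, ∀ t, W t ω = V t ω) (hW : ∀ t ≤ T, Measurable[𝒳.filtration t] (W t))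
    (hWc : ∀ ω, ∀ t < T, ContinuousWithinAt (fun s => W s ω) (Set.Ici t) t) :
    IsReflectedPath 𝒳 T ξ (fun s ω => f s ω (W s ω) (Z s ω)) W Z K := by
  have hWm : Measurable fun p : ℝ≥0 × Ω => W (min p.1 T) p.2 :=
    measurable_stopped_of_rightContinuous
      (fun s hs => (hW s hs).mono (𝒳.filtration.le s) le_rfl) hWc
  have henergy : ∫⁻ ω, ∫⁻ s in Set.Ioc 0 T, ENNReal.ofReal (𝒳.energy s ω (Z s ω)) ∂leb ∂μ < ∞ := by
    have := h.Z_sqIntegrable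
    simpa only [𝒳.lintegral_normSq_eq] using this
  obtain ⟨f1, f2⟩ := memLp_integral_abs_of_lintegral_sq_lt_top hf.measurable_zero
    hf.lintegral_sq_zero_lt_top
  obtain ⟨e1, e2⟩ := memLp_integral_abs_of_lintegral_sq_lt_top (μ := μ) (T := T)
    (𝒳.measurable_energy h.Z_predictable).sqrt (by
      simpa only [Real.sq_sqrt (𝒳.energy_nonneg _ _ _)] using henergy)
  obtain ⟨v1, v2⟩ := memLp_integral_abs_of_lintegral_sq_lt_top (μ := μ) (T := T) hWm (by
    refine lt_of_le_of_lt (lintegral_mono_ae ?_) h.V_sqIntegrable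
    filter_upwards [hWV] with ω hω
    rw [setLIntegral_congr (leb_Icc_ae_eq T)]
    refine (setLIntegral_congr_fun measurableSet_Ioc fun s hs => ?_).le
    simp only [min_eq_left hs.2, hω])
  have hprog := fun t (ht : t ≤ T) => hf.progressive hW hWc h.Z_predictable ht
  have hFm : Measurable fun p : ℝ≥0 × Ω =>
      f (min p.1 T) p.2 (W (min p.1 T) p.2) (Z (min p.1 T) p.2) :=
    (hprog T le_rfl).mono (sup_le_sup_left (MeasurableSpace.comap_mono (𝒳.filtration.le T)) _)
      le_rfl
  have hFi : ∀ᵐ ω ∂μ, IntegrableOn (fun s => |f s ω 0 0| + c' * |W (min s T) ω|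
      + c'' * |√(𝒳.energy s ω (Z s ω))|) (Set.Ioc 0 T) leb := by
    filter_upwards [f1, e1, v1] with ω a1 a2 a3
    exact ((a1.integrable one_le_two).abs.add ((a3.integrable one_le_two).abs.const_mul c')).add
      ((a2.integrable one_le_two).abs.const_mul c'')
  have hFle : ∀ᵐ ω ∂μ, ∀ᵐ s ∂leb.restrict (Set.Ioc 0 T), |f s ω (W s ω) (Z s ω)|
      ≤ |f s ω 0 0| + c' * |W (min s T) ω| + c'' * |√(𝒳.energy s ω (Z s ω))| := by
    filter_upwards [hf.ae_abs_le W Z] with ω hω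
    filter_upwards [hω, ae_restrict_mem measurableSet_Ioc] with s h1 h2
    rwa [min_eq_left h2.2, abs_of_nonneg (Real.sqrt_nonneg _)]
  refine ⟨hξ, hW, hWc, h.Z_predictable, henergy, hprog, ?_, ?_, h.K_memL2, ?_, h.K_zero, ?_, ?_⟩
  · filter_upwards [hFi, hFle] with ω h1 h2
    refine Integrable.mono' h1 ?_ h2
    refine (hFm.comp (measurable_prodMk_right (y := ω))).aestronglyMeasurable.congr
      (g := fun s => f s ω (W s ω) (Z s ω)) ?_
    filter_upwards [ae_restrict_mem measurableSet_Ioc] with s hs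
    simp only [Function.comp_apply, min_eq_left hs.2]
  · refine ((f2.add (v2.const_mul c')).add (e2.const_mul c'')).mono ?_ ?_
    · have h1 := (hFm.abs.stronglyMeasurable.integral_prod_left'
        (μ := leb.restrict (Set.Ioc 0 T))).aestronglyMeasurable (μ := μ)
      convert h1 using 2 with ω
      refine setIntegral_congr_fun measurableSet_Ioc fun s hs => ?_
      simp only [min_eq_left hs.2]
    · filter_upwards [hFi, hFle, f1, e1, v1] with ω h1 h2 a1 a2 a3
      have i1 := (a1.integrable one_le_two).abs
      have i2 := (a3.integrable one_le_two).abs.const_mul c'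
      have i3 := (a2.integrable one_le_two).abs.const_mul c''
      have h3 := integral_mono_of_nonneg (Eventually.of_forall fun s => abs_nonneg _) h1 h2
      have i12 : Integrable (fun s => |f s ω 0 0| + c' * |W (min s T) ω|)
        (leb.restrict (Set.Ioc 0 T)) := i1.add i2
      rw [integral_add i12 i3, integral_add i1 i2, integral_const_mul, integral_const_mul] at h3
      rw [Real.norm_of_nonneg (integral_nonneg fun s => abs_nonneg _)]
      exact h3.trans (le_abs_self _)
  · filter_upwards [h.equation, hWV] with ω h1 h2
    simpa only [h2] using h1
  · exact h.reflection.mono fun ω hω => hω.1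
  · exact h.reflection.mono fun ω hω => hω.2.1

/-- Where `K` increases, the solution is dominated by the supremum of the obstacle. -/
theorem ae_integral_pathMeasure_le (h : IsSolution 𝒳 T ξ f G V Z K) (hG : IsObstacle μ T G)
    {F : ℝ≥0 → Ω → ℝ} (hp : IsReflectedPath 𝒳 T ξ F W Z K)
    (hWV : ∀ᵐ ω ∂μ, ∀ t, W t ω = V t ω) :
    ∀ᵐ ω ∂μ, ∀ r : ℝ, (∀ t ≤ T, max (G t ω) 0 ≤ r) →
      ∫ s in Set.Ioc 0 T, max (W s ω) 0 ∂pathMeasure T K ω ≤ r * K T ω := by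
  filter_upwards [h.reflection, hp.ae_good, hWV] with ω href g hω r hr
  obtain ⟨hmono, hcont, hintg⟩ := href
  rw [← g.pathMeasure_eq] at hintg
  have hfin := g.isFiniteMeasure
  have hGm : Measurable fun s => G s ω := hG.measurable.comp measurable_prodMk_right
  simp only [← hω] at hintg
  have hWm := hp.aestronglyMeasurable_V ω (pathMeasure T K ω) measurableSet_Icc
    (Set.Subset.refl (Set.Icc 0 T))
  have hWG : AEMeasurable (fun s => W s ω - G s ω)
      ((pathMeasure T K ω).restrict (Set.Icc 0 T)) := hWm.aemeasurable.sub hGm.aemeasurable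
  rw [lintegral_eq_zero_iff' hWG.ennreal_ofReal] at hintg
  -- The vanishing integral forces `W ≤ G` at `dK`-almost every time, so the bound for `G⁺` passes
  -- to the positive part of `W`.
  have hle : ∀ᵐ s ∂(pathMeasure T K ω).restrict (Set.Ioc 0 T), max (W s ω) 0 ≤ r := by
    filter_upwards [ae_restrict_of_ae_restrict_of_subset Set.Ioc_subset_Icc_self hintg,
      ae_restrict_mem measurableSet_Ioc] with s h1 h2
    have h3 : W s ω - G s ω ≤ 0 := ENNReal.ofReal_eq_zero.1 h1
    exact (max_le_max (by linarith) le_rfl).trans (hr s h2.2)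
  have h1 := integral_mono_of_nonneg (Eventually.of_forall fun s => le_max_right _ _)
    (integrable_const r) hle
  rwa [integral_const, measureReal_restrict_apply_univ, g.pathMeasure_real_Ioc zero_le le_rfl,
    g.zero, sub_zero, smul_eq_mul, mul_comm] at h1

/-- The supremum of `G⁺` over uncountably many times need not be measurable, so it cannot serve as
`g`. The quotient of `∫ W⁺ dK` by `K_T` is measurable, lies below that supremum, and makes the
required bound an equality where `K_T ≠ 0`. -/
theorem exists_obstacle_bound [IsProbabilityMeasure μ] (h : IsSolution 𝒳 T ξ f G V Z K)
    (hG : IsObstacle μ T G) {F : ℝ≥0 → Ω → ℝ} (hp : IsReflectedPath 𝒳 T ξ F W Z K)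
    (hWV : ∀ᵐ ω ∂μ, ∀ t, W t ω = V t ω) :
    ∃ g : Ω → ℝ, MemLp g 2 μ ∧
      (∀ᵐ ω ∂μ, ∫ s in Set.Ioc 0 T, max (W s ω) 0 ∂pathMeasure T K ω ≤ g ω * K T ω) ∧
      ENNReal.ofReal (∫ ω, g ω ^ 2 ∂μ)
        ≤ ∫⁻ ω, ⨆ t ∈ Set.Icc 0 T, ENNReal.ofReal ((G t ω)⁺ ^ 2) ∂μ := by
  have hq := hp.integral_sq_K_le.1
  have hbound := h.ae_integral_pathMeasure_le hG hp hWV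
  have hle : ∀ᵐ ω ∂μ, ENNReal.ofReal
      (((∫ s in Set.Ioc 0 T, max (W s ω) 0 ∂pathMeasure T K ω) / K T ω) ^ 2)
      ≤ ⨆ t ∈ Set.Icc 0 T, ENNReal.ofReal ((G t ω)⁺ ^ 2) := by
    filter_upwards [hbound, hp.ae_good] with ω h1 h2
    set σ := ⨆ t ∈ Set.Icc 0 T, ENNReal.ofReal ((G t ω)⁺ ^ 2) with hσ
    rcases eq_or_ne σ ∞ with htop | htop
    · rw [htop]; exact le_top
    have hr : ∀ t ≤ T, max (G t ω) 0 ≤ √σ.toReal := by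
      intro t ht
      refine Real.le_sqrt_of_sq_le ((ENNReal.ofReal_le_iff_le_toReal htop).1 ?_)
      exact le_iSup₂ (f := fun t (_ : t ∈ Set.Icc 0 T) => ENNReal.ofReal ((G t ω)⁺ ^ 2)) t
        ⟨zero_le, ht⟩
    rw [ENNReal.ofReal_le_iff_le_toReal htop, ← Real.sq_sqrt (ENNReal.toReal_nonneg (a := σ))]
    have hK := h2.K_nonneg le_rfl
    exact pow_le_pow_left₀ (div_nonneg (integral_nonneg fun s => le_max_right _ _) hK)
      (div_le_of_le_mul₀ hK (Real.sqrt_nonneg _) (h1 _ hr)) 2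
  have hintg := lintegral_mono_ae hle
  have hgm : AEStronglyMeasurable (fun ω =>
      (∫ s in Set.Ioc 0 T, max (W s ω) 0 ∂pathMeasure T K ω) / K T ω) μ :=
    (hq.aestronglyMeasurable.aemeasurable.div hp.K_memL2.2.aestronglyMeasurable.aemeasurable
      ).aestronglyMeasurable
  have hgi : Integrable (fun ω =>
      ((∫ s in Set.Ioc 0 T, max (W s ω) 0 ∂pathMeasure T K ω) / K T ω) ^ 2) μ :=
    ⟨hgm.pow 2, (hasFiniteIntegral_iff_ofReal (Eventually.of_forall fun _ => sq_nonneg _)).2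
      (hintg.trans_lt hG.sqIntegrable)⟩
  refine ⟨_, (memLp_two_iff_integrable_sq hgm).2 hgi, ?_, ?_⟩
  · filter_upwards [hp.ae_good] with ω g
    -- If `K_T = 0` the quotient takes the default value `0`; this is harmless because `dK` then
    -- vanishes on `(0, T]`.
    rcases eq_or_ne (K T ω) 0 with h0 | h0
    · have h1 : pathMeasure T K ω (Set.Ioc 0 T) = 0 := by
        have hfin := g.isFiniteMeasure
        have h2 := g.pathMeasure_real_Ioc zero_le le_rfl
        rw [h0, g.zero, sub_zero] at h2
        exact (measureReal_eq_zero_iff).1 h2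
      rw [Measure.restrict_eq_zero.2 h1, h0]
      simp
    · rw [div_mul_cancel₀ _ h0]
  · rwa [ofReal_integral_eq_lintegral_ofReal hgi (Eventually.of_forall fun _ => sq_nonneg _)]

end IsSolution

end MarkovRBSDE

end

/-! ### The a priori estimate -/

theorem proposition3p1 (c' c'' : ℝ) (hc' : 0 ≤ c') (hc'' : 0 ≤ c'') (T : ℝ≥0) :
    ∃ C : ℝ, 0 < C ∧
      ∀ {Ω : Type*} [MeasurableSpace Ω] (μ : Measure Ω) [IsProbabilityMeasure μ]
        (N : ℕ) (𝒳 : MarkovRBSDE.MarkovChain N μ)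
        (ξ : Ω → ℝ) (f : ℝ≥0 → Ω → ℝ → (Fin N → ℝ) → ℝ) (G : ℝ≥0 → Ω → ℝ)
        (V : ℝ≥0 → Ω → ℝ) (Z : ℝ≥0 → Ω → (Fin N → ℝ)) (K : ℝ≥0 → Ω → ℝ),
        𝒳.MemL2 T ξ →
        MarkovRBSDE.IsDriver 𝒳 T c' c'' f →
        MarkovRBSDE.IsObstacle μ T G →
        MarkovRBSDE.IsSolution 𝒳 T ξ f G V Z K →
        (∫⁻ ω, ⨆ t ∈ Set.Icc 0 T, ENNReal.ofReal (|V t ω| ^ 2) ∂μ)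
            + (∫⁻ ω, ∫⁻ t in Set.Icc 0 T, ENNReal.ofReal (𝒳.normSq t ω (Z t ω)) ∂MarkovRBSDE.leb ∂μ)
            + (∫⁻ ω, ENNReal.ofReal (|K T ω| ^ 2) ∂μ)
          ≤ ENNReal.ofReal C *
            ∫⁻ ω, (ENNReal.ofReal (|ξ ω| ^ 2)
              + (⨆ t ∈ Set.Icc 0 T, ENNReal.ofReal ((G t ω)⁺ ^ 2))
              + (∫⁻ t in Set.Icc 0 T, ENNReal.ofReal |f t ω 0 0| ∂MarkovRBSDE.leb) ^ 2) ∂μ := by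
  obtain ⟨C, hC, hest⟩ := MarkovRBSDE.exists_const_estimate (c'' := c'') hc' T
  refine ⟨C, hC, ?_⟩
  intro Ω _ μ _ N 𝒳 ξ f G V Z K hξ hf hG hsol
  obtain ⟨W, hWV, hW, hWc⟩ := 𝒳.exists_rightContinuous_version hsol.V_adapted hsol.V_rcll
  have hp := hsol.isReflectedPath hξ hf hWV hW hWc
  obtain ⟨g, hg, hgK, hgG⟩ := hsol.exists_obstacle_bound hG hp hWV
  obtain ⟨f1, f2⟩ := MarkovRBSDE.memLp_integral_abs_of_lintegral_sq_lt_top hf.measurable_zero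
    hf.lintegral_sq_zero_lt_top
  have hcon : MarkovRBSDE.IsControlled 𝒳 T c' c'' (fun s ω => f s ω (W s ω) (Z s ω)) W Z K
      (fun s ω => |f s ω 0 0|) g :=
    ⟨fun _ _ => abs_nonneg _, f1.mono fun ω hω => (hω.integrable one_le_two).abs, f2,
      hf.ae_abs_le W Z, hg, hgK⟩
  obtain ⟨S, hS, hSV, hle⟩ := hest μ N 𝒳 ξ _ W Z K _ g hp hcon
  have hsup : ∫⁻ ω, ⨆ t ∈ Set.Icc 0 T, ENNReal.ofReal (|V t ω| ^ 2) ∂μ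
      ≤ ENNReal.ofReal (∫ ω, S ω ^ 2 ∂μ) := by
    rw [ofReal_integral_eq_lintegral_ofReal hS.integrable_sq
      (Eventually.of_forall fun _ => sq_nonneg _)]
    refine lintegral_mono_ae ?_
    filter_upwards [hSV, hWV] with ω h1 h2
    refine iSup₂_le fun t ht => ENNReal.ofReal_le_ofReal ?_
    rw [← h2]
    exact pow_le_pow_left₀ (abs_nonneg _) (h1 t ht.2) 2
  have hsq : ∀ {u : Ω → ℝ}, MemLp u 2 μ →
      ∫⁻ ω, ENNReal.ofReal (|u ω| ^ 2) ∂μ = ENNReal.ofReal (∫ ω, u ω ^ 2 ∂μ) := fun hu => by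
    simp only [sq_abs]
    exact (ofReal_integral_eq_lintegral_ofReal hu.integrable_sq
      (Eventually.of_forall fun _ => sq_nonneg _)).symm
  have hf0 : ∫⁻ ω, (∫⁻ t in Set.Icc 0 T, ENNReal.ofReal |f t ω 0 0| ∂MarkovRBSDE.leb) ^ 2 ∂μ
      = ENNReal.ofReal (∫ ω, (∫ s in Set.Ioc 0 T, |f s ω 0 0| ∂MarkovRBSDE.leb) ^ 2 ∂μ) := by
    rw [ofReal_integral_eq_lintegral_ofReal f2.integrable_sq
      (Eventually.of_forall fun _ => sq_nonneg _)]
    refine lintegral_congr_ae ?_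
    filter_upwards [f1] with ω hω
    rw [setLIntegral_congr (MarkovRBSDE.leb_Icc_ae_eq T), ← ofReal_integral_eq_lintegral_ofReal
      (hω.integrable one_le_two).abs (Eventually.of_forall fun _ => abs_nonneg _),
      ENNReal.ofReal_pow (integral_nonneg fun _ => abs_nonneg _)]
  have hfm : Measurable fun ω => (∫⁻ t in Set.Icc 0 T, ENNReal.ofReal |f t ω 0 0| ∂MarkovRBSDE.leb) ^ 2 :=
    (hf.measurable_zero.abs.ennreal_ofReal.lintegral_prod_left').pow_const 2
  have hξm : Measurable fun ω => ENNReal.ofReal (|ξ ω| ^ 2) :=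
    ((hξ.1.mono (𝒳.filtration.le T) le_rfl).abs.pow_const 2).ennreal_ofReal
  have hE0 : 0 ≤ ∫ ω, ∫ s in Set.Ioc 0 T, 𝒳.energy s ω (Z s ω) ∂MarkovRBSDE.leb ∂μ :=
    integral_nonneg fun _ => integral_nonneg fun _ => 𝒳.energy_nonneg _ _ _
  have hn : ∀ u : Ω → ℝ, 0 ≤ ∫ ω, u ω ^ 2 ∂μ := fun u => integral_nonneg fun _ => sq_nonneg _
  -- The expectation is split using measurability of the driver and terminal terms only, since the
  -- supremum of the obstacle may fail to be measurable.
  rw [lintegral_add_right _ hfm, lintegral_add_left hξm, hsq hξ.2, hf0, hsq hsol.K_memL2.2]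
  simp only [𝒳.lintegral_normSq_eq]
  rw [(hp.integrable_energy 0).2]
  calc _ ≤ ENNReal.ofReal (∫ ω, S ω ^ 2 ∂μ)
        + ENNReal.ofReal (∫ ω, ∫ s in Set.Ioc 0 T, 𝒳.energy s ω (Z s ω) ∂MarkovRBSDE.leb ∂μ)
        + ENNReal.ofReal (∫ ω, K T ω ^ 2 ∂μ) := by gcongr
    _ ≤ ENNReal.ofReal (C * ((∫ ω, ξ ω ^ 2 ∂μ) + (∫ ω, g ω ^ 2 ∂μ)
          + ∫ ω, (∫ s in Set.Ioc 0 T, |f s ω 0 0| ∂MarkovRBSDE.leb) ^ 2 ∂μ)) := by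
        rw [← ENNReal.ofReal_add (hn _) hE0, ← ENNReal.ofReal_add (add_nonneg (hn _) hE0) (hn _)]
        exact ENNReal.ofReal_le_ofReal hle
    _ ≤ _ := by
        rw [ENNReal.ofReal_mul hC.le, ENNReal.ofReal_add (add_nonneg (hn _) (hn _)) (hn _),
          ENNReal.ofReal_add (hn _) (hn _)]
        gcongr
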